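/- Let $\mathbb{D}=\{|z|<1\}$. Let $\mathcal{H}$ be the class of complex-valued harmonic functions $f$ in $\mathbb{D}$ with $f(0)=0$, $f_z(0)=1$, $f_{\bar z}(0)=0$; each is uniquely $f=h+\bar g$ with $h(z)=z+\sum_{n\ge2}a_nz^n$ and $g(z)=\sum_{n\ge2}b_nz^n$ analytic in $\mathbb{D}$. Let $\mathcal{A}\subset\mathcal{H}$ be the class of analytic $\varphi$ in $\mathbb D$ with $\varphi(0)=0$, $\varphi'(0)=1$; let $\mathcal{K}\subset\mathcal{A}$ be the univalent ones with convex range, and $\mathcal{W}=\{\varphi\in\mathcal{A}:\operatorname{Re}(\varphi'(z)+z\varphi''(z))>0 \text{ in } \mathbb{D}\}$. Let $$\mathcal{W}_H^0=\{f=h+\bar g\in\mathcal{H}:\ \operatorname{Re}(h'(z)+zh''(z))>|g'(z)+zg''(z)|\ \text{ for all } z\in\mathbb{D}\}.$$ Let $\mathcal{S}_H^0\subset\mathcal{H}$ be the univalent functions with $|f_z|^2-|f_{\bar z}|^2>0$ (sense-preserving) in $\mathbb D$, and let $\mathcal{SK}_H^0$ be the set of $f=h+\bar g\in\mathcal{S}_H^0$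 such that, for every $|\lambda|=1$, $h+\lambda\bar g$ belongs to $\mathcal{S}_H^0$ and has convex range. For analytic functions, $*$ is the Hadamard product $\sum u_nz^n*\sum v_nz^n=\sum u_nv_nz^n$; for $f_i=h_i+\bar g_i\in\mathcal{H}$ put $f_1*f_2=h_1*h_2+\overline{g_1*g_2}$, and for $\varphi\in\mathcal{A}$, $f=h+\bar g\in\mathcal{H}$ put $\varphi\,\tilde*\,f=\varphi*h+\overline{\varphi*g}$. **Theorem 3.5.** Let $f=h+\bar g\in\mathcal{W}_H^0$, with $h,g$ as above. Then $\big||a_n|-|b_n|\big|\le 2/n^2$ for $n=2,3,\dots$, and $$-|z|+2\int_0^{|z|}\frac{\log(1+t)}{t}\,dt\ \le\ |f(z)|\ \le\ -|z|-2\int_0^{|z|}\frac{\log(1-t)}{t}\,dt,\qquad z\in\mathbb{D}.$$ In particular $f(\mathbb{D})\supset\{|w|<\pi^2/6-1\}$. All these results are sharp for $f_0(z)=z+\sum_{n\ge2}\frac{2}{n^2}z^n$: this function lies in $\mathcal{W}_H^0$, it gives equality in the coefficient bound for every $n\ge2$, equality in the upper growth bound at $z=r$ and in the lower growth bound at $z=-r$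 for every $0\le r<1$, and $f_0(\mathbb{D})$ contains no disk $|w|<R$ with $R>\pi^2/6-1$. Moreover: (i) $\mathcal{W}_H^0$ is compact in the topology of locally uniform convergence in $\mathbb D$. (ii) $r_S(\mathcal{W}_H^0)=1=r_{CC}(\mathcal{W}_H^0)$. Here $r_S$ (resp. $r_{CC}$) is the largest $r\in(0,1]$ such that, for every $0<\rho\le r$, each member of the class is univalent and sense-preserving in $|z|<\rho$ and maps this disk onto a domain that is starlike with respect to $0$ (resp. close-to-convex, that is, whose complement is a union of closed half-lines with pairwise disjoint corresponding open half-lines). (iii) If $f_1,f_2\in\mathcal{W}_H^0$, then $f_1*f_2\in\mathcal{W}_H^0$. (iv) Let $f\in\mathcal{W}_H^0$. (a) If $\varphi\in\mathcal{K}$, then $\varphi\,\tilde*\,f\in\mathcal{W}_H^0$. (b) If $\varphi\in\mathcal{A}$ and $\operatorname{Re}(\varphi(z)/z)>1/2$ for $0<|z|<1$, then $\varphi\,\tilde*\,f\in\mathcal{W}_H^0$. (c) If $\varphi\in\mathcal{W}$, then $\varphi\,\tilde*\,f\in\mathcal{W}_H^0\cap\mathcal{SK}_H^0$. (v) $\mathcal{W}_H^0$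 is closed under convex combinations: if $f_n\in\mathcal{W}_H^0$, $t_n\ge0$ for $n\in\mathbb{N}$ and $\sum_n t_n=1$, then $\sum_n t_nf_n$ converges in $\mathbb{D}$ and its sum belongs to $\mathcal{W}_H^0$. -/

import Mathlib

open Complex ComplexConjugate

noncomputable section

namespace HarmonicAnalogue

/-- The open unit disk. -/
abbrev unitDisk : Set ℂ := Metric.ball (0 : ℂ) 1

/-- The Wirtinger derivative `∂f/∂z`. -/
def dz (f : ℂ → ℂ) (z : ℂ) : ℂ := (1 / 2) * (fderiv ℝ f z 1 - I * fderiv ℝ f z I)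

/-- The Wirtinger derivative `∂f/∂z̄`. -/
def dzbar (f : ℂ → ℂ) (z : ℂ) : ℂ := (1 / 2) * (fderiv ℝ f z 1 + I * fderiv ℝ f z I)

/-- The class of complex-valued harmonic functions in the unit disk normalized by
`f(0) = 0`, `f_z(0) = 1`, `f_z̄(0) = 0`. Functions are represented by maps `ℂ → ℂ`; only their
values in the unit disk matter, here and in all classes below. -/
def classH : Set (ℂ → ℂ) :=
  {f | InnerProductSpace.HarmonicOnNhd f unitDisk ∧ f 0 = 0 ∧ dz f 0 = 1 ∧ dzbar f 0 = 0}

/-- `f = h + conj g` in the unit disk, with `h` and `g` analytic there and `g(0) = 0`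
(so `h` and `g` are uniquely determined in the disk by `f`). -/
structure IsCanonical (f h g : ℂ → ℂ) : Prop where
  analytic_h : DifferentiableOn ℂ h unitDisk
  analytic_g : DifferentiableOn ℂ g unitDisk
  g_zero : g 0 = 0
  eq_on : ∀ z ∈ unitDisk, f z = h z + conj (g z)

/-- The normalized analytic functions in the unit disk. -/
def classA : Set (ℂ → ℂ) :=
  {f | DifferentiableOn ℂ f unitDisk ∧ f 0 = 0 ∧ deriv f 0 = 1}

/-- The normalized analytic univalent functions with convex range. -/
def classK : Set (ℂ → ℂ) :=
  {f | f ∈ classA ∧ Set.InjOn f unitDisk ∧ Convex ℝ (f '' unitDisk)}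

/-- Chichra's class: `Re (f' + z f'') > 0`. -/
def classW : Set (ℂ → ℂ) :=
  {f | f ∈ classA ∧ ∀ z ∈ unitDisk, 0 < (deriv f z + z * deriv (deriv f) z).re}

/-- The harmonic class `Re (h' + z h'') > |g' + z g''|`, where `f = h + conj g`. -/
def classWH0 : Set (ℂ → ℂ) :=
  {f | f ∈ classH ∧ ∃ h g : ℂ → ℂ, IsCanonical f h g ∧ ∀ z ∈ unitDisk,
    ‖deriv g z + z * deriv (deriv g) z‖ < (deriv h z + z * deriv (deriv h) z).re}

/-- `f` is sense-preserving on `s`: its Jacobian `|f_z|² - |f_z̄|²` is positive there. -/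
def SensePreservingOn (f : ℂ → ℂ) (s : Set ℂ) : Prop :=
  ∀ z ∈ s, 0 < ‖dz f z‖ ^ 2 - ‖dzbar f z‖ ^ 2

/-- The normalized harmonic functions that are univalent and sense-preserving in the disk. -/
def classSH0 : Set (ℂ → ℂ) :=
  {f | f ∈ classH ∧ Set.InjOn f unitDisk ∧ SensePreservingOn f unitDisk}

/-- The members of `classSH0` with convex range. -/
def classKH0 : Set (ℂ → ℂ) :=
  {f | f ∈ classSH0 ∧ Convex ℝ (f '' unitDisk)}

/-- The stable convex mappings: members `f = h + conj g` of `classSH0` such that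
`h + c * conj g` is a convex mapping for every `c` with `|c| = 1`. -/
def classSKH0 : Set (ℂ → ℂ) :=
  {f | f ∈ classSH0 ∧ ∃ h g : ℂ → ℂ, IsCanonical f h g ∧
    ∀ c : ℂ, ‖c‖ = 1 → (fun z => h z + c * conj (g z)) ∈ classKH0}

/-- The `n`-th Taylor coefficient at the origin. -/
def taylorCoeff (h : ℂ → ℂ) (n : ℕ) : ℂ := iteratedDeriv n h 0 / (n.factorial : ℂ)

/-- The convolution (Hadamard product) of two functions analytic in the unit disk. -/
def hadamard (h k : ℂ → ℂ) (z : ℂ) : ℂ := ∑' n : ℕ, taylorCoeff h n * taylorCoeff k n * z ^ n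

/-- The harmonic convolution of `h₁ + conj g₁` and `h₂ + conj g₂`. -/
def harmonicConv (h₁ g₁ h₂ g₂ : ℂ → ℂ) (z : ℂ) : ℂ :=
  hadamard h₁ h₂ z + conj (hadamard g₁ g₂ z)

/-- The product of an analytic function `φ` and the harmonic function `h + conj g`. -/
def mixedConv (φ h g : ℂ → ℂ) (z : ℂ) : ℂ :=
  hadamard h φ z + conj (hadamard g φ z)

/-- A close-to-convex domain: a domain whose complement is a union of closed half-lines
`{p + t u : t ≥ 0}` such that the corresponding open half-lines are pairwise disjoint. Half-lines
are encoded by pairs `(p, u)`. -/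
def IsCloseToConvexDomain (Ω : Set ℂ) : Prop :=
  IsOpen Ω ∧ IsConnected Ω ∧ ∃ S : Set (ℂ × ℂ),
    (∀ l ∈ S, l.2 ≠ 0) ∧
    S.Pairwise (fun l m => Disjoint
      {w : ℂ | ∃ t : ℝ, 0 < t ∧ w = l.1 + t * l.2} {w : ℂ | ∃ t : ℝ, 0 < t ∧ w = m.1 + t * m.2}) ∧
    Ωᶜ = ⋃ l ∈ S, {w : ℂ | ∃ t : ℝ, 0 ≤ t ∧ w = l.1 + t * l.2}

/-- `f` is starlike in `|z| < r`: univalent and sense-preserving there, onto a domain that is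
starlike with respect to the origin. -/
def StarlikeIn (f : ℂ → ℂ) (r : ℝ) : Prop :=
  Set.InjOn f (Metric.ball 0 r) ∧ SensePreservingOn f (Metric.ball 0 r) ∧
    StarConvex ℝ 0 (f '' Metric.ball 0 r)

/-- `f` is close-to-convex in `|z| < r`: univalent and sense-preserving there, onto a
close-to-convex domain. -/
def CloseToConvexIn (f : ℂ → ℂ) (r : ℝ) : Prop :=
  Set.InjOn f (Metric.ball 0 r) ∧ SensePreservingOn f (Metric.ball 0 r) ∧
    IsCloseToConvexDomain (f '' Metric.ball 0 r)

/-- `R` is the radius of the property `P` for the class `C`: the largest `R` in `(0, 1]` such that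
every member of `C` has the property in each disk `|z| < ρ` with `ρ ≤ R`. (For harmonic functions
starlikeness in a disk need not be inherited by smaller disks.) -/
def IsRadius (P : (ℂ → ℂ) → ℝ → Prop) (C : Set (ℂ → ℂ)) (R : ℝ) : Prop :=
  IsGreatest {r : ℝ | 0 < r ∧ r ≤ 1 ∧ ∀ f ∈ C, ∀ ρ : ℝ, 0 < ρ → ρ ≤ r → P f ρ} R

/-- The function `z + ∑_{n ≥ 2} (2 / n²) zⁿ`. -/
def extremal (z : ℂ) : ℂ := z + ∑' n : ℕ, 2 / ((n : ℂ) + 2) ^ 2 * z ^ (n + 2)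

end HarmonicAnalogue

end

open HarmonicAnalogue

/-! For analytic F write P = F' + zF''. Rotating g shows that h + conj g lies in the harmonic class
exactly when h + k g lies in Chichra's class for every |k| = 1 (`CoeffWH.coeffW`,
`coeffWH_of_coeffW`), so the harmonic claims reduce to analytic ones. The work is done on Taylor
coefficients: passing from F to P multiplies the n-th one by n², and Hadamard products are termwise.

For F in Chichra's class, P has positive real part and P(0) = 1. Carathéodory's bound on P gives the
coefficient bound 2/n² and, summed, the upper growth bound. Harnack's inequality Re P ≥ (1 - r)/(1 +
r), integrated twice along radii, gives the lower growth bound; the second integral is a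
dilogarithm. A choice of k that aligns or opposes the two parts carries these bounds over to h +
conj g, and the covering disk follows from the lower bound by connectedness.

The same integration yields Re F/z ≥ 1/2. Convolving a function of positive real part, with value 1
at 0, with one whose real part is at least 1/2 preserves positivity (`re_powSer_mul_pos`); this
gives all the convolution closures, convex factors being covered by the Marx–Strohhäcker theorem
(`half_le_re_div_of_classK`).

A first-boundary-point argument (`re_deriv_div_pos`) proves that F is starlike, and that zE' is
starlike when E is the convolution of two members of Chichra's class; the latter means that E is
convex. Shearing (`shear_segment`) passes from the analytic images to the harmonic one, and starlike
domains are close-to-convex.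

Compactness and countable convex combinations rest on the fact that the weak form of the defining
inequality already implies the strict one (`coeffWH_of_le`). The extremal function is the one with P
= (1 + z)/(1 - z). -/

noncomputable section
namespace HarmonicAnalogue
open Filter Topology

/-! ### Power series in the unit disk -/

/-- The sum of the power series with coefficients `c`. -/
def powSer (c : ℕ → ℂ) (z : ℂ) : ℂ := ∑' n, c n * z ^ n

/-- The power series with coefficients `c` converges in the unit disk. -/
def RadOne (c : ℕ → ℂ) : Prop := ∀ r : ℝ, 0 ≤ r → r < 1 → Summable fun n => ‖c n‖ * r ^ n

theorem RadOne.mono {c d : ℕ → ℂ} (hc : RadOne c) (h : ∀ n, ‖d n‖ ≤ ‖c n‖) : RadOne d := by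
  intro r h0 h1
  refine Summable.of_nonneg_of_le (fun n => by positivity) (fun n => ?_) (hc r h0 h1)
  exact mul_le_mul_of_nonneg_right (h n) (by positivity)

theorem radOne_of_bound {c : ℕ → ℂ} {B : ℝ} (h : ∀ n, ‖c n‖ ≤ B) : RadOne c := by
  intro r h0 h1
  refine Summable.of_nonneg_of_le (fun n => by positivity) (fun n => ?_)
    ((summable_geometric_of_lt_one h0 h1).mul_left B)
  exact mul_le_mul_of_nonneg_right (h n) (by positivity)

theorem RadOne.add {c d : ℕ → ℂ} (hc : RadOne c) (hd : RadOne d) : RadOne (fun n => c n + d n) := by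
  intro r h0 h1
  refine Summable.of_nonneg_of_le (fun n => by positivity) (fun n => ?_)
    ((hc r h0 h1).add (hd r h0 h1))
  rw [← add_mul]
  exact mul_le_mul_of_nonneg_right (norm_add_le _ _) (by positivity)

theorem RadOne.const_mul {c : ℕ → ℂ} (hc : RadOne c) (k : ℂ) : RadOne (fun n => k * c n) := by
  intro r h0 h1
  simpa [norm_mul, mul_assoc] using (hc r h0 h1).mul_left ‖k‖

theorem RadOne.shift {c : ℕ → ℂ} (hc : RadOne c) : RadOne (fun n => c (n + 1)) := by
  intro r h0 h1
  rcases h0.eq_or_lt with rfl | h0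
  · refine summable_of_ne_finset_zero (s := {0}) fun n hn => ?_
    simp at hn
    simp [hn]
  · have := ((summable_nat_add_iff 1).2 (hc r h0.le h1)).mul_left r⁻¹
    refine this.congr fun n => ?_
    field_simp
    ring

/-- The linear factor is absorbed by a slightly larger radius s: (n + 1)(r/s)^n is bounded. -/
theorem RadOne.mul_succ {c : ℕ → ℂ} (hc : RadOne c) : RadOne (fun n => ((n : ℂ) + 1) * c n) := by
  intro r h0 h1
  obtain ⟨s, hrs, hs1⟩ := exists_between h1
  have hs : 0 < s := h0.trans_lt hrs
  have hsum : Summable fun n : ℕ => ((n : ℝ) + 1) * (r / s) ^ n := by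
    have h2 : ‖r / s‖ < 1 := by
      rw [Real.norm_of_nonneg (by positivity)]
      exact (div_lt_one hs).2 hrs
    have := (summable_pow_mul_geometric_of_norm_lt_one 1 h2).add
      (summable_geometric_of_norm_lt_one h2)
    refine this.congr fun n => ?_
    ring
  obtain ⟨B, hB⟩ := hsum.tendsto_atTop_zero.bddAbove_range
  refine Summable.of_nonneg_of_le (fun n => by positivity) (fun n => ?_)
    ((hc s hs.le hs1).mul_left B)
  have h3 : ((n : ℝ) + 1) * (r / s) ^ n ≤ B := hB ⟨n, rfl⟩
  have h4 : ‖(n : ℂ) + 1‖ = (n : ℝ) + 1 := by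
    have : ((n : ℂ) + 1) = ((n + 1 : ℕ) : ℂ) := by push_cast; rfl
    rw [this, Complex.norm_natCast]; push_cast; rfl
  rw [norm_mul, h4]
  calc ((n : ℝ) + 1) * ‖c n‖ * r ^ n = (((n : ℝ) + 1) * (r / s) ^ n) * (‖c n‖ * s ^ n) := by
        rw [div_pow]; field_simp
    _ ≤ B * (‖c n‖ * s ^ n) := mul_le_mul_of_nonneg_right h3 (by positivity)

/-- The radius is split as r = √r · √r, one factor for each series; one of them needs only to be
bounded. -/
theorem RadOne.mul {c d : ℕ → ℂ} (hc : RadOne c) (hd : RadOne d) : RadOne (fun n => c n * d n) := by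
  intro r h0 h1
  have hs0 : 0 ≤ √r := Real.sqrt_nonneg r
  have hs1 : √r < 1 := by rw [Real.sqrt_lt' one_pos]; simpa using h1
  obtain ⟨B, hB⟩ := (hc _ hs0 hs1).tendsto_atTop_zero.bddAbove_range
  refine Summable.of_nonneg_of_le (fun n => by positivity) (fun n => ?_)
    ((hd _ hs0 hs1).mul_left B)
  have h3 : ‖c n‖ * √r ^ n ≤ B := hB ⟨n, rfl⟩
  calc ‖c n * d n‖ * r ^ n = (‖c n‖ * √r ^ n) * (‖d n‖ * √r ^ n) := by
        rw [norm_mul]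
        nth_rewrite 1 [← Real.mul_self_sqrt h0]
        rw [mul_pow]; ring
    _ ≤ _ := mul_le_mul_of_nonneg_right h3 (by positivity)

theorem RadOne.unshift {c : ℕ → ℂ} (hc : RadOne (fun n => c (n + 1))) : RadOne c := by
  intro r h0 h1
  rw [← summable_nat_add_iff 1]
  refine ((hc r h0 h1).mul_left r).congr fun n => ?_
  ring

theorem mem_disk {z : ℂ} : z ∈ unitDisk ↔ ‖z‖ < 1 := by simp [unitDisk]

theorem RadOne.summable_norm {c : ℕ → ℂ} (hc : RadOne c) {z : ℂ} (hz : ‖z‖ < 1) :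
    Summable fun n => ‖c n * z ^ n‖ := by
  simpa [norm_mul, norm_pow] using hc ‖z‖ (norm_nonneg z) hz

theorem RadOne.hasSum {c : ℕ → ℂ} (hc : RadOne c) {z : ℂ} (hz : ‖z‖ < 1) :
    HasSum (fun n => c n * z ^ n) (powSer c z) :=
  (hc.summable_norm hz).of_norm.hasSum

theorem powSer_add {c d : ℕ → ℂ} (hc : RadOne c) (hd : RadOne d) {z : ℂ} (hz : ‖z‖ < 1) :
    powSer (fun n => c n + d n) z = powSer c z + powSer d z := by
  refine HasSum.tsum_eq ?_
  simpa [add_mul] using (hc.hasSum hz).add (hd.hasSum hz)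

theorem powSer_const_mul (c : ℕ → ℂ) (k z : ℂ) :
    powSer (fun n => k * c n) z = k * powSer c z := by
  simp only [powSer, mul_assoc, tsum_mul_left]

theorem powSer_zero (c : ℕ → ℂ) : powSer c 0 = c 0 := by
  rw [powSer, tsum_eq_single 0]
  · simp
  · intro n hn; simp [hn]

theorem mul_powSer_shift {c : ℕ → ℂ} (hc : RadOne c) {z : ℂ} (hz : ‖z‖ < 1) :
    z * powSer (fun n => c (n + 1)) z = powSer c z - c 0 := by
  have h := (hasSum_nat_add_iff' 1).2 (hc.hasSum hz)
  simp only [Finset.range_one, Finset.sum_singleton, pow_zero, mul_one] at h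
  refine HasSum.unique ?_ h
  have := (hc.shift.hasSum hz).mul_left z
  convert! this using 2 with n
  ring

theorem hasDerivAt_powSer {c : ℕ → ℂ} (hc : RadOne c) {z : ℂ} (hz : ‖z‖ < 1) :
    HasDerivAt (powSer c) (powSer (fun n => ((n : ℂ) + 1) * c (n + 1)) z) z := by
  obtain ⟨r, hzr, hr1⟩ := exists_between hz
  have hr0 : 0 < r := (norm_nonneg z).trans_lt hzr
  have hs : Summable fun n : ℕ => ‖(n : ℂ) * c n‖ * r ^ (n - 1) := by
    rw [← summable_nat_add_iff 1]
    have : RadOne (fun n => ((n : ℂ) + 1) * c (n + 1)) := hc.shift.mul_succ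
    simpa using this r hr0.le hr1
  have h := hasDerivAt_tsum_of_isPreconnected (t := Metric.ball (0 : ℂ) r)
    (g := fun n z => c n * z ^ n) (g' := fun n z => c n * (n * z ^ (n - 1))) (y₀ := 0) (y := z)
    hs Metric.isOpen_ball (convex_ball _ _).isPreconnected
    (fun n y _ => (hasDerivAt_pow n y).const_mul (c n))
    (fun n y hy => by
      rw [← mul_assoc, norm_mul, mul_comm (c n), norm_pow]
      refine mul_le_mul_of_nonneg_left (pow_le_pow_left₀ (norm_nonneg _) ?_ _) (norm_nonneg _)
      simpa using (Metric.mem_ball.1 hy).le)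
    (by simpa using hr0) ((hc.hasSum (z := 0) (by simp)).summable) (by simpa using hzr)
  convert! h using 1
  have hs2 : Summable fun n : ℕ => c n * (n * z ^ (n - 1)) := by
    refine Summable.of_norm_bounded hs fun n => ?_
    rw [← mul_assoc, norm_mul, mul_comm (c n), norm_pow]
    exact mul_le_mul_of_nonneg_left (pow_le_pow_left₀ (norm_nonneg _) hzr.le _) (norm_nonneg _)
  rw [hs2.tsum_eq_zero_add]
  simp only [powSer, Nat.cast_zero, zero_mul, mul_zero, zero_add]
  refine tsum_congr fun n => ?_
  push_cast
  ring

theorem differentiableOn_powSer {c : ℕ → ℂ} (hc : RadOne c) :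
    DifferentiableOn ℂ (powSer c) unitDisk := fun _ hz =>
  (hasDerivAt_powSer hc (mem_disk.1 hz)).differentiableAt.differentiableWithinAt

theorem taylorCoeff_congr {f g : ℂ → ℂ} (h : Set.EqOn f g unitDisk) (n : ℕ) :
    taylorCoeff f n = taylorCoeff g n := by
  have : f =ᶠ[nhds 0] g := Filter.eventuallyEq_of_mem (Metric.ball_mem_nhds 0 one_pos) h
  rw [taylorCoeff, taylorCoeff, this.iteratedDeriv_eq]

theorem taylorCoeff_succ (f : ℂ → ℂ) (n : ℕ) :
    taylorCoeff f (n + 1) = taylorCoeff (deriv f) n / (n + 1) := by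
  rw [taylorCoeff, taylorCoeff, iteratedDeriv_succ', Nat.factorial_succ]
  push_cast
  rw [div_div, mul_comm]

theorem taylorCoeff_powSer {c : ℕ → ℂ} (hc : RadOne c) (n : ℕ) : taylorCoeff (powSer c) n = c n := by
  induction n generalizing c with
  | zero => simp [taylorCoeff, powSer_zero]
  | succ n ih =>
    rw [taylorCoeff_succ, taylorCoeff_congr (g := powSer (fun n => ((n : ℂ) + 1) * c (n + 1)))
      (fun z hz => (hasDerivAt_powSer hc (mem_disk.1 hz)).deriv), ih hc.shift.mul_succ]
    field_simp [Nat.cast_add_one_ne_zero n]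

theorem hasSum_taylorCoeff {f : ℂ → ℂ} (hf : DifferentiableOn ℂ f unitDisk) {z : ℂ}
    (hz : ‖z‖ < 1) : HasSum (fun n => taylorCoeff f n * z ^ n) (f z) := by
  convert! hasSum_taylorSeries_on_ball hf (mem_disk.2 hz) using 2 with n
  simp only [taylorCoeff, smul_eq_mul, sub_zero]
  field_simp

theorem radOne_taylorCoeff {f : ℂ → ℂ} (hf : DifferentiableOn ℂ f unitDisk) :
    RadOne (taylorCoeff f) := by
  intro r h0 h1
  have := (hasSum_taylorCoeff hf (z := r) (by simpa [abs_of_nonneg h0] using h1)).summable.norm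
  simpa [abs_of_nonneg h0] using this

theorem eqOn_powSer {f : ℂ → ℂ} (hf : DifferentiableOn ℂ f unitDisk) {z : ℂ} (hz : ‖z‖ < 1) :
    f z = powSer (taylorCoeff f) z := (hasSum_taylorCoeff hf hz).tsum_eq.symm

theorem taylorCoeff_zero (f : ℂ → ℂ) : taylorCoeff f 0 = f 0 := by simp [taylorCoeff]

theorem taylorCoeff_one (f : ℂ → ℂ) : taylorCoeff f 1 = deriv f 0 := by simp [taylorCoeff]

/-! ### Coefficient form of the classes -/

/-- The coefficients of `f' + z f''` for `f = powSer c`. -/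
def chichra (c : ℕ → ℂ) (n : ℕ) : ℂ := ((n : ℂ) + 1) * (((n : ℂ) + 1) * c (n + 1))

theorem RadOne.chichra {c : ℕ → ℂ} (hc : RadOne c) : RadOne (chichra c) := hc.shift.mul_succ.mul_succ

/-- The multiplier n + 1 is the operator V ↦ V + zV'. Applied to F/z it gives F', and applied to F'
it gives F' + zF''; this two-step ladder is climbed down in the growth estimates. -/
theorem powSer_mul_succ {c : ℕ → ℂ} (hc : RadOne c) {z : ℂ} (hz : ‖z‖ < 1) :
    powSer (fun n => ((n : ℂ) + 1) * c n) z = powSer c z + z * deriv (powSer c) z := by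
  rw [(hasDerivAt_powSer hc hz).deriv]
  have h1 : RadOne (fun n => (n : ℂ) * c n) := hc.mul_succ.mono fun n => by
    rw [norm_mul, norm_mul]
    refine mul_le_mul_of_nonneg_right ?_ (norm_nonneg _)
    have : ((n : ℂ) + 1) = ((n + 1 : ℕ) : ℂ) := by push_cast; rfl
    rw [this, Complex.norm_natCast, Complex.norm_natCast]; push_cast; linarith
  have h2 := mul_powSer_shift h1 hz
  push_cast at h2
  rw [h2]
  have h3 := powSer_add h1 hc hz
  simp only [zero_mul, sub_zero]
  rw [add_comm, ← h3]
  congr 1; ext n; ring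

theorem eventuallyEq_deriv {f g : ℂ → ℂ} (h : Set.EqOn f g unitDisk) :
    Set.EqOn (deriv f) (deriv g) unitDisk := fun _ hz =>
  (Filter.eventuallyEq_of_mem (Metric.isOpen_ball.mem_nhds hz) h).deriv_eq

theorem deriv_add_mul_deriv_deriv {f : ℂ → ℂ} (hf : DifferentiableOn ℂ f unitDisk) {z : ℂ}
    (hz : ‖z‖ < 1) :
    deriv f z + z * deriv (deriv f) z = powSer (chichra (taylorCoeff f)) z := by
  have hc := radOne_taylorCoeff hf
  have h1 : Set.EqOn (deriv f) (powSer (fun n => ((n : ℂ) + 1) * taylorCoeff f (n + 1))) unitDisk := by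
    intro w hw
    rw [eventuallyEq_deriv (fun w hw => eqOn_powSer hf (mem_disk.1 hw)) hw]
    exact (hasDerivAt_powSer hc (mem_disk.1 hw)).deriv
  rw [h1 (mem_disk.2 hz), eventuallyEq_deriv h1 (mem_disk.2 hz)]
  exact (powSer_mul_succ hc.shift.mul_succ hz).symm

/-- The coefficient sequences of the functions in `classW`. -/
structure CoeffW (c : ℕ → ℂ) : Prop where
  rad : RadOne c
  zero : c 0 = 0
  one : c 1 = 1
  re_pos : ∀ z : ℂ, ‖z‖ < 1 → 0 < (powSer (chichra c) z).re

theorem coeffW_of_mem {f : ℂ → ℂ} (hf : f ∈ classW) : CoeffW (taylorCoeff f) where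
  rad := radOne_taylorCoeff hf.1.1
  zero := by rw [taylorCoeff_zero, hf.1.2.1]
  one := by rw [taylorCoeff_one, hf.1.2.2]
  re_pos z hz := by
    rw [← deriv_add_mul_deriv_deriv hf.1.1 hz]
    exact hf.2 z (mem_disk.2 hz)

/-- The pairs of coefficient sequences of the functions `h + conj g` in `classWH0`. -/
structure CoeffWH (a b : ℕ → ℂ) : Prop where
  rad_a : RadOne a
  rad_b : RadOne b
  a_zero : a 0 = 0
  a_one : a 1 = 1
  b_zero : b 0 = 0
  b_one : b 1 = 0
  lt_re : ∀ z : ℂ, ‖z‖ < 1 → ‖powSer (chichra b) z‖ < (powSer (chichra a) z).re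

theorem powSer_chichra_add {a b : ℕ → ℂ} (ha : RadOne a) (hb : RadOne b) (k : ℂ) {z : ℂ}
    (hz : ‖z‖ < 1) : powSer (chichra (fun n => a n + k * b n)) z =
      powSer (chichra a) z + k * powSer (chichra b) z := by
  rw [← powSer_const_mul, ← powSer_add ha.chichra (hb.chichra.const_mul k) hz]
  congr 1; ext n; simp only [chichra]; ring

theorem CoeffWH.coeffW {a b : ℕ → ℂ} (h : CoeffWH a b) {k : ℂ} (hk : ‖k‖ ≤ 1) :
    CoeffW (fun n => a n + k * b n) where
  rad := h.rad_a.add (h.rad_b.const_mul k)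
  zero := by simp [h.a_zero, h.b_zero]
  one := by simp [h.a_one, h.b_one]
  re_pos z hz := by
    rw [powSer_chichra_add h.rad_a h.rad_b k hz, add_re]
    have h1 := h.lt_re z hz
    have h2 := neg_le_of_abs_le (Complex.abs_re_le_norm (k * powSer (chichra b) z))
    rw [norm_mul] at h2
    nlinarith [norm_nonneg (powSer (chichra b) z)]

/-- Every complex number can be rotated to the negative real half-line. -/
theorem exists_unit_mul_eq_neg_norm (w : ℂ) : ∃ k : ℂ, ‖k‖ = 1 ∧ k * w = -(‖w‖ : ℂ) := by
  by_cases hw : w = 0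
  · exact ⟨1, by simp, by simp [hw]⟩
  · have h0 : (‖w‖ : ℂ) ≠ 0 := by exact_mod_cast norm_ne_zero_iff.2 hw
    refine ⟨-(‖w‖ : ℂ) / w, ?_, by field_simp⟩
    rw [norm_div, norm_neg, Complex.norm_real, norm_norm, div_self (norm_ne_zero_iff.2 hw)]

/-- At each point some rotation k turns the co-analytic term into minus its modulus, so positivity
of the real part for that k is the required inequality. The normalizations come from k = 1 and k =
-1. -/
theorem coeffWH_of_coeffW {a b : ℕ → ℂ} (ha : RadOne a) (hb : RadOne b)
    (h : ∀ k : ℂ, ‖k‖ = 1 → CoeffW (fun n => a n + k * b n)) : CoeffWH a b := by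
  have h1 := h 1 (by simp)
  have h2 := h (-1) (by simp)
  have e1 := h1.zero; have e2 := h2.zero; have e3 := h1.one; have e4 := h2.one
  refine ⟨ha, hb, by linear_combination (e1 + e2) / 2, by linear_combination (e3 + e4) / 2,
    by linear_combination (e1 - e2) / 2, by linear_combination (e3 - e4) / 2, fun z hz => ?_⟩
  obtain ⟨k, hk, hkw⟩ := exists_unit_mul_eq_neg_norm (powSer (chichra b) z)
  have h3 := (h k hk).re_pos z hz
  rw [powSer_chichra_add ha hb k hz, hkw] at h3
  simpa using h3

/-! ### Functions with positive real part and their convolutions -/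

/-- Harnack's inequality for analytic functions with nonnegative real part. -/
theorem harnack {u : ℂ → ℂ} (hu : DifferentiableOn ℂ u unitDisk) (h0 : u 0 = 1)
    (hre : ∀ z, ‖z‖ < 1 → 0 ≤ (u z).re) {z : ℂ} (hz : ‖z‖ < 1) :
    (1 - ‖z‖) / (1 + ‖z‖) ≤ (u z).re := by
  have hne : ∀ w ∈ unitDisk, 1 + u w ≠ 0 := fun w hw h => by
    have := congrArg re h
    have h1 := hre w (mem_disk.1 hw)
    simp at this
    linarith
  -- Schwarz's lemma for the Cayley transform of u, which fixes the origin and maps into the closed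
  -- disk.
  have h1 : ‖(1 - u z) / (1 + u z)‖ ≤ ‖z‖ := by
    refine norm_le_norm_of_mapsTo_ball (f := fun z => (1 - u z) / (1 + u z))
      (((differentiableOn_const 1).sub hu).div ((differentiableOn_const 1).add hu) hne)
      (fun w hw => ?_) (by simp [h0]) hz
    have hx := hre w (mem_disk.1 hw)
    rw [mem_closedBall_zero_iff, norm_div]
    refine div_le_one_of_le₀ ?_ (norm_nonneg _)
    rw [← sq_le_sq₀ (norm_nonneg _) (norm_nonneg _), ← normSq_eq_norm_sq, ← normSq_eq_norm_sq,
      normSq_apply, normSq_apply]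
    simp
    nlinarith
  have hx := hre z hz
  rw [norm_div, div_le_iff₀ (norm_pos_iff.2 (hne z (mem_disk.2 hz))),
    ← sq_le_sq₀ (norm_nonneg _) (by positivity), mul_pow] at h1
  have e1 : ‖1 - u z‖ ^ 2 = (1 - (u z).re) ^ 2 + (u z).im ^ 2 := by
    rw [← normSq_eq_norm_sq, normSq_apply]; simp; ring
  have e2 : ‖1 + u z‖ ^ 2 = (1 + (u z).re) ^ 2 + (u z).im ^ 2 := by
    rw [← normSq_eq_norm_sq, normSq_apply]; simp; ring
  rw [e1, e2] at h1
  have hr := norm_nonneg z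
  rw [div_le_iff₀ (by positivity)]
  have hy : 0 ≤ (1 - ‖z‖ ^ 2) * ((u z).im * (u z).im) :=
    mul_nonneg (by nlinarith) (mul_self_nonneg _)
  have : (1 - (u z).re) ^ 2 ≤ (‖z‖ * (1 + (u z).re)) ^ 2 := by nlinarith
  have := abs_le_of_sq_le_sq this (by positivity)
  linarith [le_abs_self (1 - (u z).re)]

/-- Strict positivity is automatic once the value at 0 is 1; this lets weak inequalities pass to
limits and be upgraded afterwards. -/
theorem re_pos_of_nonneg {u : ℂ → ℂ} (hu : DifferentiableOn ℂ u unitDisk) (h0 : u 0 = 1)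
    (hre : ∀ z, ‖z‖ < 1 → 0 ≤ (u z).re) {z : ℂ} (hz : ‖z‖ < 1) : 0 < (u z).re :=
  (div_pos (by linarith) (by positivity)).trans_le (harnack hu h0 hre hz)

theorem integral_exp_int (k : ℤ) :
    ∫ θ in (0 : ℝ)..2 * Real.pi, cexp (k * θ * I) = if k = 0 then 2 * (Real.pi : ℂ) else 0 := by
  split_ifs with h
  · simp [h]
  · have hk : (k : ℂ) * I ≠ 0 := mul_ne_zero (by exact_mod_cast h) I_ne_zero
    have := integral_exp_mul_complex (a := 0) (b := 2 * Real.pi) hk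
    rw [show (fun θ : ℝ => cexp (k * θ * I)) = fun θ : ℝ => cexp (k * I * θ) by
      ext θ; ring_nf, this]
    have h1 : cexp (k * I * ((2 * Real.pi : ℝ) : ℂ)) = 1 := by
      rw [Complex.exp_eq_one_iff]; exact ⟨k, by push_cast; ring⟩
    rw [h1]; simp

/-- The sign s serves two cases: s = 1 leaves the diagonal and hence the Hadamard product, while s =
-1, arising from a conjugated series, leaves only the constant term. -/
theorem hasSum_integral_fourier {A B : ℕ → ℂ} (hA : Summable fun n => ‖A n‖)
    (hB : Summable fun n => ‖B n‖) (s : ℤ) :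
    HasSum (fun p : ℕ × ℕ => A p.1 * B p.2 *
        if s * p.1 - p.2 = 0 then 2 * (Real.pi : ℂ) else 0)
      (∫ θ in (0 : ℝ)..2 * Real.pi, (∑' m : ℕ, A m * cexp (s * θ * I) ^ m) *
        ∑' n : ℕ, B n * cexp (-θ * I) ^ n) := by
  have hAB : Summable fun p : ℕ × ℕ => ‖A p.1‖ * ‖B p.2‖ :=
    hA.mul_of_nonneg hB (fun _ => norm_nonneg _) (fun _ => norm_nonneg _)
  have hn1 : ∀ θ : ℝ, ‖cexp (s * θ * I)‖ = 1 := fun θ => by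
    rw [show ((s : ℂ) * θ * I) = ((s * θ : ℝ) : ℂ) * I by push_cast; ring, norm_exp_ofReal_mul_I]
  have hn2 : ∀ θ : ℝ, ‖cexp (-θ * I)‖ = 1 := fun θ => by
    rw [show (-(θ : ℂ) * I) = ((-θ : ℝ) : ℂ) * I by push_cast; ring, norm_exp_ofReal_mul_I]
  have hterm : ∀ (p : ℕ × ℕ) (θ : ℝ), A p.1 * cexp (s * θ * I) ^ p.1 * (B p.2 * cexp (-θ * I) ^ p.2)
      = A p.1 * B p.2 * cexp ((s * p.1 - p.2 : ℤ) * θ * I) := fun p θ => by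
    rw [← Complex.exp_nat_mul, ← Complex.exp_nat_mul]
    rw [show A p.1 * cexp (p.1 * (s * θ * I)) * (B p.2 * cexp (p.2 * (-θ * I))) =
      A p.1 * B p.2 * (cexp (p.1 * (s * θ * I)) * cexp (p.2 * (-θ * I))) by ring, ← Complex.exp_add]
    congr 2; push_cast; ring
  have := intervalIntegral.hasSum_integral_of_dominated_convergence (a := 0) (b := 2 * Real.pi)
    (μ := MeasureTheory.volume)
    (F := fun (p : ℕ × ℕ) (θ : ℝ) => A p.1 * B p.2 * cexp ((s * p.1 - p.2 : ℤ) * θ * I))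
    (f := fun θ : ℝ => (∑' m : ℕ, A m * cexp (s * θ * I) ^ m) * ∑' n : ℕ, B n * cexp (-θ * I) ^ n)
    (fun p _ => ‖A p.1‖ * ‖B p.2‖)
    (fun p => Continuous.aestronglyMeasurable (by fun_prop))
    (fun p => Filter.Eventually.of_forall fun θ _ => by
      rw [← hterm, norm_mul, norm_mul, norm_mul, norm_pow, norm_pow, hn1, hn2]; simp)
    (Filter.Eventually.of_forall fun θ _ => hAB) (by simp)
    (Filter.Eventually.of_forall fun θ _ => by
      have h1 : Summable fun m : ℕ => ‖A m * cexp (s * θ * I) ^ m‖ := by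
        simpa [norm_mul, norm_pow, hn1] using hA
      have h2 : Summable fun m : ℕ => ‖B m * cexp (-θ * I) ^ m‖ := by
        simpa only [norm_mul, norm_pow, hn2, one_pow, mul_one] using hB
      simp only [← hterm]
      rw [tsum_mul_tsum_of_summable_norm h1 h2]
      exact (summable_mul_of_summable_norm h1 h2).hasSum)
  convert! this using 2 with p
  rw [intervalIntegral.integral_const_mul, integral_exp_int]

theorem integral_fourier {A B : ℕ → ℂ} (hA : Summable fun n => ‖A n‖)
    (hB : Summable fun n => ‖B n‖) :
    ∫ θ in (0 : ℝ)..2 * Real.pi, (∑' m : ℕ, A m * cexp (θ * I) ^ m) *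
        ∑' n : ℕ, B n * cexp (-θ * I) ^ n = 2 * Real.pi * ∑' n, A n * B n := by
  have h := hasSum_integral_fourier hA hB 1
  simp only [Int.cast_one, one_mul] at h
  rw [← h.tsum_eq, ← tsum_mul_left]
  have hinj : Function.Injective fun n : ℕ => (n, n) := fun a b hab => (Prod.mk.inj hab).1
  rw [← hinj.tsum_eq]
  · refine tsum_congr fun n => ?_
    simp; ring
  · rintro ⟨m, n⟩ hp
    refine ⟨m, ?_⟩
    have : m = n := by
      by_contra hne
      refine hp ?_
      have : ¬ ((m : ℤ) - n = 0) := by omega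
      simp [this]
    simp [this]

theorem integral_fourier_conj {A B : ℕ → ℂ} (hA : Summable fun n => ‖A n‖)
    (hB : Summable fun n => ‖B n‖) :
    ∫ θ in (0 : ℝ)..2 * Real.pi, conj (∑' m : ℕ, A m * cexp (θ * I) ^ m) *
        ∑' n : ℕ, B n * cexp (-θ * I) ^ n = 2 * Real.pi * (conj (A 0) * B 0) := by
  have h := hasSum_integral_fourier (A := fun n => conj (A n)) (by simpa using hA) hB (-1)
  have h1 : ∀ θ : ℝ, conj (∑' m : ℕ, A m * cexp (θ * I) ^ m) =
      ∑' m : ℕ, conj (A m) * cexp ((-1 : ℤ) * θ * I) ^ m := fun θ => by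
    rw [Complex.conj_tsum]
    refine tsum_congr fun m => ?_
    rw [map_mul, map_pow, ← Complex.exp_conj]
    simp
  simp only [h1]
  rw [← h.tsum_eq, tsum_eq_single (0, 0)]
  · simp; ring
  · rintro ⟨m, n⟩ hp
    have : ¬ ((-1 : ℤ) * m - n = 0) := fun h => hp (by
      have h1 : m = 0 := by omega
      have h2 : n = 0 := by omega
      simp [h1, h2])
    dsimp only
    rw [if_neg this, mul_zero]

/-- The convolution of two functions with nonnegative real part, normalized by the value `1` at
the origin. -/
theorem neg_one_le_re_powSer_mul {P K : ℕ → ℂ} (hP : RadOne P) (hK : RadOne K) (hP0 : P 0 = 1)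
    (hK0 : K 0 = 1) (hPre : ∀ z, ‖z‖ < 1 → 0 ≤ (powSer P z).re)
    (hKre : ∀ z, ‖z‖ < 1 → 0 ≤ (powSer K z).re) {z : ℂ} (hz : ‖z‖ < 1) :
    -1 ≤ (powSer (fun n => P n * K n) z).re := by
  obtain ⟨r, hzr, hr1⟩ := exists_between hz
  have hr0 : 0 < r := (norm_nonneg z).trans_lt hzr
  have hrC : (r : ℂ) ≠ 0 := by exact_mod_cast hr0.ne'
  have hzr1 : ‖z / r‖ < 1 := by
    rw [norm_div, Complex.norm_real, Real.norm_of_nonneg hr0.le]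
    exact (div_lt_one hr0).2 hzr
  have hrn : ‖(r : ℂ)‖ < 1 := by simpa [abs_of_pos hr0] using hr1
  -- The point z is split as r · (z/r) with both factors inside the disk. The mean of (P + conj P)K
  -- over the circle is then the convolution at z plus 1, and the integrand 2 Re(P) K has
  -- nonnegative real part.
  set A : ℕ → ℂ := fun n => P n * (r : ℂ) ^ n with hA
  set B : ℕ → ℂ := fun n => K n * (z / r) ^ n with hB
  have sA : Summable fun n => ‖A n‖ := hP.summable_norm hrn
  have sB : Summable fun n => ‖B n‖ := hK.summable_norm hzr1
  have e1 := integral_fourier sA sB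
  have e2 := integral_fourier_conj sA sB
  have hn1 : ∀ θ : ℝ, ‖cexp (θ * I)‖ = 1 := fun θ => norm_exp_ofReal_mul_I θ
  have hn2 : ∀ θ : ℝ, ‖cexp (-θ * I)‖ = 1 := fun θ => by
    rw [show (-(θ : ℂ) * I) = ((-θ : ℝ) : ℂ) * I by push_cast; ring, norm_exp_ofReal_mul_I]
  have hp : ∀ θ : ℝ, ‖r * cexp (θ * I)‖ < 1 := fun θ => by
    rw [norm_mul, hn1, mul_one]; exact hrn
  have hk : ∀ θ : ℝ, ‖z / r * cexp (-θ * I)‖ < 1 := fun θ => by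
    rw [norm_mul, hn2, mul_one]; exact hzr1
  have eA : ∀ θ : ℝ, ∑' m : ℕ, A m * cexp (θ * I) ^ m = powSer P (r * cexp (θ * I)) := fun θ =>
    tsum_congr fun m => by simp only [hA]; ring
  have eB : ∀ θ : ℝ, ∑' m : ℕ, B m * cexp (-θ * I) ^ m = powSer K (z / r * cexp (-θ * I)) :=
    fun θ => tsum_congr fun m => by simp only [hB]; ring
  have eAB : ∑' n, A n * B n = powSer (fun n => P n * K n) z := tsum_congr fun n => by
    simp only [hA, hB]
    rw [show P n * (r : ℂ) ^ n * (K n * (z / r) ^ n) = P n * K n * ((r : ℂ) * (z / r)) ^ n by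
      rw [mul_pow]; ring, mul_div_cancel₀ _ hrC]
  simp only [eA, eB, eAB] at e1 e2
  have hA0 : A 0 = 1 := by simp [hA, hP0]
  have hB0 : B 0 = 1 := by simp [hB, hK0]
  rw [hA0, hB0] at e2
  have cP : Continuous fun θ : ℝ => powSer P (r * cexp (θ * I)) :=
    (differentiableOn_powSer hP).continuousOn.comp_continuous (by fun_prop)
      fun θ => mem_disk.2 (hp θ)
  have cK : Continuous fun θ : ℝ => powSer K (z / r * cexp (-θ * I)) :=
    (differentiableOn_powSer hK).continuousOn.comp_continuous (by fun_prop)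
      fun θ => mem_disk.2 (hk θ)
  have cF : Continuous fun θ : ℝ => powSer P (r * cexp (θ * I)) * powSer K (z / r * cexp (-θ * I)) +
      conj (powSer P (r * cexp (θ * I))) * powSer K (z / r * cexp (-θ * I)) :=
    (cP.mul cK).add ((continuous_conj.comp cP).mul cK)
  have e3 := intervalIntegral.integral_add (μ := MeasureTheory.volume)
    ((cP.mul cK).intervalIntegrable 0 (2 * Real.pi))
    (((continuous_conj.comp cP).mul cK).intervalIntegrable 0 (2 * Real.pi))
  simp only [Pi.mul_apply, Function.comp_apply] at e3
  rw [e1, e2] at e3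
  have e4 := intervalIntegral.intervalIntegral_re (cF.intervalIntegrable 0 (2 * Real.pi))
    (μ := MeasureTheory.volume)
  have e5 : 0 ≤ ∫ θ in (0 : ℝ)..2 * Real.pi,
      RCLike.re (powSer P (r * cexp (θ * I)) * powSer K (z / r * cexp (-θ * I)) +
      conj (powSer P (r * cexp (θ * I))) * powSer K (z / r * cexp (-θ * I))) := by
    refine intervalIntegral.integral_nonneg (by positivity) fun θ _ => ?_
    have key : ∀ p k : ℂ, 0 ≤ p.re → 0 ≤ k.re → 0 ≤ (p * k + conj p * k).re := by
      intro p k h1 h2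
      simp
      nlinarith [mul_nonneg h1 h2]
    exact key _ _ (hPre _ (hp θ)) (hKre _ (hk θ))
  rw [e4, e3] at e5
  have h6 : 0 ≤ 2 * Real.pi * ((powSer (fun n => P n * K n) z).re + 1) := by
    refine e5.trans_eq ?_
    simp; ring
  have := nonneg_of_mul_nonneg_right h6 (by positivity)
  linarith

/-- The convolution of a function with positive real part and a function with real part at least
`1 / 2` has positive real part. -/
theorem re_powSer_mul_pos {P G : ℕ → ℂ} (hP : RadOne P) (hG : RadOne G) (hP0 : P 0 = 1)
    (hG0 : G 0 = 1) (hPre : ∀ z, ‖z‖ < 1 → 0 ≤ (powSer P z).re)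
    (hGre : ∀ z, ‖z‖ < 1 → 1 / 2 ≤ (powSer G z).re) {z : ℂ} (hz : ‖z‖ < 1) :
    0 < (powSer (fun n => P n * G n) z).re := by
  have hPG := hP.mul hG
  refine re_pos_of_nonneg (differentiableOn_powSer hPG) (by rw [powSer_zero, hP0, hG0, one_mul])
    (fun w hw => ?_) hz
  set δ : ℕ → ℂ := fun n => if n = 0 then -1 else 0 with hδ
  have rδ : RadOne δ := radOne_of_bound (B := 1) fun n => by
    by_cases h : n = 0 <;> simp [hδ, h]
  have sδ : ∀ w, powSer δ w = -1 := fun w => by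
    rw [powSer, tsum_eq_single 0] <;> simp +contextual [hδ]
  -- The second factor is 2G - 1, which has nonnegative real part. Its convolution with P is 2(P *
  -- G) - 1, so the lower bound -1 turns into nonnegativity.
  have h1 := neg_one_le_re_powSer_mul hP ((hG.const_mul 2).add rδ) hP0
    (by simp [hG0, hδ]; norm_num) hPre (fun w hw => by
      rw [powSer_add (hG.const_mul 2) rδ hw, powSer_const_mul, sδ]
      have := hGre w hw
      simp
      linarith) hw
  have h2 : (fun n => P n * (2 * G n + δ n)) = fun n => 2 * (P n * G n) + δ n := by
    ext n
    by_cases h : n = 0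
    · simp [h, hδ, hP0]
    · simp [h, hδ]; ring
  rw [h2, powSer_add (hPG.const_mul 2) rδ hw, powSer_const_mul, sδ] at h1
  simp at h1
  linarith

/-- Carathéodory's coefficient bound. -/
theorem norm_coeff_le_two {P : ℕ → ℂ} (hP : RadOne P) (hP0 : P 0 = 1)
    (hPre : ∀ z, ‖z‖ < 1 → 0 ≤ (powSer P z).re) {n : ℕ} (hn : n ≠ 0) : ‖P n‖ ≤ 2 := by
  obtain ⟨k, hk, hkP⟩ := exists_unit_mul_eq_neg_norm (P n)
  -- The test function 1 + (k/2) zⁿ has real part at least 1/2. Convolving at real s gives 1 - |P_n|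
  -- sⁿ/2 > 0, and then s tends to 1.
  set G : ℕ → ℂ := fun m => if m = 0 then 1 else if m = n then k / 2 else 0 with hG
  have rG : RadOne G := radOne_of_bound (B := 1) fun m => by
    by_cases h : m = 0
    · simp [hG, h]
    · by_cases h' : m = n <;> simp [hG, h, h', hk, hn]; norm_num
  have sG : ∀ (Q : ℕ → ℂ) (w : ℂ), powSer (fun m => Q m * G m) w = Q 0 + Q n * (k / 2) * w ^ n := by
    intro Q w
    rw [powSer, tsum_eq_sum (s := {0, n})]
    · rw [Finset.sum_pair hn.symm]; simp [hG, hn]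
    · intro m hm
      simp at hm
      simp [hG, hm]
  have key : ∀ s : ℝ, 0 < s → s < 1 → ‖P n‖ * s ^ n ≤ 2 := fun s h0 h1 => by
    have := re_powSer_mul_pos hP rG hP0 (by simp [hG]) hPre (fun w hw => by
      have h2 := sG (fun _ => 1) w
      simp only [one_mul] at h2
      rw [h2, add_re, one_re]
      have h3 := neg_le_of_abs_le (Complex.abs_re_le_norm (k / 2 * w ^ n))
      rw [norm_mul, norm_div, hk, norm_pow] at h3
      have h4 : ‖w‖ ^ n ≤ 1 := pow_le_one₀ (norm_nonneg _) hw.le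
      simp at h3 ⊢
      linarith) (z := s) (by simpa [abs_of_pos h0] using h1)
    rw [sG, hP0, show P n * (k / 2) = k * P n / 2 by ring, hkP] at this
    have h5 : ((1 : ℂ) + -(‖P n‖ : ℂ) / 2 * (s : ℂ) ^ n).re = 1 - ‖P n‖ * s ^ n / 2 := by
      rw [show ((1 : ℂ) + -(‖P n‖ : ℂ) / 2 * (s : ℂ) ^ n) =
        ((1 - ‖P n‖ * s ^ n / 2 : ℝ) : ℂ) by push_cast; ring, ofReal_re]
    rw [h5] at this
    linarith
  have hlim : Filter.Tendsto (fun s : ℝ => ‖P n‖ * s ^ n) (nhdsWithin 1 (Set.Iio 1))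
      (nhds (‖P n‖ * 1 ^ n)) := tendsto_nhdsWithin_of_tendsto_nhds
      ((continuous_const.mul (continuous_pow n)).tendsto 1)
  rw [one_pow, mul_one] at hlim
  refine le_of_tendsto hlim ?_
  filter_upwards [Ioo_mem_nhdsLT (zero_lt_one (α := ℝ))] with s hs using key s hs.1 hs.2

/-! ### The dilogarithm and the logarithmic integrals -/

/-- The dilogarithm on the interval `[-1, 1]`. -/
def dilog (x : ℝ) : ℝ := ∑' n : ℕ, x ^ (n + 1) / ((n : ℝ) + 1) ^ 2

theorem summable_one_div_succ_sq : Summable fun n : ℕ => 1 / ((n : ℝ) + 1) ^ 2 := by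
  have := (summable_nat_add_iff 1).2 (Real.summable_one_div_nat_pow.2 one_lt_two)
  simpa using this

theorem norm_dilog_term_le {x : ℝ} (hx : |x| ≤ 1) (n : ℕ) :
    ‖x ^ (n + 1) / ((n : ℝ) + 1) ^ 2‖ ≤ 1 / ((n : ℝ) + 1) ^ 2 := by
  rw [norm_div, norm_pow, Real.norm_eq_abs, Real.norm_of_nonneg (by positivity)]
  gcongr
  exact pow_le_one₀ (abs_nonneg x) hx

theorem hasSum_dilog {x : ℝ} (hx : |x| ≤ 1) :
    HasSum (fun n : ℕ => x ^ (n + 1) / ((n : ℝ) + 1) ^ 2) (dilog x) :=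
  (Summable.of_norm_bounded summable_one_div_succ_sq (norm_dilog_term_le hx)).hasSum

theorem continuousOn_dilog : ContinuousOn dilog (Set.Icc (-1) 1) :=
  continuousOn_tsum (fun n => by fun_prop) summable_one_div_succ_sq
    fun n _ hx => norm_dilog_term_le (abs_le.2 hx) n

theorem dilog_zero : dilog 0 = 0 := by simp [dilog]

/-- The origin is excluded because the quotient takes the value 0 there, whereas the derivative of
the series is 1. -/
theorem hasDerivAt_dilog {x : ℝ} (hx : |x| < 1) (hx0 : x ≠ 0) :
    HasDerivAt dilog (-Real.log (1 - x) / x) x := by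
  obtain ⟨r, hxr, hr1⟩ := exists_between hx
  have hr0 : 0 < r := (abs_nonneg x).trans_lt hxr
  have h := hasDerivAt_tsum_of_isPreconnected (t := Metric.ball (0 : ℝ) r)
    (g := fun (n : ℕ) (x : ℝ) => x ^ (n + 1) / ((n : ℝ) + 1) ^ 2)
    (g' := fun n x => x ^ n / ((n : ℝ) + 1)) (y₀ := 0) (y := x) (u := fun n => r ^ n)
    (summable_geometric_of_lt_one hr0.le hr1) Metric.isOpen_ball (convex_ball _ _).isPreconnected
    (fun n y _ => by
      convert! (hasDerivAt_pow (n + 1) y).div_const (((n : ℝ) + 1) ^ 2) using 1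
      push_cast
      field_simp)
    (fun n y hy => by
      rw [norm_div, norm_pow, Real.norm_of_nonneg (by positivity : (0 : ℝ) ≤ n + 1)]
      have h1 : ‖y‖ ^ n ≤ r ^ n :=
        pow_le_pow_left₀ (norm_nonneg _) (by simpa using (Metric.mem_ball.1 hy).le) _
      exact (div_le_self (by positivity) (by linarith [(n.cast_nonneg : (0 : ℝ) ≤ n)])).trans h1)
    (by simpa using hr0) (hasSum_dilog (x := 0) (by simp)).summable (by simpa using hxr)
  convert! h using 1
  have h2 := (Real.hasSum_pow_div_log_of_abs_lt_one hx).div_const x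
  rw [← h2.tsum_eq]
  refine tsum_congr fun n => ?_
  field_simp
  ring

theorem dilog_one : dilog 1 = Real.pi ^ 2 / 6 := by
  have h := (hasSum_nat_add_iff' 1).2 hasSum_zeta_two
  simp at h
  rw [dilog, ← h.tsum_eq]
  simp

/-- The terms with even denominator base are a quarter of ζ(2), namely π²/24; the remaining ones sum
to π²/8 and change sign. -/
theorem dilog_neg_one : dilog (-1) = -Real.pi ^ 2 / 12 := by
  have h1 := hasSum_dilog (x := 1) (by simp)
  rw [dilog_one] at h1
  simp only [one_pow] at h1
  have hodd : HasSum (fun k : ℕ => 1 / (((2 * k + 1 : ℕ) : ℝ) + 1) ^ 2) (Real.pi ^ 2 / 24) := by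
    convert! h1.div_const 4 using 1
    · ext k; push_cast; field_simp; ring
    · ring
  have heven : HasSum (fun k : ℕ => 1 / (((2 * k : ℕ) : ℝ) + 1) ^ 2) (Real.pi ^ 2 / 8) := by
    have h2 : Summable (fun k : ℕ => 1 / (((2 * k : ℕ) : ℝ) + 1) ^ 2) :=
      Summable.comp_injective (f := fun n : ℕ => 1 / ((n : ℝ) + 1) ^ 2) h1.summable
        (i := fun k : ℕ => 2 * k) fun a b h => by simpa using h
    have h3 := (HasSum.even_add_odd (f := fun n : ℕ => 1 / ((n : ℝ) + 1) ^ 2)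
      h2.hasSum hodd).unique h1
    have h4 : ∑' k : ℕ, 1 / (((2 * k : ℕ) : ℝ) + 1) ^ 2 = Real.pi ^ 2 / 8 := by linarith
    exact h4 ▸ h2.hasSum
  have h5 : HasSum (fun n : ℕ => (-1 : ℝ) ^ (n + 1) / ((n : ℝ) + 1) ^ 2)
      (-(Real.pi ^ 2 / 8) + Real.pi ^ 2 / 24) := by
    refine HasSum.even_add_odd ?_ ?_
    · convert! heven.neg using 2 with k
      rw [pow_succ, pow_mul]; simp; ring
    · convert! hodd using 2 with k
      rw [pow_succ, pow_succ, pow_mul]; simp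
  rw [dilog, h5.tsum_eq]; ring

/-- The value of the integrand at 0 plays no role: continuity on the closed interval and a
derivative on the open one suffice, and integrability comes from the constant sign. -/
theorem integral_log_one_sub {r : ℝ} (h0 : 0 ≤ r) (h1 : r < 1) :
    ∫ t in (0 : ℝ)..r, 1 / t * Real.log (1 - t) = -dilog r := by
  have hc : ContinuousOn dilog (Set.Icc 0 r) :=
    continuousOn_dilog.mono (Set.Icc_subset_Icc (by norm_num) h1.le)
  have hd : ∀ x ∈ Set.Ioo 0 r, HasDerivAt dilog (-Real.log (1 - x) / x) x := fun x hx =>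
    hasDerivAt_dilog (by rw [abs_of_pos hx.1]; exact hx.2.trans h1) hx.1.ne'
  have hi := intervalIntegral.integrableOn_deriv_of_nonneg hc hd fun x hx =>
    div_nonneg (neg_nonneg.2 (Real.log_nonpos (by linarith [hx.2]) (by linarith [hx.1]))) hx.1.le
  have h := intervalIntegral.integral_eq_sub_of_hasDerivAt_of_le h0 hc hd
    ((intervalIntegrable_iff_integrableOn_Ioc_of_le h0).2 hi)
  rw [dilog_zero, sub_zero] at h
  rw [← h, ← intervalIntegral.integral_neg]
  congr 1; ext t; ring

theorem integral_log_one_add {r : ℝ} (h0 : 0 ≤ r) (h1 : r < 1) :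
    ∫ t in (0 : ℝ)..r, 1 / t * Real.log (1 + t) = -dilog (-r) := by
  have hc : ContinuousOn (fun x => -dilog (-x)) (Set.Icc 0 r) :=
    (continuousOn_dilog.comp continuousOn_neg fun x hx =>
      ⟨by linarith [hx.2], by linarith [hx.1]⟩).neg
  have hd : ∀ x ∈ Set.Ioo 0 r, HasDerivAt (fun x => -dilog (-x)) (1 / x * Real.log (1 + x)) x := by
    intro x hx
    have := (hasDerivAt_dilog (x := -x) (by rw [abs_neg, abs_of_pos hx.1]; exact hx.2.trans h1)
      (neg_ne_zero.2 hx.1.ne'))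
    convert! ((this.comp x (hasDerivAt_neg x)).neg) using 1
    rw [sub_neg_eq_add]; ring
  have hi := intervalIntegral.integrableOn_deriv_of_nonneg hc hd fun x hx =>
    mul_nonneg (by have := hx.1; positivity) (Real.log_nonneg (by linarith [hx.1]))
  have h := intervalIntegral.integral_eq_sub_of_hasDerivAt_of_le h0 hc hd
    ((intervalIntegrable_iff_integrableOn_Ioc_of_le h0).2 hi)
  simpa [dilog_zero] using h

/-! ### Integration along radii and estimates for Chichra's class -/

/-- A lower bound for `Re (V + z V')` in terms of `|z|` integrates to one for `|z| Re V`. -/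
theorem le_norm_mul_re_powSer {c : ℕ → ℂ} (hc : RadOne c) {u N : ℝ → ℝ} (hN0 : N 0 = 0)
    (hNc : ContinuousOn N (Set.Ico 0 1)) (hN : ∀ s ∈ Set.Ioo (0 : ℝ) 1, HasDerivAt N (u s) s)
    (hU : ∀ z, ‖z‖ < 1 → z ≠ 0 → u ‖z‖ ≤ (powSer (fun n => ((n : ℂ) + 1) * c n) z).re) {z : ℂ}
    (hz : ‖z‖ < 1) : N ‖z‖ ≤ ‖z‖ * (powSer c z).re := by
  rcases eq_or_ne z 0 with rfl | hz0
  · simp [hN0]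
  set r := ‖z‖ with hr
  have hr0 : 0 < r := norm_pos_iff.2 hz0
  have hrC : (r : ℂ) ≠ 0 := by exact_mod_cast hr0.ne'
  set e : ℂ := z / r with he
  have hen : ‖e‖ = 1 := by
    rw [he, norm_div, Complex.norm_real, Real.norm_of_nonneg hr0.le, ← hr, div_self hr0.ne']
  have hse : ∀ s : ℝ, 0 ≤ s → ‖(s : ℂ) * e‖ = s := fun s hs => by
    rw [norm_mul, hen, Complex.norm_real, Real.norm_of_nonneg hs, mul_one]
  -- On the ray through z, the derivative of s V(se) in s is V + zV'; comparing it with N' = u gives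
  -- the claim by monotonicity.
  have hder : ∀ s : ℝ, 0 ≤ s → s < 1 → HasDerivAt (fun s : ℝ => s * (powSer c (s * e)).re)
      (powSer (fun n => ((n : ℂ) + 1) * c n) (s * e)).re s := by
    intro s h0 h1
    have hlt : ‖(s : ℂ) * e‖ < 1 := by rw [hse s h0]; exact h1
    have hd := (hasDerivAt_powSer hc hlt)
    have h2 : HasDerivAt (fun s : ℝ => (s : ℂ) * e) e s := by
      simpa using (hasDerivAt_id s).ofReal_comp.mul_const e
    have h2' : HasDerivAt (fun s : ℝ => powSer c (s * e)) _ s :=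
      HasDerivAt.comp (h₂ := powSer c) (h := fun s : ℝ => (s : ℂ) * e) s hd h2
    have h3 : HasDerivAt (fun s : ℝ => (s : ℂ) * powSer c (s * e)) _ s :=
      (hasDerivAt_id s).ofReal_comp.mul h2'
    have h4 := reCLM.hasFDerivAt.comp_hasDerivAt s h3
    convert! h4 using 1
    · ext t; simp
    · rw [powSer_mul_succ hc hlt, hd.deriv]
      simp
      ring
  have hmono : MonotoneOn (fun s : ℝ => s * (powSer c (s * e)).re - N s) (Set.Icc 0 r) := by
    refine monotoneOn_of_deriv_nonneg (convex_Icc 0 r) (ContinuousOn.sub (fun s hs => ?_)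
      (hNc.mono (Set.Icc_subset_Ico_right hz))) (fun s hs => ?_) (fun s hs => ?_)
    · exact (hder s hs.1 (hs.2.trans_lt hz)).continuousAt.continuousWithinAt
    · rw [interior_Icc] at hs
      exact ((hder s hs.1.le (hs.2.trans hz)).sub (hN s ⟨hs.1, hs.2.trans hz⟩)).differentiableAt
        |>.differentiableWithinAt
    · rw [interior_Icc] at hs
      have hd := (hder s hs.1.le (hs.2.trans hz)).sub (hN s ⟨hs.1, hs.2.trans hz⟩)
      have h5 := hU (s * e) (by rw [hse s hs.1.le]; exact hs.2.trans hz)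
        (norm_pos_iff.1 (by rw [hse s hs.1.le]; exact hs.1))
      rw [hse s hs.1.le] at h5
      have : deriv (fun s : ℝ => s * (powSer c (s * e)).re - N s) s = _ := hd.deriv
      rw [this]
      linarith
  have h6 := hmono ⟨le_rfl, hr0.le⟩ ⟨hr0.le, le_rfl⟩ hr0.le
  simp only [hN0, zero_mul, sub_zero] at h6
  rw [he, mul_div_cancel₀ _ hrC] at h6
  linarith

/-- Radial averaging halves the slope of a linear lower bound. Iterating from 1 - 2r produces the
bounds 1 - r, 1 - r/2 and 1 - r/4 used below. -/
theorem one_sub_le_re_powSer {c : ℕ → ℂ} (hc : RadOne c) (b : ℝ)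
    (hU : ∀ z, ‖z‖ < 1 → 1 - b * ‖z‖ ≤ (powSer (fun n => ((n : ℂ) + 1) * c n) z).re) {z : ℂ}
    (hz : ‖z‖ < 1) : 1 - b / 2 * ‖z‖ ≤ (powSer c z).re := by
  rcases eq_or_ne z 0 with rfl | hz0
  · have := hU 0 (by simp)
    simpa [powSer_zero] using this
  have h := le_norm_mul_re_powSer hc (u := fun s => 1 - b * s) (N := fun s => s - b * s ^ 2 / 2)
    (by simp) (by fun_prop) (fun s _ => by
      convert! (hasDerivAt_id s).sub (((hasDerivAt_pow 2 s).const_mul b).div_const 2) using 1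
      simp; ring) (fun z hz _ => hU z hz) hz
  have hr0 : 0 < ‖z‖ := norm_pos_iff.2 hz0
  refine le_of_mul_le_mul_left ?_ hr0
  linarith

namespace CoeffW

variable {c : ℕ → ℂ} (hc : CoeffW c)
include hc

theorem chichra_zero : chichra c 0 = 1 := by simp [chichra, hc.one]

theorem le_re_chichra {z : ℂ} (hz : ‖z‖ < 1) :
    (1 - ‖z‖) / (1 + ‖z‖) ≤ (powSer (chichra c) z).re :=
  harnack (differentiableOn_powSer hc.rad.chichra) (by rw [powSer_zero, hc.chichra_zero])
    (fun z hz => (hc.re_pos z hz).le) hz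

theorem le_norm_mul_re_deriv {z : ℂ} (hz : ‖z‖ < 1) :
    -‖z‖ + 2 * Real.log (1 + ‖z‖) ≤ ‖z‖ * (powSer (fun n => ((n : ℂ) + 1) * c (n + 1)) z).re := by
  refine le_norm_mul_re_powSer hc.rad.shift.mul_succ (u := fun s => (1 - s) / (1 + s))
    (N := fun s => -s + 2 * Real.log (1 + s)) (by simp) ?_ ?_ ?_ hz
  · refine ContinuousOn.add (by fun_prop) (continuousOn_const.mul (ContinuousOn.log (by fun_prop) ?_))
    intro s hs
    linarith [hs.1]
  · intro s hs
    have h1 : (1 + s) ≠ 0 := by linarith [hs.1]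
    convert! (hasDerivAt_id s).neg.add
      ((((hasDerivAt_id s).const_add 1).log h1).const_mul 2) using 1
    simp only [id]
    field_simp
    ring
  · intro w hw _
    exact hc.le_re_chichra hw

/-- Concavity gives log(1 + r) ≥ r log 2 on [0, 1]. The positive constant, about 0.386, is what the
convexity of convolutions needs, since the linear bound degenerates at the boundary. -/
theorem re_deriv_ge {z : ℂ} (hz : ‖z‖ < 1) :
    2 * Real.log 2 - 1 ≤ (powSer (fun n => ((n : ℂ) + 1) * c (n + 1)) z).re := by
  rcases eq_or_ne z 0 with rfl | hz0
  · have : Real.log 2 ≤ 1 := by linarith [Real.log_two_lt_d9]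
    simp [powSer_zero, hc.one]
    linarith
  have hr0 : 0 < ‖z‖ := norm_pos_iff.2 hz0
  have h := hc.le_norm_mul_re_deriv hz
  have h2 := strictConcaveOn_log_Ioi.concaveOn.2 (show (1 : ℝ) ∈ Set.Ioi 0 by simp)
    (show (2 : ℝ) ∈ Set.Ioi 0 by simp) (show 0 ≤ 1 - ‖z‖ by linarith) hr0.le (by ring)
  simp only [smul_eq_mul, Real.log_one, mul_zero, mul_one, zero_add] at h2
  rw [show 1 - ‖z‖ + ‖z‖ * 2 = 1 + ‖z‖ by ring] at h2
  refine le_of_mul_le_mul_left ?_ hr0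
  linarith

theorem one_sub_norm_le_re_deriv {z : ℂ} (hz : ‖z‖ < 1) :
    1 - ‖z‖ ≤ (powSer (fun n => ((n : ℂ) + 1) * c (n + 1)) z).re := by
  -- The slope 2 comes from (1 - r)/(1 + r) ≥ 1 - 2r.
  have := one_sub_le_re_powSer hc.rad.shift.mul_succ 2 (fun w hw => ?_) hz
  · simpa using this
  · refine le_trans ?_ (hc.le_re_chichra hw)
    rw [le_div_iff₀ (by positivity)]
    nlinarith [norm_nonneg w]

theorem re_deriv_pos {z : ℂ} (hz : ‖z‖ < 1) :
    0 < (powSer (fun n => ((n : ℂ) + 1) * c (n + 1)) z).re :=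
  (sub_pos.2 hz).trans_le (hc.one_sub_norm_le_re_deriv hz)

theorem one_sub_half_le_re_shift {z : ℂ} (hz : ‖z‖ < 1) :
    1 - 1 / 2 * ‖z‖ ≤ (powSer (fun n => c (n + 1)) z).re :=
  one_sub_le_re_powSer hc.rad.shift 1
    (fun w hw => by simpa using hc.one_sub_norm_le_re_deriv hw) hz

theorem half_le_re_shift {z : ℂ} (hz : ‖z‖ < 1) : 1 / 2 ≤ (powSer (fun n => c (n + 1)) z).re := by
  linarith [hc.one_sub_half_le_re_shift hz]

theorem rad_shift_div : RadOne (fun n => c (n + 1) / ((n : ℂ) + 1)) :=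
  hc.rad.shift.mono fun n => by
    rw [norm_div]
    refine div_le_self (norm_nonneg _) ?_
    rw [show ((n : ℂ) + 1) = ((n + 1 : ℕ) : ℂ) by push_cast; rfl, Complex.norm_natCast]
    push_cast
    linarith [(n.cast_nonneg : (0 : ℝ) ≤ n)]

theorem three_quarters_le_re {z : ℂ} (hz : ‖z‖ < 1) :
    3 / 4 ≤ (powSer (fun n => c (n + 1) / ((n : ℂ) + 1)) z).re := by
  have := one_sub_le_re_powSer hc.rad_shift_div (1 / 2) (fun w hw => ?_) hz
  · linarith
  · have h1 : (fun n : ℕ => ((n : ℂ) + 1) * (c (n + 1) / ((n : ℂ) + 1))) = fun n => c (n + 1) := by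
      ext n
      rw [mul_div_cancel₀]
      exact Nat.cast_add_one_ne_zero n
    rw [h1]
    exact hc.one_sub_half_le_re_shift hw

/-- Second integration of Harnack's bound: the first gave a logarithm, and integrating 2 log(1 +
s)/s - 1 gives the dilogarithm of the lower growth estimate. -/
theorem le_norm_mul_re_shift {z : ℂ} (hz : ‖z‖ < 1) :
    -‖z‖ - 2 * dilog (-‖z‖) ≤ ‖z‖ * (powSer (fun n => c (n + 1)) z).re := by
  refine le_norm_mul_re_powSer hc.rad.shift (u := fun s => -1 + 2 * (Real.log (1 + s) / s))
    (N := fun s => -s - 2 * dilog (-s)) (by simp [dilog_zero]) ?_ ?_ ?_ hz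
  · refine ContinuousOn.sub (by fun_prop) (continuousOn_const.mul
      (continuousOn_dilog.comp continuousOn_neg fun s hs => ?_))
    exact ⟨by linarith [hs.2], by linarith [hs.1]⟩
  · intro s hs
    have := hasDerivAt_dilog (x := -s) (by rw [abs_neg, abs_of_pos hs.1]; exact hs.2)
      (neg_ne_zero.2 hs.1.ne')
    convert! (hasDerivAt_id s).neg.sub ((this.comp s (hasDerivAt_neg s)).const_mul 2) using 1
    rw [sub_neg_eq_add]
    have := hs.1.ne'
    field_simp
    ring
  · intro w hw hw0
    have hr0 : 0 < ‖w‖ := norm_pos_iff.2 hw0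
    refine le_of_mul_le_mul_left ?_ hr0
    refine le_trans (le_of_eq ?_) (hc.le_norm_mul_re_deriv hw)
    field_simp

theorem norm_coeff_le (n : ℕ) : ‖c (n + 2)‖ ≤ 2 / ((n : ℝ) + 2) ^ 2 := by
  have h := norm_coeff_le_two hc.rad.chichra hc.chichra_zero (fun z hz => (hc.re_pos z hz).le)
    (n := n + 1) (by simp)
  rw [chichra, norm_mul, norm_mul, show (((n + 1 : ℕ) : ℂ) + 1) = ((n + 2 : ℕ) : ℂ) by
    push_cast; ring, Complex.norm_natCast] at h
  push_cast at h
  rw [le_div_iff₀ (by positivity)]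
  calc _ = ((n : ℝ) + 2) * ((n + 2) * ‖c (n + 1 + 1)‖) := by ring
    _ ≤ 2 := h

theorem norm_powSer_le {z : ℂ} (hz : ‖z‖ < 1) : ‖powSer c z‖ ≤ -‖z‖ + 2 * dilog ‖z‖ := by
  have h1 := (hasSum_nat_add_iff' 2).2 (hc.rad.hasSum hz)
  simp [Finset.sum_range_succ, hc.zero, hc.one] at h1
  have h2 := (hasSum_nat_add_iff' 1).2 (hasSum_dilog (x := ‖z‖) (by simpa using hz.le))
  simp at h2
  have h3 := h1.norm_le_of_bounded (h2.mul_left 2) fun n => by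
    rw [norm_mul, norm_pow]
    calc _ ≤ 2 / ((n : ℝ) + 2) ^ 2 * ‖z‖ ^ (n + 2) :=
          mul_le_mul_of_nonneg_right (hc.norm_coeff_le n) (by positivity)
      _ = _ := by ring
  have h4 := norm_add_le (powSer c z - z) z
  rw [sub_add_cancel] at h4
  linarith

end CoeffW

/-! ### Inverse functions and criteria for starlikeness -/

theorem eventually_lt_left_of_hasDerivAt_pos {k : ℝ → ℝ} {k' a : ℝ} (hk : HasDerivAt k k' a)
    (h : 0 < k') : ∀ᶠ t in 𝓝[<] a, k t < k a := by
  have h1 := (hasDerivAt_iff_tendsto_slope_left_right.1 hk).1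
  filter_upwards [h1.eventually (lt_mem_nhds h), self_mem_nhdsWithin] with t ht hta
  rw [slope_def_field] at ht
  have hta : t < a := hta
  by_contra! hcon
  exact absurd ht (not_lt.2 (div_nonpos_of_nonneg_of_nonpos (by linarith) (by linarith)))

theorem eventually_lt_right_of_hasDerivAt_pos {k : ℝ → ℝ} {k' a : ℝ} (hk : HasDerivAt k k' a)
    (h : 0 < k') : ∀ᶠ t in 𝓝[>] a, k a < k t := by
  have h1 := (hasDerivAt_iff_tendsto_slope_left_right.1 hk).2
  filter_upwards [h1.eventually (lt_mem_nhds h), self_mem_nhdsWithin] with t ht hta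
  rw [slope_def_field] at ht
  have hta : a < t := hta
  by_contra! hcon
  exact absurd ht (not_lt.2 (div_nonpos_of_nonpos_of_nonneg (by linarith) (by linarith)))

/-- An injective analytic function without critical points has an analytic inverse. -/
theorem exists_inverse {F : ℂ → ℂ} (hF : DifferentiableOn ℂ F unitDisk)
    (hinj : Set.InjOn F unitDisk) (hF' : ∀ z, ‖z‖ < 1 → deriv F z ≠ 0) :
    ∃ G : ℂ → ℂ, ∀ z, ‖z‖ < 1 → G (F z) = z ∧ HasDerivAt G (deriv F z)⁻¹ (F z) ∧
      ∀ᶠ y in 𝓝 (F z), F (G y) = y := by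
  have hleft : ∀ z, ‖z‖ < 1 → Function.invFunOn F unitDisk (F z) = z := fun z hz =>
    hinj.leftInvOn_invFunOn (mem_disk.2 hz)
  refine ⟨Function.invFunOn F unitDisk, fun z hz => ⟨hleft z hz, ?_⟩⟩
  have hs : HasStrictDerivAt F (deriv F z) z :=
    (hF.analyticAt (Metric.isOpen_ball.mem_nhds (mem_disk.2 hz))).hasStrictDerivAt
  have hg := hs.to_localInverse (hF' z hz)
  have hg0 : hs.localInverse F (deriv F z) z (hF' z hz) (F z) = z :=
    HasStrictFDerivAt.localInverse_apply_image (hf := hs.hasStrictFDerivAt_equiv (hF' z hz))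
  have hr : ∀ᶠ y in 𝓝 (F z), F (hs.localInverse F (deriv F z) z (hF' z hz) y) = y :=
    HasStrictFDerivAt.eventually_right_inverse (hs.hasStrictFDerivAt_equiv (hF' z hz))
  have hin : ∀ᶠ y in 𝓝 (F z), ‖hs.localInverse F (deriv F z) z (hF' z hz) y‖ < 1 := by
    refine hg.hasDerivAt.continuousAt.norm.eventually_lt_const ?_
    simpa only [hg0] using hz
  have heq : Function.invFunOn F unitDisk =ᶠ[𝓝 (F z)]
      hs.localInverse F (deriv F z) z (hF' z hz) := by
    filter_upwards [hr, hin] with y h1 h2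
    conv_lhs => rw [← h1]
    exact hleft _ h2
  refine ⟨hg.hasDerivAt.congr_of_eventuallyEq heq, ?_⟩
  filter_upwards [hr, heq] with y h1 h2
  rw [h2, h1]

theorem hasDerivAt_normSq_comp {ζ : ℝ → ℂ} {ζ' : ℂ} {t : ℝ} (h : HasDerivAt ζ ζ' t) :
    HasDerivAt (fun t => normSq (ζ t)) (2 * (conj (ζ t) * ζ').re) t := by
  have h1 := reCLM.hasFDerivAt.comp_hasDerivAt t h
  have h2 := imCLM.hasFDerivAt.comp_hasDerivAt t h
  convert! (h1.mul h1).add (h2.mul h2) using 1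
  simp
  ring

/-- An injective analytic function with `Re (z F' / F) > 0` maps disks about the origin onto
starlike domains. -/
theorem exists_eq_smul_of_starlike {F : ℂ → ℂ} (hF : DifferentiableOn ℂ F unitDisk)
    (hinj : Set.InjOn F unitDisk) (hF0 : F 0 = 0) (hF' : ∀ z, ‖z‖ < 1 → deriv F z ≠ 0)
    (hst : ∀ z, ‖z‖ < 1 → z ≠ 0 → 0 < (F z / (z * deriv F z)).re) {z₁ : ℂ} (hz₁ : ‖z₁‖ < 1)
    {s : ℝ} (hs : s ∈ Set.Icc (0 : ℝ) 1) : ∃ ζ, ‖ζ‖ ≤ ‖z₁‖ ∧ F ζ = s * F z₁ := by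
  by_cases hw : F z₁ = 0
  · exact ⟨0, by simp, by simp [hw, hF0]⟩
  obtain ⟨G, hG⟩ := exists_inverse hF hinj hF'
  set S : Set ℝ := {s | (s : ℂ) * F z₁ ∈ F '' Metric.closedBall 0 ‖z₁‖} with hS
  have hcl : IsClosed (S ∩ Set.Icc 0 1) := by
    refine IsClosed.inter (IsClosed.preimage (by fun_prop) (IsCompact.isClosed ?_)) isClosed_Icc
    refine (isCompact_closedBall _ _).image_of_continuousOn (hF.continuousOn.mono fun w hw => ?_)
    exact mem_disk.2 ((mem_closedBall_zero_iff.1 hw).trans_lt hz₁)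
  have hsub : Set.Icc (0 : ℝ) 1 ⊆ S := by
    -- The parameter moves down from 1: the set of good parameters is closed, and from each positive
    -- one it can be lowered further.
    refine hcl.Icc_subset_of_forall_exists_lt ⟨z₁, by simp, by simp⟩ ?_
    rintro x ⟨⟨ζ, hζ, hζx⟩, hx⟩ y hy
    have hζ1 : ‖ζ‖ ≤ ‖z₁‖ := mem_closedBall_zero_iff.1 hζ
    have hζD := hζ1.trans_lt hz₁
    have hxC : (x : ℂ) ≠ 0 := by exact_mod_cast hx.1.ne'
    have hζ0 : ζ ≠ 0 := by
      rintro rfl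
      rw [hF0] at hζx
      exact mul_ne_zero hxC hw hζx.symm
    obtain ⟨h1, h2, h3⟩ := hG ζ hζD
    rw [hζx] at h1 h2 h3
    have hl : HasDerivAt (fun t : ℝ => (t : ℂ) * F z₁) (F z₁) x := by
      simpa using (hasDerivAt_id x).ofReal_comp.mul_const (F z₁)
    have h4 : HasDerivAt (fun t : ℝ => G ((t : ℂ) * F z₁)) _ x :=
      HasDerivAt.comp (h₂ := G) (h := fun t : ℝ => (t : ℂ) * F z₁) x h2 hl
    have h5 := hasDerivAt_normSq_comp h4
    simp only [h1] at h5
    -- The starlikeness hypothesis says that the modulus of the preimage increases with t, so moving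
    -- t down keeps the preimage in the closed disk.
    have hpos : 0 < 2 * (conj ζ * ((deriv F ζ)⁻¹ * F z₁)).re := by
      have h6 := hst ζ hζD hζ0
      rw [hζx] at h6
      have h7 : conj ζ * ((deriv F ζ)⁻¹ * F z₁) =
          ((normSq ζ / x : ℝ) : ℂ) * ((x : ℂ) * F z₁ / (ζ * deriv F ζ)) := by
        push_cast
        rw [normSq_eq_conj_mul_self]
        have := hF' ζ hζD
        field_simp
      rw [h7, re_ofReal_mul]
      have : 0 < normSq ζ := normSq_pos.2 hζ0
      have := hx.1
      positivity
    have hev := eventually_lt_left_of_hasDerivAt_pos h5 hpos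
    have h3' : ∀ᶠ t : ℝ in 𝓝[<] x, F (G ((t : ℂ) * F z₁)) = (t : ℂ) * F z₁ :=
      (hl.continuousAt.eventually h3).filter_mono nhdsWithin_le_nhds
    obtain ⟨t, ⟨ht1, ht2⟩, ht⟩ :=
      ((hev.and h3').and (Ioo_mem_nhdsLT (show y < x from hy))).exists
    refine ⟨t, ⟨G ((t : ℂ) * F z₁), ?_, ht2⟩, ht.1.le, ht.2⟩
    rw [h1, normSq_eq_norm_sq, normSq_eq_norm_sq, sq_lt_sq₀ (norm_nonneg _) (norm_nonneg _)] at ht1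
    exact mem_closedBall_zero_iff.2 (ht1.le.trans hζ1)
  obtain ⟨ζ, hζ, h⟩ := hsub hs
  exact ⟨ζ, mem_closedBall_zero_iff.1 hζ, h⟩

/-- A function with `q(0) = 1` whose real part is somewhere not positive has a first boundary
point, where `Re q = 0` and `z q'` is real and at most `-1 / 2`. -/
theorem exists_first_boundary_point {q : ℂ → ℂ} (hq : DifferentiableOn ℂ q unitDisk)
    (hq0 : q 0 = 1) {z₁ : ℂ} (hz₁ : ‖z₁‖ < 1) (hre : (q z₁).re ≤ 0) :
    ∃ z₀, ‖z₀‖ < 1 ∧ (q z₀).re = 0 ∧ (z₀ * deriv q z₀).im = 0 ∧ (z₀ * deriv q z₀).re ≤ -1 / 2 := by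
  have hsub : Metric.closedBall (0 : ℂ) ‖z₁‖ ⊆ unitDisk := fun w hw =>
    mem_disk.2 ((mem_closedBall_zero_iff.1 hw).trans_lt hz₁)
  have hcomp : IsCompact (Metric.closedBall (0 : ℂ) ‖z₁‖ ∩ (fun z => (q z).re) ⁻¹' Set.Iic 0) := by
    refine (isCompact_closedBall _ _).of_isClosed_subset ?_ Set.inter_subset_left
    exact (continuous_re.comp_continuousOn (hq.continuousOn.mono hsub)).preimage_isClosed_of_isClosed
      Metric.isClosed_closedBall isClosed_Iic
  -- The point is chosen with least modulus, so Re q > 0 on the open disk of radius |z₀| and Harnack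
  -- applies there after rescaling.
  obtain ⟨z₀, ⟨hz₀, hz₀re⟩, hmin⟩ := hcomp.exists_isMinOn ⟨z₁, by simp, hre⟩
    continuous_norm.continuousOn
  have hz₀re : (q z₀).re ≤ 0 := hz₀re
  have hz₀z₁ : ‖z₀‖ ≤ ‖z₁‖ := mem_closedBall_zero_iff.1 hz₀
  have hz₀D := hz₀z₁.trans_lt hz₁
  have hz₀0 : z₀ ≠ 0 := by
    rintro rfl
    rw [hq0] at hz₀re
    norm_num at hz₀re
  have hr0 : 0 < ‖z₀‖ := norm_pos_iff.2 hz₀0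
  have hin : ∀ z, ‖z‖ < ‖z₀‖ → 0 < (q z).re := fun z hz => by
    by_contra! hcon
    have := hmin ⟨mem_closedBall_zero_iff.2 (hz.le.trans hz₀z₁), hcon⟩
    exact absurd this (not_le.2 hz)
  have hscale : ∀ z w : ℂ, ‖z‖ = ‖z₀‖ → ‖w‖ < 1 → ‖z * w‖ < ‖z₀‖ := fun z w hz hw => by
    rw [norm_mul, hz]
    exact mul_lt_of_lt_one_right hr0 hw
  have hd : ∀ z, ‖z‖ < 1 → HasDerivAt q (deriv q z) z := fun z hz =>
    (hq.differentiableAt (Metric.isOpen_ball.mem_nhds (mem_disk.2 hz))).hasDerivAt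
  have hray : ∀ z : ℂ, ‖z‖ = ‖z₀‖ → ∀ t : ℝ, 0 < t → t < 1 →
      (1 - t) / (1 + t) ≤ (q (z * t)).re := fun z hz t h0 h1 => by
    have htn : ‖(t : ℂ)‖ = t := by rw [Complex.norm_real, Real.norm_of_nonneg h0.le]
    have := harnack (u := fun w => q (z * w)) (hq.comp (by fun_prop) fun w hw =>
      mem_disk.2 ((hscale z w hz (mem_disk.1 hw)).trans hz₀D)) (by simp [hq0])
      (fun w hw => (hin _ (hscale z w hz hw)).le) (z := t) (by rwa [htn])
    rwa [htn] at this
  have hline : ∀ z : ℂ, ‖z‖ = ‖z₀‖ → HasDerivAt (fun t : ℝ => (q (z * t)).re) (z * deriv q z).re 1 :=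
    fun z hz => by
      have h1 : HasDerivAt (fun t : ℝ => z * (t : ℂ)) z (1 : ℝ) := by
        simpa using (hasDerivAt_id (1 : ℝ)).ofReal_comp.const_mul z
      have h2 : HasDerivAt (fun t : ℝ => q (z * (t : ℂ))) (deriv q z * z) (1 : ℝ) := by
        refine HasDerivAt.comp (h₂ := q) (h := fun t : ℝ => z * (t : ℂ)) (1 : ℝ) ?_ h1
        simpa using hd z (hz ▸ hz₀D)
      rw [mul_comm]
      exact reCLM.hasFDerivAt.comp_hasDerivAt (1 : ℝ) h2
  have hmem : Set.Ioo (0 : ℝ) 1 ∈ 𝓝[<] (1 : ℝ) := Ioo_mem_nhdsLT one_pos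
  have hcirc : ∀ z : ℂ, ‖z‖ = ‖z₀‖ → 0 ≤ (q z).re := fun z hz => by
    have h1 : Tendsto (fun t : ℝ => (q (z * t)).re) (𝓝[<] 1) (𝓝 (q z).re) := by
      simpa using tendsto_nhdsWithin_of_tendsto_nhds (hline z hz).continuousAt.tendsto
    refine ge_of_tendsto h1 ?_
    filter_upwards [hmem] with t ht
    exact (div_nonneg (by linarith [ht.2]) (by linarith [ht.1])).trans (hray z hz t ht.1 ht.2)
  have hz₀eq : (q z₀).re = 0 := le_antisymm hz₀re (hcirc z₀ rfl)
  refine ⟨z₀, hz₀D, hz₀eq, ?_, ?_⟩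
  · have h1 : HasDerivAt (fun θ : ℝ => z₀ * cexp (θ * I)) (z₀ * I) 0 := by
      have := (((hasDerivAt_id (0 : ℝ)).ofReal_comp.mul_const I).cexp).const_mul z₀
      simpa using this
    have h2 : HasDerivAt (fun θ : ℝ => q (z₀ * cexp (θ * I))) (deriv q z₀ * (z₀ * I)) 0 := by
      refine HasDerivAt.comp (h₂ := q) (h := fun θ : ℝ => z₀ * cexp (θ * I)) (0 : ℝ) ?_ h1
      simpa using hd z₀ hz₀D
    have h3 := reCLM.hasFDerivAt.comp_hasDerivAt (0 : ℝ) h2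
    -- Along the circle Re q has a minimum at z₀; the vanishing angular derivative is the imaginary
    -- part of z₀ q'.
    have h4 : IsLocalMin (reCLM ∘ fun θ : ℝ => q (z₀ * cexp (θ * I))) 0 := by
      refine Filter.Eventually.of_forall fun θ => ?_
      simp only [Function.comp, ofReal_zero, zero_mul, Complex.exp_zero, mul_one, reCLM_apply, hz₀eq]
      exact hcirc _ (by rw [norm_mul, norm_exp_ofReal_mul_I, mul_one])
    have h5 := h4.hasDerivAt_eq_zero h3
    simp at h5
    simp
    linarith
  · by_contra! hcon
    -- Both Re q(tz₀) and its Harnack minorant vanish at t = 1, so the radial derivative of the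
    -- former cannot exceed the slope -1/2 of the latter.
    have h1 : HasDerivAt (fun t : ℝ => (1 - t) / (1 + t)) (-1 / 2) 1 := by
      convert! ((hasDerivAt_id (1 : ℝ)).const_sub 1).div ((hasDerivAt_id (1 : ℝ)).const_add 1)
        (by norm_num) using 1
      norm_num
    have h2 := eventually_lt_left_of_hasDerivAt_pos ((hline z₀ rfl).sub h1) (by linarith)
    obtain ⟨t, ht1, ht2⟩ := (h2.and hmem).exists
    have h3 := hray z₀ rfl t ht2.1 ht2.2
    simp only [Pi.sub_apply, ofReal_one, mul_one, hz₀eq] at ht1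
    norm_num at ht1
    linarith

/-- A criterion for starlikeness of `F = powSer c`: here the shifted series is `F(z) / z`. -/
theorem re_deriv_div_pos {c : ℕ → ℂ} (hc : RadOne c) (hc1 : c 1 = 1)
    (hG : ∀ z, ‖z‖ < 1 → 0 < (powSer (fun n => c (n + 1)) z).re)
    (hE : ∀ z, ‖z‖ < 1 → 0 < (powSer (chichra c) z).re + (powSer (fun n => c (n + 1)) z).re / 2)
    {z : ℂ} (hz : ‖z‖ < 1) :
    0 < (powSer (fun n => ((n : ℂ) + 1) * c (n + 1)) z / powSer (fun n => c (n + 1)) z).re := by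
  set G := powSer (fun n => c (n + 1)) with hGdef
  set F₁ := powSer (fun n => ((n : ℂ) + 1) * c (n + 1)) with hF₁
  have dG : DifferentiableOn ℂ G unitDisk := differentiableOn_powSer hc.shift
  have dF : DifferentiableOn ℂ F₁ unitDisk := differentiableOn_powSer hc.shift.mul_succ
  have hG0 : ∀ z, ‖z‖ < 1 → G z ≠ 0 := fun z hz h => by
    have := hG z hz
    rw [h] at this
    simp at this
  have dq : DifferentiableOn ℂ (fun z => F₁ z / G z) unitDisk :=
    dF.div dG fun w hw => hG0 w (mem_disk.1 hw)
  by_contra! hcon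
  obtain ⟨z₀, hz₀, h1, h2, h3⟩ := exists_first_boundary_point dq
    (by simp [hF₁, hGdef, powSer_zero, hc1]) hz hcon
  have hnhds := Metric.isOpen_ball.mem_nhds (mem_disk.2 hz₀)
  have e1 : powSer (chichra c) z₀ = F₁ z₀ + z₀ * deriv F₁ z₀ := powSer_mul_succ hc.shift.mul_succ hz₀
  have e2 : F₁ z₀ = G z₀ + z₀ * deriv G z₀ := powSer_mul_succ hc.shift hz₀
  set q' := deriv (fun z => F₁ z / G z) z₀ with hq'
  have e3 : deriv F₁ z₀ = q' * G z₀ + F₁ z₀ / G z₀ * deriv G z₀ := by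
    have hd := ((dq.differentiableAt hnhds).hasDerivAt.mul (dG.differentiableAt hnhds).hasDerivAt)
    rw [← hd.deriv]
    refine Filter.EventuallyEq.deriv_eq ?_
    filter_upwards [hnhds] with w hw
    simp [div_mul_cancel₀ _ (hG0 w (mem_disk.1 hw))]
  set Q := F₁ z₀ / G z₀ with hQ
  have e4 : F₁ z₀ = Q * G z₀ := (div_mul_cancel₀ _ (hG0 z₀ hz₀)).symm
  -- With q = zF'/F one has F' + zF'' = (zq' + q²) F/z. At the boundary point q is imaginary and zq'
  -- is real, so the factor is a real number at most -1/2, contradicting `hE`.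
  have e5 : powSer (chichra c) z₀ = (z₀ * q' + Q ^ 2) * G z₀ := by
    rw [e1, e3]
    clear_value Q
    linear_combination (1 + Q) * e4 - Q * e2
  have e6 : z₀ * q' + Q ^ 2 = (((z₀ * q').re - Q.im ^ 2 : ℝ) : ℂ) := by
    apply Complex.ext
    · simp [pow_two, h1, sub_eq_add_neg]
    · simp only [add_im, h2, pow_two, mul_im, h1, ofReal_im]; ring
  have h4 := hE z₀ hz₀
  rw [e5, e6, re_ofReal_mul] at h4
  have h5 := hG z₀ hz₀
  nlinarith [sq_nonneg Q.im]

/-! ### Univalence, convexity and the shear construction -/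

theorem hasDerivAt_of_mem_disk {F : ℂ → ℂ} (hF : DifferentiableOn ℂ F unitDisk) {z : ℂ}
    (hz : ‖z‖ < 1) : HasDerivAt F (deriv F z) z :=
  (hF.differentiableAt (Metric.isOpen_ball.mem_nhds (mem_disk.2 hz))).hasDerivAt

/-- The Noshiro–Warschawski criterion for harmonic functions. -/
theorem injOn_of_norm_deriv_lt {h g : ℂ → ℂ} (hh : DifferentiableOn ℂ h unitDisk)
    (hg : DifferentiableOn ℂ g unitDisk) (hlt : ∀ z, ‖z‖ < 1 → ‖deriv g z‖ < (deriv h z).re) :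
    Set.InjOn (fun z => h z + conj (g z)) unitDisk := by
  intro z₁ h₁ z₂ h₂ heq
  by_contra hne
  set Δ := z₂ - z₁ with hΔ
  have hΔ0 : Δ ≠ 0 := sub_ne_zero.2 (Ne.symm hne)
  have hmem : ∀ t ∈ Set.Icc (0 : ℝ) 1, ‖z₁ + t * Δ‖ < 1 := fun t ht => by
    have := (convex_ball (0 : ℂ) 1).add_smul_sub_mem h₁ h₂ ht
    simpa using this
  have hder : ∀ t ∈ Set.Icc (0 : ℝ) 1, HasDerivAt
      (fun t : ℝ => ((h (z₁ + t * Δ) + conj (g (z₁ + t * Δ))) * conj Δ).re)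
      ((deriv h (z₁ + t * Δ) * Δ + conj (deriv g (z₁ + t * Δ) * Δ)) * conj Δ).re t := by
    intro t ht
    have h0 : HasDerivAt (fun t : ℝ => z₁ + (t : ℂ) * Δ) Δ t := by
      simpa using ((hasDerivAt_id t).ofReal_comp.mul_const Δ).const_add z₁
    have h1 := HasDerivAt.comp (h₂ := h) t (hasDerivAt_of_mem_disk hh (hmem t ht)) h0
    have h2 := HasDerivAt.comp (h₂ := g) t (hasDerivAt_of_mem_disk hg (hmem t ht)) h0
    have h3 := conjCLE.toContinuousLinearMap.hasFDerivAt.comp_hasDerivAt t h2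
    exact reCLM.hasFDerivAt.comp_hasDerivAt t ((h1.add h3).mul_const (conj Δ))
  have hmono : StrictMonoOn (fun t : ℝ => ((h (z₁ + t * Δ) + conj (g (z₁ + t * Δ))) * conj Δ).re)
      (Set.Icc 0 1) := by
    refine strictMonoOn_of_deriv_pos (convex_Icc 0 1)
      (fun t ht => (hder t ht).continuousAt.continuousWithinAt) fun t ht => ?_
    rw [interior_Icc] at ht
    have ht' := Set.Ioo_subset_Icc_self ht
    rw [(hder t ht').deriv]
    have h4 := hlt _ (hmem t ht')
    set p := deriv h (z₁ + t * Δ)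
    set q := deriv g (z₁ + t * Δ)
    -- Projecting on the direction Δ, the derivative is at least |Δ|² (Re h' - |g'|), which is
    -- positive.
    have h5 : ((p * Δ + conj (q * Δ)) * conj Δ) = ((normSq Δ : ℝ) : ℂ) * p + conj (q * Δ * Δ) := by
      rw [normSq_eq_conj_mul_self]; simp only [map_mul]; ring
    rw [h5, add_re, re_ofReal_mul, conj_re, normSq_eq_norm_sq]
    have h6 := neg_le_of_abs_le (Complex.abs_re_le_norm (q * Δ * Δ))
    rw [norm_mul, norm_mul] at h6
    have : 0 < ‖Δ‖ := norm_pos_iff.2 hΔ0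
    nlinarith [mul_pos (mul_pos this this) (sub_pos.2 h4)]
  have := hmono (Set.left_mem_Icc.2 zero_le_one) (Set.right_mem_Icc.2 zero_le_one) zero_lt_one
  have heq' : h z₁ + conj (g z₁) = h z₂ + conj (g z₂) := heq
  simp only [ofReal_zero, zero_mul, add_zero, ofReal_one, one_mul, hΔ, add_sub_cancel, heq'] at this
  exact lt_irrefl _ this

/-- At a point where a line touches the image of a circle from inside, convexity is violated. -/
theorem norm_lt_of_segment_subset {F : ℂ → ℂ} (hF : DifferentiableOn ℂ F unitDisk)
    (hinj : Set.InjOn F unitDisk) (hF' : ∀ z, ‖z‖ < 1 → deriv F z ≠ 0)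
    (hcv : ∀ z, ‖z‖ < 1 → 0 < (1 + z * deriv (deriv F) z / deriv F z).re) {R : ℝ} (hR : R < 1)
    {p v : ℂ} (hv : v ≠ 0) {ζ : ℂ} (hζ : ‖ζ‖ = R) (hζp : F ζ = p)
    (hin : ∀ᶠ t : ℝ in 𝓝 0, p + t * v ∈ F '' Metric.closedBall 0 R) : False := by
  obtain ⟨G, hG⟩ := exists_inverse hF hinj hF'
  have dF' : DifferentiableOn ℂ (deriv F) unitDisk := hF.deriv Metric.isOpen_ball
  have hζ1 : ‖ζ‖ < 1 := hζ ▸ hR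
  have hline : ∀ t : ℝ, HasDerivAt (fun t : ℝ => p + (t : ℂ) * v) v t := fun t => by
    simpa using ((hasDerivAt_id t).ofReal_comp.mul_const v).const_add p
  set c : ℝ → ℂ := fun t => G (p + t * v) with hc
  have hc0 : c 0 = ζ := by simp [hc, ← hζp, (hG ζ hζ1).1]
  have hcin : ∀ᶠ t : ℝ in 𝓝 0, ‖c t‖ ≤ R ∧ HasDerivAt c ((deriv F (c t))⁻¹ * v) t := by
    filter_upwards [hin] with t ⟨ξ, hξ, hξt⟩
    have hξR : ‖ξ‖ ≤ R := mem_closedBall_zero_iff.1 hξ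
    obtain ⟨h1, h2, -⟩ := hG ξ (hξR.trans_lt hR)
    have hct : c t = ξ := by simp only [hc, ← hξt, h1]
    rw [hct]
    refine ⟨hξR, ?_⟩
    rw [hξt] at h2
    exact HasDerivAt.comp (h₂ := G) (h := fun t : ℝ => p + (t : ℂ) * v) t h2 (hline t)
  have hm : ∀ᶠ t : ℝ in 𝓝 0, HasDerivAt (fun t => normSq (c t))
      (2 * (conj (c t) * ((deriv F (c t))⁻¹ * v)).re) t := by
    filter_upwards [hcin] with t ht using hasDerivAt_normSq_comp ht.2
  -- The preimage c of the line stays in the disk of radius R and meets its boundary at t = 0. The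
  -- second derivative of |c|² there is a positive multiple of Re(1 + ζF''/F'), which also makes 0 a
  -- local minimum; |c|² would be locally constant, which is absurd.
  have hmax : IsLocalMax (fun t => normSq (c t)) 0 := by
    filter_upwards [hcin] with t ht
    rw [hc0, normSq_eq_norm_sq, normSq_eq_norm_sq, hζ]
    exact pow_le_pow_left₀ (norm_nonneg _) ht.1 2
  have hd0 := hm.self_of_nhds
  have hz0 := hmax.hasDerivAt_eq_zero hd0
  have hc' := hcin.self_of_nhds.2
  rw [hc0] at hz0 hc'
  set d := (deriv F ζ)⁻¹ * v with hd
  have hF0 := hF' ζ hζ1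
  have hζ0 : ζ ≠ 0 := by
    rintro rfl
    have hev : ∀ᶠ t : ℝ in 𝓝 0, c t = 0 := by
      filter_upwards [hcin] with t ht
      rw [norm_zero] at hζ
      exact norm_le_zero_iff.1 (hζ ▸ ht.1)
    have h1 := hc'.congr_of_eventuallyEq (EventuallyEq.symm hev)
    have h2 := h1.unique (hasDerivAt_const (0 : ℝ) (0 : ℂ))
    exact mul_ne_zero (inv_ne_zero hF0) hv h2
  set α := d / ζ with hα
  have hdα : d = α * ζ := (div_mul_cancel₀ _ hζ0).symm
  have hα0 : α ≠ 0 := div_ne_zero (mul_ne_zero (inv_ne_zero hF0) hv) hζ0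
  have hns : 0 < normSq ζ := normSq_pos.2 hζ0
  have hαre : α.re = 0 := by
    have h1 : conj ζ * d = ((normSq ζ : ℝ) : ℂ) * α := by
      rw [hdα, normSq_eq_conj_mul_self]; ring
    rw [h1, re_ofReal_mul] at hz0
    have : normSq ζ * α.re = 0 := by linarith
    exact (mul_eq_zero.1 this).resolve_left hns.ne'
  have hαim : α.im ≠ 0 := fun h => hα0 (Complex.ext hαre h)
  have hα2 : α ^ 2 = ((-(α.im ^ 2) : ℝ) : ℂ) := by
    apply Complex.ext
    · simp [pow_two, hαre]
    · simp [pow_two, hαre]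
  have h2 : HasDerivAt (fun t => deriv F (c t)) (deriv (deriv F) ζ * d) 0 := by
    refine HasDerivAt.comp (h₂ := deriv F) (0 : ℝ) ?_ hc'
    rw [hc0]
    exact hasDerivAt_of_mem_disk dF' hζ1
  have h3 := (h2.inv (by rwa [hc0])).mul_const v
  have h4 := conjCLE.toContinuousLinearMap.hasFDerivAt.comp_hasDerivAt (0 : ℝ) hc'
  have h5 := (reCLM.hasFDerivAt.comp_hasDerivAt (0 : ℝ) (h4.mul h3)).const_mul 2
  simp only [Function.comp, hc0] at h5
  have hpos : 0 < deriv (deriv fun t => normSq (c t)) 0 := by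
    have h6 : deriv (fun t => normSq (c t)) =ᶠ[𝓝 0]
        fun t => 2 * (conj (c t) * ((deriv F (c t))⁻¹ * v)).re := by
      filter_upwards [hm] with t ht using ht.deriv
    rw [h6.deriv_eq]
    have h7 : deriv (fun t => 2 * (conj (c t) * ((deriv F (c t))⁻¹ * v)).re) 0 = _ := h5.deriv
    rw [h7]
    have h8 : conj d * ((deriv F ζ)⁻¹ * v) + conj ζ *
        (-(deriv (deriv F) ζ * d) / deriv F ζ ^ 2 * v) =
        ((α.im ^ 2 * normSq ζ : ℝ) : ℂ) * (1 + ζ * deriv (deriv F) ζ / deriv F ζ) := by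
      have e1 : v = deriv F ζ * d := by rw [hd]; field_simp
      have e2 : conj d * d = ((α.im ^ 2 * normSq ζ : ℝ) : ℂ) := by
        rw [← normSq_eq_conj_mul_self, hdα, normSq_mul, normSq_apply α, hαre]
        push_cast; ring
      have e3 : conj ζ * d ^ 2 = -((α.im ^ 2 * normSq ζ : ℝ) : ℂ) * ζ := by
        rw [hdα, mul_pow, hα2]
        push_cast
        rw [normSq_eq_conj_mul_self]; ring
      rw [← hd, e2, mul_add, mul_one]
      congr 1
      calc conj ζ * (-(deriv (deriv F) ζ * d) / deriv F ζ ^ 2 * v)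
          = -(conj ζ * d ^ 2) * (deriv (deriv F) ζ / deriv F ζ) := by
            rw [e1]; field_simp
        _ = _ := by rw [e3]; ring
    have h9 : 0 < (((α.im ^ 2 * normSq ζ : ℝ) : ℂ) * (1 + ζ * deriv (deriv F) ζ / deriv F ζ)).re := by
      rw [re_ofReal_mul]
      have := hcv ζ hζ1
      positivity
    rw [← h8] at h9
    simp only [Pi.inv_apply, hc0]
    exact mul_pos two_pos h9
  have hmin := isLocalMin_of_deriv_deriv_pos hpos (by rw [hd0.deriv, hc0]; exact hz0)
    hd0.continuousAt
  have hconst : (fun t => normSq (c t)) =ᶠ[𝓝 0] fun _ => normSq (c 0) := by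
    filter_upwards [hmin, hmax] with t h1 h2 using le_antisymm h2 h1
  have h10 := hconst.deriv.deriv_eq
  simp at h10
  exact hpos.ne' h10

/-- An injective analytic function with `Re (1 + z F'' / F') > 0` has convex range. -/
theorem segment_subset_image {F : ℂ → ℂ} (hF : DifferentiableOn ℂ F unitDisk)
    (hinj : Set.InjOn F unitDisk) (hF' : ∀ z, ‖z‖ < 1 → deriv F z ≠ 0)
    (hcv : ∀ z, ‖z‖ < 1 → 0 < (1 + z * deriv (deriv F) z / deriv F z).re) {z₁ z₂ : ℂ}
    (hz₁ : ‖z₁‖ < 1) (hz₂ : ‖z₂‖ < 1) {a : ℝ} (ha : a ∈ Set.Icc (0 : ℝ) 1) :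
    F z₁ + a * (F z₂ - F z₁) ∈ F '' unitDisk := by
  obtain ⟨R, hR, hR1⟩ := exists_between (max_lt hz₁ hz₂)
  have hR₁ : ‖z₁‖ < R := (le_max_left _ _).trans_lt hR
  have hR₂ : ‖z₂‖ < R := (le_max_right _ _).trans_lt hR
  have hR0 : 0 < R := (norm_nonneg z₁).trans_lt hR₁
  have hlt : ∀ z : ℂ, ‖z‖ < R → ∀ s ∈ Set.Icc (0 : ℝ) 1, ‖(s : ℂ) * z‖ < R := fun z hz s hs => by
    rw [norm_mul, Complex.norm_real, Real.norm_of_nonneg hs.1]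
    exact (mul_le_of_le_one_left (norm_nonneg z) hs.2).trans_lt hz
  set φ : ℝ → ℝ → ℂ := fun s a => F (s * z₁) + a * (F (s * z₂) - F (s * z₁)) with hφ
  have hball : Metric.ball (0 : ℂ) R ⊆ unitDisk := Metric.ball_subset_ball hR1.le
  have hcball : Metric.closedBall (0 : ℂ) R ⊆ unitDisk := Metric.closedBall_subset_ball hR1
  have hFc : ∀ z, ‖z‖ < R → ∀ s ∈ Set.Icc (0 : ℝ) 1, ContinuousAt (fun s : ℝ => F (s * z)) s := by
    intro z hz s hs
    have h1 : ContinuousAt F ((s : ℂ) * z) :=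
      (hasDerivAt_of_mem_disk hF ((hlt z hz s hs).trans hR1)).continuousAt
    exact ContinuousAt.comp (f := fun s : ℝ => (s : ℂ) * z) h1 (by fun_prop)
  have hopen : ∀ ζ, ‖ζ‖ < R → F '' Metric.ball 0 R ∈ 𝓝 (F ζ) := by
    intro ζ hζ
    have hs : HasStrictDerivAt F (deriv F ζ) ζ :=
      (hF.analyticAt (Metric.isOpen_ball.mem_nhds (mem_disk.2 (hζ.trans hR1)))).hasStrictDerivAt
    rw [← hs.map_nhds_eq (hF' ζ (hζ.trans hR1))]
    exact image_mem_map (Metric.isOpen_ball.mem_nhds (mem_ball_zero_iff.2 hζ))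
  -- Continuity method: both endpoints are contracted to the origin by s. The condition that the
  -- whole chord lies in the image of the closed disk is closed in s; it is open because the
  -- preceding lemma forbids the chord to touch the image of the boundary circle.
  set T : Set ℝ := {s | ∀ a ∈ Set.Icc (0 : ℝ) 1, φ s a ∈ F '' Metric.closedBall 0 R} with hT
  have hstrict : ∀ s ∈ T ∩ Set.Icc 0 1, ∀ a ∈ Set.Icc (0 : ℝ) 1, φ s a ∈ F '' Metric.ball 0 R := by
    rintro s ⟨hsT, hs⟩ a ha
    obtain ⟨ζ, hζ, hζa⟩ := hsT a ha
    rcases (mem_closedBall_zero_iff.1 hζ).lt_or_eq with h | h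
    · exact ⟨ζ, mem_ball_zero_iff.2 h, hζa⟩
    exfalso
    have hends : ∀ z : ℂ, ‖z‖ < R → φ s a ≠ F (s * z) := by
      intro z hz heq
      have h1 : ζ = s * z := hinj (hcball hζ) (hball (mem_ball_zero_iff.2 (hlt z hz s hs)))
        (hζa.trans heq)
      have h2 := hlt z hz s hs
      rw [← h1, h] at h2
      exact lt_irrefl _ h2
    have ha0 : a ≠ 0 := by
      rintro rfl
      exact hends z₁ hR₁ (by simp [hφ])
    have ha1 : a ≠ 1 := by
      rintro rfl
      exact hends z₂ hR₂ (by simp [hφ])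
    have hv : F (s * z₂) - F (s * z₁) ≠ 0 := fun hv => hends z₁ hR₁ (by simp [hφ, hv])
    refine norm_lt_of_segment_subset hF hinj hF' hcv hR1 hv h hζa ?_
    have h3 : Tendsto (fun t : ℝ => a + t) (𝓝 0) (𝓝 a) := by
      have : Continuous fun t : ℝ => a + t := by fun_prop
      simpa using this.tendsto 0
    filter_upwards [h3 (Icc_mem_nhds (lt_of_le_of_ne ha.1 (Ne.symm ha0)) (lt_of_le_of_ne ha.2 ha1))]
      with t ht
    convert! hsT (a + t) ht using 1
    simp only [hφ]; push_cast; ring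
  have hsub : Set.Icc (0 : ℝ) 1 ⊆ T := by
    refine IsClosed.Icc_subset_of_forall_exists_gt ?_ ?_ ?_
    · have : T ∩ Set.Icc 0 1 = ⋂ a ∈ Set.Icc (0 : ℝ) 1,
          (Set.Icc (0 : ℝ) 1 ∩ (fun s => φ s a) ⁻¹' (F '' Metric.closedBall 0 R)) := by
        ext s
        simp only [Set.mem_inter_iff, Set.mem_iInter, Set.mem_preimage]
        exact ⟨fun h a ha => ⟨h.2, h.1 a ha⟩, fun h => ⟨fun a ha => (h a ha).2,
          (h 0 ⟨le_rfl, zero_le_one⟩).1⟩⟩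
      rw [this]
      refine isClosed_biInter fun a _ => ContinuousOn.preimage_isClosed_of_isClosed ?_ isClosed_Icc
        ((isCompact_closedBall _ _).image_of_continuousOn (hF.continuousOn.mono hcball)).isClosed
      intro s hs
      exact ((hFc z₁ hR₁ s hs).add (continuousAt_const.mul ((hFc z₂ hR₂ s hs).sub
        (hFc z₁ hR₁ s hs)))).continuousWithinAt
    · intro a _
      exact ⟨0, by simpa using hR0.le, by simp [hφ]⟩
    · rintro s ⟨hsT, hs⟩ y hy
      have hs' : s ∈ Set.Icc (0 : ℝ) 1 := ⟨hs.1, hs.2.le⟩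
      have hev : ∀ᶠ s' in 𝓝 s, ∀ a ∈ Set.Icc (0 : ℝ) 1, φ s' a ∈ F '' Metric.ball 0 R := by
        refine isCompact_Icc.eventually_forall_of_forall_eventually fun a ha => ?_
        obtain ⟨ζ, hζ, hζa⟩ := hstrict s ⟨hsT, hs'⟩ a ha
        have hct : ContinuousAt (fun q : ℝ × ℝ => φ q.1 q.2) (s, a) := by
          have c1 : ContinuousAt (fun q : ℝ × ℝ => F (q.1 * z₁)) (s, a) :=
            ContinuousAt.comp (g := fun s : ℝ => F (s * z₁)) (f := Prod.fst) (x := (s, a))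
              (hFc z₁ hR₁ s hs') continuousAt_fst
          have c2 : ContinuousAt (fun q : ℝ × ℝ => F (q.1 * z₂)) (s, a) :=
            ContinuousAt.comp (g := fun s : ℝ => F (s * z₂)) (f := Prod.fst) (x := (s, a))
              (hFc z₂ hR₂ s hs') continuousAt_fst
          have c3 : ContinuousAt (fun q : ℝ × ℝ => (q.2 : ℂ)) (s, a) := by fun_prop
          exact c1.add (c3.mul (c2.sub c1))
        refine hct.eventually ?_
        simp only
        rw [← hζa]
        exact hopen ζ (mem_ball_zero_iff.1 hζ)
      obtain ⟨t, ht, hty⟩ := ((hev.filter_mono (nhdsWithin_le_nhds (s := Set.Ioi s))).and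
        (Ioc_mem_nhdsGT (show s < y from hy))).exists
      exact ⟨t, fun a ha => Set.image_mono Metric.ball_subset_closedBall (ht a ha), hty⟩
  obtain ⟨ζ, hζ, h⟩ := hsub ⟨zero_le_one, le_rfl⟩ a ha
  exact ⟨ζ, hcball hζ, by simpa [hφ] using h⟩

/-- The shear construction: segments in the images of all analytic functions `h + k g`, `|k| = 1`,
give segments in the image of `h + conj g`. -/
theorem shear_segment {h g : ℂ → ℂ} (hh : DifferentiableOn ℂ h unitDisk)
    (hg : DifferentiableOn ℂ g unitDisk) {B : Set ℂ} (hB : B ⊆ unitDisk) {z₁ z₂ : ℂ} (h₁ : z₁ ∈ B)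
    (h₂ : z₂ ∈ B) (hinj : ∀ k : ℂ, ‖k‖ = 1 → Set.InjOn (fun z => h z + k * g z) unitDisk)
    (hder : ∀ k : ℂ, ‖k‖ = 1 → ∀ z, ‖z‖ < 1 → deriv (fun z => h z + k * g z) z ≠ 0)
    (hseg : ∀ k : ℂ, ‖k‖ = 1 → ∀ a ∈ Set.Icc (0 : ℝ) 1, h z₁ + k * g z₁ +
      a * ((h z₂ + k * g z₂) - (h z₁ + k * g z₁)) ∈ (fun z => h z + k * g z) '' B)
    {s : ℝ} (hs : s ∈ Set.Icc (0 : ℝ) 1) :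
    h z₁ + conj (g z₁) + s * ((h z₂ + conj (g z₂)) - (h z₁ + conj (g z₁))) ∈
      (fun z => h z + conj (g z)) '' B := by
  set f : ℂ → ℂ := fun z => h z + conj (g z) with hf
  obtain ⟨u, hu, huw⟩ := exists_unit_mul_eq_neg_norm (f z₂ - f z₁)
  have huu : conj u * u = 1 := by rw [conj_mul', hu]; simp
  -- With this k the functions u f and u F differ by a real number, so f and F have the same height
  -- across the direction of the chord.
  set k : ℂ := -(conj u) ^ 2 with hk
  have hk1 : ‖k‖ = 1 := by simp [hk, hu]
  set F : ℂ → ℂ := fun z => h z + k * g z with hFdef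
  have hF : DifferentiableOn ℂ F unitDisk := hh.add (hg.const_mul k)
  obtain ⟨G, hG⟩ := exists_inverse hF (hinj k hk1) (hder k hk1)
  have him : ∀ z, (u * f z).im = (u * F z).im := fun z => by
    have e : u * f z - u * F z = u * conj (g z) + conj (u * conj (g z)) := by
      simp only [hf, hFdef, hk, map_mul, conj_conj]
      linear_combination (conj u * g z) * huu
    have := congrArg im e
    simp at this
    simp
    linarith
  set p : ℝ → ℂ := fun a => F z₁ + a * (F z₂ - F z₁) with hp
  have hpB : ∀ a ∈ Set.Icc (0 : ℝ) 1, ∃ ζ ∈ B, F ζ = p a := fun a ha => hseg k hk1 a ha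
  have hfc : ContinuousOn f unitDisk :=
    hh.continuousOn.add (continuous_conj.comp_continuousOn hg.continuousOn)
  have hcont : ContinuousOn (fun a : ℝ => (u * f (G (p a))).re) (Set.Icc 0 1) := by
    intro a ha
    obtain ⟨ζ, hζ, hζa⟩ := hpB a ha
    obtain ⟨e1, e2, -⟩ := hG ζ (mem_disk.1 (hB hζ))
    rw [hζa] at e1 e2
    have c1 : ContinuousAt p a := by fun_prop
    have c2 : ContinuousAt (fun a => G (p a)) a := e2.continuousAt.comp c1
    have c3 : ContinuousAt f (G (p a)) := by
      rw [e1]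
      exact hfc.continuousAt (Metric.isOpen_ball.mem_nhds (hB hζ))
    have c4 : ContinuousAt (fun a => f (G (p a))) a := ContinuousAt.comp (g := f) c3 c2
    exact (continuous_re.continuousAt.comp (continuousAt_const.mul c4)).continuousWithinAt
  have hG1 : G (p 0) = z₁ := by simp [hp, (hG z₁ (mem_disk.1 (hB h₁))).1]
  have hG2 : G (p 1) = z₂ := by simp [hp, (hG z₂ (mem_disk.1 (hB h₂))).1]
  -- The segment between the F-values pulls back to a path in B along which the height of u f is
  -- constant; by continuity its real part takes every intermediate value.
  have hivt := intermediate_value_uIcc (a := (0 : ℝ)) (b := 1)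
    (by rwa [Set.uIcc_of_le zero_le_one] : ContinuousOn (fun a : ℝ => (u * f (G (p a))).re) _)
  simp only [hG1, hG2] at hivt
  set w := f z₁ + s * (f z₂ - f z₁) with hw
  have hmem : (u * w).re ∈ Set.uIcc (u * f z₁).re (u * f z₂).re := by
    rw [← segment_eq_uIcc]
    refine ⟨1 - s, s, by linarith [hs.2], hs.1, by ring, ?_⟩
    simp [hw]; ring
  obtain ⟨a, ha, hX⟩ := hivt hmem
  rw [Set.uIcc_of_le zero_le_one] at ha
  obtain ⟨ζ, hζ, hζa⟩ := hpB a ha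
  have hGp : G (p a) = ζ := by rw [← hζa, (hG ζ (mem_disk.1 (hB hζ))).1]
  simp only [hGp] at hX
  refine ⟨ζ, hζ, ?_⟩
  have hu0 : u ≠ 0 := norm_ne_zero_iff.1 (by rw [hu]; exact one_ne_zero)
  refine mul_left_cancel₀ hu0 (Complex.ext hX ?_)
  have hflat : (u * f z₂).im = (u * f z₁).im := by
    have := congrArg im huw
    rw [mul_sub, sub_im, neg_im, ofReal_im] at this
    linarith
  have e1 : (u * w).im = (u * f z₁).im := by
    have : u * w = u * f z₁ + s * (u * f z₂ - u * f z₁) := by rw [hw]; ring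
    rw [this, add_im, im_ofReal_mul, sub_im, hflat]; ring
  have e2 : (u * f ζ).im = (u * f z₁).im := by
    have : u * F ζ = u * F z₁ + a * (u * F z₂ - u * F z₁) := by rw [hζa, hp]; ring
    rw [him, this, add_im, im_ofReal_mul, sub_im, ← him, ← him, hflat]; ring
  exact e2.trans e1.symm

/-! ### Starlikeness in Chichra's class and convexity of its convolutions -/

namespace CoeffW

variable {c : ℕ → ℂ} (hc : CoeffW c)
include hc

theorem deriv_powSer {z : ℂ} (hz : ‖z‖ < 1) :
    deriv (powSer c) z = powSer (fun n => ((n : ℂ) + 1) * c (n + 1)) z :=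
  (hasDerivAt_powSer hc.rad hz).deriv

theorem re_deriv_powSer_pos {z : ℂ} (hz : ‖z‖ < 1) : 0 < (deriv (powSer c) z).re := by
  rw [hc.deriv_powSer hz]
  exact hc.re_deriv_pos hz

theorem deriv_ne_zero {z : ℂ} (hz : ‖z‖ < 1) : deriv (powSer c) z ≠ 0 := fun h => by
  have := hc.re_deriv_powSer_pos hz
  rw [h] at this
  simp at this

theorem injOn : Set.InjOn (powSer c) unitDisk := by
  have := injOn_of_norm_deriv_lt (h := powSer c) (g := fun _ => 0) (differentiableOn_powSer hc.rad)
    (differentiableOn_const 0) fun z hz => by simpa using hc.re_deriv_powSer_pos hz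
  simpa using this

theorem powSer_eq_mul {z : ℂ} (hz : ‖z‖ < 1) :
    powSer c z = z * powSer (fun n => c (n + 1)) z := by
  rw [mul_powSer_shift hc.rad hz, hc.zero, sub_zero]

theorem apply_zero : powSer c 0 = 0 := by rw [powSer_zero, hc.zero]

theorem re_starlike_pos {z : ℂ} (hz : ‖z‖ < 1) (hz0 : z ≠ 0) :
    0 < (powSer c z / (z * deriv (powSer c) z)).re := by
  have hG : ∀ z, ‖z‖ < 1 → 0 < (powSer (fun n => c (n + 1)) z).re := fun z hz => by
    linarith [hc.half_le_re_shift hz]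
  have h1 := re_deriv_div_pos hc.rad hc.one hG
    (fun w hw => by linarith [hG w hw, hc.re_pos w hw]) hz
  rw [hc.powSer_eq_mul hz, mul_div_mul_left _ _ hz0, hc.deriv_powSer hz, ← inv_div, inv_re]
  exact div_pos h1 (normSq_pos.2 fun h => by simp [h] at h1)

theorem exists_eq_smul {z : ℂ} (hz : ‖z‖ < 1) {s : ℝ} (hs : s ∈ Set.Icc (0 : ℝ) 1) :
    ∃ ζ, ‖ζ‖ ≤ ‖z‖ ∧ powSer c ζ = s * powSer c z :=
  exists_eq_smul_of_starlike (differentiableOn_powSer hc.rad) hc.injOn hc.apply_zero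
    (fun _ hz => hc.deriv_ne_zero hz) (fun _ hz hz0 => hc.re_starlike_pos hz hz0) hz hs

theorem mul_of_half_le {d : ℕ → ℂ} (hd : RadOne d) (hd1 : d 1 = 1)
    (hre : ∀ z, ‖z‖ < 1 → 1 / 2 ≤ (powSer (fun n => d (n + 1)) z).re) :
    CoeffW (fun n => c n * d n) where
  rad := hc.rad.mul hd
  zero := by rw [hc.zero, zero_mul]
  one := by rw [hc.one, hd1, mul_one]
  re_pos z hz := by
    have := re_powSer_mul_pos hc.rad.chichra hd.shift hc.chichra_zero hd1
      (fun z hz => (hc.re_pos z hz).le) hre hz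
    convert! this using 3
    ext n; simp only [chichra]; ring

/-- The convolution of two functions of `classW` is convex. -/
theorem re_convex_pos_of_mul {d : ℕ → ℂ} (hd : CoeffW d) {z : ℂ} (hz : ‖z‖ < 1) :
    0 < (1 + z * deriv (deriv (powSer fun n => c n * d n)) z /
      deriv (powSer fun n => c n * d n) z).re := by
  have he : CoeffW (fun n => c n * d n) :=
    hc.mul_of_half_le hd.rad hd.one fun z hz => hd.half_le_re_shift hz
  set e : ℕ → ℂ := fun n => c n * d n with hedef
  -- Alexander's correspondence: this series is z times the derivative of the convolution, and its
  -- starlikeness is the convexity of the convolution.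
  set E : ℕ → ℂ := fun n => (n : ℂ) * e n with hE
  have rE : RadOne E := RadOne.unshift (by
    refine he.rad.shift.mul_succ.mono fun n => ?_
    simp [hE])
  have hP := fun (w : ℂ) (hw : ‖w‖ < 1) => (hc.re_pos w hw).le
  have hd' := hd.rad.shift.mul_succ
  have hG : ∀ w, ‖w‖ < 1 → 0 < (powSer (fun n => E (n + 1)) w).re := fun w hw => by
    have := re_powSer_mul_pos hc.rad.chichra hd.rad_shift_div hc.chichra_zero (by simp [hd.one]) hP
      (fun w hw => by linarith [hd.three_quarters_le_re hw]) hw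
    convert! this using 3
    ext n
    have := Nat.cast_add_one_ne_zero (R := ℂ) n
    simp only [hE, hedef, chichra]
    push_cast
    field_simp
  have hlog : (0.6931471803 : ℝ) < Real.log 2 := Real.log_two_gt_d9
  -- K is the multiplier for which P * K is 2/3 of the quantity required positive by the
  -- starlikeness criterion; the factor 2/3 makes K(0) = 1. Re K ≥ 1/2 amounts to Re D' + (3/4)/2 ≥
  -- 3/4, and 2 log 2 - 1 > 3/8 just suffices.
  set K : ℕ → ℂ := fun n => (2 / 3 : ℂ) * ((((n : ℂ) + 1) * d (n + 1)) +
    (1 / 2 : ℂ) * (d (n + 1) / ((n : ℂ) + 1))) with hK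
  have rK : RadOne K := (hd'.add (hd.rad_shift_div.const_mul _)).const_mul _
  have hKre : ∀ w, ‖w‖ < 1 → 1 / 2 ≤ (powSer K w).re := fun w hw => by
    rw [hK, powSer_const_mul, powSer_add hd' (hd.rad_shift_div.const_mul _) hw, powSer_const_mul]
    have h1 := hd.re_deriv_ge hw
    have h2 := hd.three_quarters_le_re hw
    have e1 : ∀ x y : ℂ, ((2 / 3 : ℂ) * (x + (1 / 2 : ℂ) * y)).re = 2 / 3 * (x.re + 1 / 2 * y.re) := by
      intro x y
      rw [show (2 / 3 : ℂ) = ((2 / 3 : ℝ) : ℂ) by push_cast; rfl,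
        show (1 / 2 : ℂ) = ((1 / 2 : ℝ) : ℂ) by push_cast; rfl, re_ofReal_mul, add_re, re_ofReal_mul]
    rw [e1]
    linarith
  have hsum : ∀ w, ‖w‖ < 1 → 0 < (powSer (chichra E) w).re +
      (powSer (fun n => E (n + 1)) w).re / 2 := fun w hw => by
    have h1 := re_powSer_mul_pos hc.rad.chichra rK hc.chichra_zero (by simp [hK, hd.one]; norm_num) hP
      hKre hw
    have h2 : (fun n => HarmonicAnalogue.chichra c n * K n) =
        fun n => (2 / 3 : ℂ) * (chichra E n + (1 / 2 : ℂ) * E (n + 1)) := by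
      ext n
      have := Nat.cast_add_one_ne_zero (R := ℂ) n
      simp only [hE, hedef, chichra, hK]
      push_cast
      field_simp
    rw [h2, powSer_const_mul, powSer_add rE.chichra (rE.shift.const_mul _) hw, powSer_const_mul] at h1
    have e1 : ∀ x y : ℂ, ((2 / 3 : ℂ) * (x + (1 / 2 : ℂ) * y)).re = 2 / 3 * (x.re + 1 / 2 * y.re) := by
      intro x y
      rw [show (2 / 3 : ℂ) = ((2 / 3 : ℝ) : ℂ) by push_cast; rfl,
        show (1 / 2 : ℂ) = ((1 / 2 : ℝ) : ℂ) by push_cast; rfl, re_ofReal_mul, add_re, re_ofReal_mul]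
    rw [e1] at h1
    linarith
  have key := re_deriv_div_pos rE (by simp [hE, he.one]) hG hsum hz
  have e2 : (fun n : ℕ => E (n + 1)) = fun n : ℕ => ((n : ℂ) + 1) * e (n + 1) := by
    ext n; simp [hE]
  have hD : Set.EqOn (deriv (powSer e)) (powSer (fun n => E (n + 1))) unitDisk := fun w hw => by
    rw [e2]; exact he.deriv_powSer (mem_disk.1 hw)
  have hne := he.deriv_ne_zero hz
  rw [eventuallyEq_deriv hD (mem_disk.2 hz)]
  rw [hD (mem_disk.2 hz)] at hne ⊢
  rw [powSer_mul_succ rE.shift hz, add_div, div_self hne] at key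
  exact key

end CoeffW

/-! ### Geometry and growth of the harmonic functions -/

namespace CoeffWH

variable {a b : ℕ → ℂ} (hab : CoeffWH a b)
include hab

theorem eqOn_add {k : ℂ} : Set.EqOn (fun z => powSer a z + k * powSer b z)
    (powSer fun n => a n + k * b n) unitDisk := fun z hz => by
  have hz := mem_disk.1 hz
  rw [powSer_add hab.rad_a (hab.rad_b.const_mul k) hz, powSer_const_mul]

theorem injOn_add {k : ℂ} (hk : ‖k‖ = 1) :
    Set.InjOn (fun z => powSer a z + k * powSer b z) unitDisk :=
  (hab.coeffW hk.le).injOn.congr hab.eqOn_add.symm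

theorem deriv_add_ne_zero {k : ℂ} (hk : ‖k‖ = 1) {z : ℂ} (hz : ‖z‖ < 1) :
    deriv (fun z => powSer a z + k * powSer b z) z ≠ 0 := by
  rw [eventuallyEq_deriv hab.eqOn_add (mem_disk.2 hz)]
  exact (hab.coeffW hk.le).deriv_ne_zero hz

theorem norm_deriv_lt {z : ℂ} (hz : ‖z‖ < 1) :
    ‖deriv (powSer b) z‖ < (deriv (powSer a) z).re := by
  obtain ⟨k, hk, hkw⟩ := exists_unit_mul_eq_neg_norm (deriv (powSer b) z)
  have h := (hab.coeffW hk.le).re_deriv_powSer_pos hz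
  rw [← eventuallyEq_deriv hab.eqOn_add (mem_disk.2 hz)] at h
  have h1 := hasDerivAt_of_mem_disk (differentiableOn_powSer hab.rad_a) hz
  have h2 := hasDerivAt_of_mem_disk (differentiableOn_powSer hab.rad_b) hz
  have h3 : deriv (fun z => powSer a z + k * powSer b z) z = _ := (h1.add (h2.const_mul k)).deriv
  rw [h3, hkw] at h
  simpa using h

theorem injOn : Set.InjOn (fun z => powSer a z + conj (powSer b z)) unitDisk :=
  injOn_of_norm_deriv_lt (differentiableOn_powSer hab.rad_a) (differentiableOn_powSer hab.rad_b)
    fun _ hz => hab.norm_deriv_lt hz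

theorem starConvex {ρ : ℝ} (hρ0 : 0 < ρ) (hρ : ρ ≤ 1) :
    StarConvex ℝ 0 ((fun z => powSer a z + conj (powSer b z)) '' Metric.ball 0 ρ) := by
  rintro _ ⟨z, hz, rfl⟩ s t hs ht hst
  have hzρ := mem_ball_zero_iff.1 hz
  have hz1 := hzρ.trans_le hρ
  have h0 : powSer a 0 = 0 := by rw [powSer_zero, hab.a_zero]
  have h0' : powSer b 0 = 0 := by rw [powSer_zero, hab.b_zero]
  have := shear_segment (differentiableOn_powSer hab.rad_a) (differentiableOn_powSer hab.rad_b)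
    (Metric.ball_subset_ball hρ) (z₁ := 0) (z₂ := z) (by simpa using hρ0) hz
    (fun k hk => hab.injOn_add hk) (fun k hk _ hz => hab.deriv_add_ne_zero hk hz)
    (fun k hk s hs => by
      obtain ⟨ζ, h1, h2⟩ := (hab.coeffW hk.le).exists_eq_smul hz1 hs
      refine ⟨ζ, mem_ball_zero_iff.2 (h1.trans_lt hzρ), ?_⟩
      have e1 := hab.eqOn_add (k := k) (mem_disk.2 hz1)
      have e2 := hab.eqOn_add (k := k) (mem_disk.2 (h1.trans_lt hz1))
      simp only at e1 e2 ⊢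
      rw [h0, h0', e1, e2, h2]
      ring) (s := t) ⟨ht, by linarith⟩
  simpa [h0, h0', mul_add] using this

theorem convex_image
    (hcv : ∀ k : ℂ, ‖k‖ = 1 → ∀ z, ‖z‖ < 1 →
      0 < (1 + z * deriv (deriv (powSer fun n => a n + k * b n)) z /
        deriv (powSer fun n => a n + k * b n) z).re) :
    Convex ℝ ((fun z => powSer a z + conj (powSer b z)) '' unitDisk) := by
  rintro _ ⟨z₁, h₁, rfl⟩ _ ⟨z₂, h₂, rfl⟩ s t hs ht hst
  have := shear_segment (differentiableOn_powSer hab.rad_a) (differentiableOn_powSer hab.rad_b)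
    subset_rfl h₁ h₂ (fun k hk => hab.injOn_add hk) (fun k hk _ hz => hab.deriv_add_ne_zero hk hz)
    (fun k hk s hs => by
      have hW := hab.coeffW hk.le
      obtain ⟨ζ, h3, h4⟩ := segment_subset_image (differentiableOn_powSer hW.rad) hW.injOn
        (fun _ hz => hW.deriv_ne_zero hz) (hcv k hk) (mem_disk.1 h₁) (mem_disk.1 h₂) hs
      refine ⟨ζ, h3, ?_⟩
      have e1 := hab.eqOn_add (k := k) h₁
      have e2 := hab.eqOn_add (k := k) h₂
      have e3 := hab.eqOn_add (k := k) h3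
      simp only at e1 e2 e3 ⊢
      rw [e1, e2, e3, h4]) (s := t) ⟨ht, by linarith⟩
  convert! this using 1
  obtain rfl : s = 1 - t := by linarith
  simp
  ring

/-- The real derivative v ↦ h'v + conj(g'v) is injective because |g'| < |h'|, hence surjective, and
the map is locally open. -/
theorem isOpen_image {ρ : ℝ} (hρ : ρ ≤ 1) :
    IsOpen ((fun z => powSer a z + conj (powSer b z)) '' Metric.ball 0 ρ) := by
  rw [isOpen_iff_mem_nhds]
  rintro _ ⟨z, hz, rfl⟩
  have hz1 : ‖z‖ < 1 := (mem_ball_zero_iff.1 hz).trans_le hρ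
  have sd : ∀ {c : ℕ → ℂ}, RadOne c → HasStrictFDerivAt (powSer c)
      ((ContinuousLinearMap.toSpanSingleton ℂ (deriv (powSer c) z)).restrictScalars ℝ) z := by
    intro c hc
    exact (((differentiableOn_powSer hc).analyticAt (Metric.isOpen_ball.mem_nhds
      (mem_disk.2 hz1))).hasStrictDerivAt.hasStrictFDerivAt).restrictScalars ℝ
  have hs : HasStrictFDerivAt (fun z => powSer a z + conj (powSer b z)) _ z := (sd hab.rad_a).add
    (conjCLE.toContinuousLinearMap.hasStrictFDerivAt.comp z (sd hab.rad_b))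
  rw [← hs.map_nhds_eq_of_surj ?_]
  · exact image_mem_map (Metric.isOpen_ball.mem_nhds hz)
  · rw [LinearMap.range_eq_top]
    refine (LinearMap.injective_iff_surjective).1 ((injective_iff_map_eq_zero _).2 fun v hv => ?_)
    by_contra hv0
    have hv' : deriv (powSer a) z * v = -conj (deriv (powSer b) z * v) := by
      simp at hv
      rw [map_mul]
      linear_combination hv
    have h1 := congrArg norm hv'
    rw [norm_neg, norm_conj, norm_mul, norm_mul] at h1
    have h2 := mul_right_cancel₀ (norm_ne_zero_iff.2 hv0) h1
    have h3 := hab.norm_deriv_lt hz1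
    linarith [Complex.re_le_norm (deriv (powSer a) z)]

theorem continuousOn : ContinuousOn (fun z => powSer a z + conj (powSer b z)) unitDisk :=
  (differentiableOn_powSer hab.rad_a).continuousOn.add
    (continuous_conj.comp_continuousOn (differentiableOn_powSer hab.rad_b).continuousOn)

theorem lower_growth {z : ℂ} (hz : ‖z‖ < 1) :
    -‖z‖ - 2 * dilog (-‖z‖) ≤ ‖powSer a z + conj (powSer b z)‖ := by
  rcases eq_or_ne z 0 with rfl | hz0
  · simp [dilog_zero]
  -- The rotation opposes the co-analytic part, so the analytic bound becomes one for |h/z| - |g/z|.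
  obtain ⟨k, hk, hkw⟩ := exists_unit_mul_eq_neg_norm (powSer (fun n => b (n + 1)) z)
  have h := (hab.coeffW hk.le).le_norm_mul_re_shift hz
  have e1 : powSer a z = z * powSer (fun n => a (n + 1)) z := by
    rw [mul_powSer_shift hab.rad_a hz, hab.a_zero, sub_zero]
  have e2 : powSer b z = z * powSer (fun n => b (n + 1)) z := by
    rw [mul_powSer_shift hab.rad_b hz, hab.b_zero, sub_zero]
  rw [powSer_add hab.rad_a.shift (hab.rad_b.shift.const_mul k) hz, powSer_const_mul, hkw] at h
  refine h.trans ?_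
  have h3 : ‖powSer a z‖ - ‖powSer b z‖ ≤ ‖powSer a z + conj (powSer b z)‖ := by
    have := norm_sub_norm_le (powSer a z) (-conj (powSer b z))
    rwa [norm_neg, norm_conj, sub_neg_eq_add] at this
  refine le_trans ?_ h3
  rw [e1, e2, norm_mul, norm_mul, ← mul_sub]
  refine mul_le_mul_of_nonneg_left ?_ (norm_nonneg z)
  have := Complex.re_le_norm (powSer (fun n => a (n + 1)) z)
  simp
  linarith

theorem upper_growth {z : ℂ} (hz : ‖z‖ < 1) :
    ‖powSer a z + conj (powSer b z)‖ ≤ -‖z‖ + 2 * dilog ‖z‖ := by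
  obtain ⟨k, hk, hkw⟩ := exists_unit_mul_eq_neg_norm (powSer b z)
  obtain ⟨l, hl, hlw⟩ := exists_unit_mul_eq_neg_norm (powSer a z)
  have hl0 : l ≠ 0 := norm_ne_zero_iff.1 (by rw [hl]; exact one_ne_zero)
  -- The quotient of the two rotations gives h and k g the same argument at z, so that |h + k g| =
  -- |h| + |g|.
  have h := (hab.coeffW (k := k / l) (by rw [norm_div, hk, hl, div_one])).norm_powSer_le hz
  rw [powSer_add hab.rad_a (hab.rad_b.const_mul _) hz, powSer_const_mul] at h
  refine le_trans ?_ h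
  have e : l * (powSer a z + k / l * powSer b z) = -((‖powSer a z‖ + ‖powSer b z‖ : ℝ) : ℂ) := by
    rw [mul_add, hlw, ← mul_assoc, mul_div_cancel₀ _ hl0, hkw]
    push_cast; ring
  have e' := congrArg norm e
  rw [norm_mul, hl, one_mul, norm_neg, Complex.norm_real, Real.norm_of_nonneg (by positivity)] at e'
  rw [e']
  refine (norm_add_le _ _).trans ?_
  rw [norm_conj]

/-- Alignment of the two coefficients bounds the sum of their moduli, which is stronger than the
bound on the difference. -/
theorem norm_coeff_add_le (n : ℕ) : ‖a (n + 2)‖ + ‖b (n + 2)‖ ≤ 2 / ((n : ℝ) + 2) ^ 2 := by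
  obtain ⟨k, hk, hkw⟩ := exists_unit_mul_eq_neg_norm (b (n + 2))
  obtain ⟨l, hl, hlw⟩ := exists_unit_mul_eq_neg_norm (a (n + 2))
  have hl0 : l ≠ 0 := norm_ne_zero_iff.1 (by rw [hl]; exact one_ne_zero)
  have h := (hab.coeffW (k := k / l) (by rw [norm_div, hk, hl, div_one])).norm_coeff_le n
  have e : l * (a (n + 2) + k / l * b (n + 2)) = -((‖a (n + 2)‖ + ‖b (n + 2)‖ : ℝ) : ℂ) := by
    rw [mul_add, hlw, ← mul_assoc, mul_div_cancel₀ _ hl0, hkw]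
    push_cast; ring
  have e' := congrArg norm e
  rw [norm_mul, hl, one_mul, norm_neg, Complex.norm_real, Real.norm_of_nonneg (by positivity)] at e'
  rwa [e'] at h

theorem ball_subset_image :
    Metric.ball (0 : ℂ) (Real.pi ^ 2 / 6 - 1) ⊆
      (fun z => powSer a z + conj (powSer b z)) '' unitDisk := by
  intro w hw
  rw [mem_ball_zero_iff] at hw
  set m : ℝ → ℝ := fun r => -r - 2 * dilog (-r) with hm
  have hlim : Tendsto m (𝓝[<] 1) (𝓝 (m 1)) := by
    have h1 : ContinuousWithinAt m (Set.Icc 0 1) 1 := by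
      refine ContinuousWithinAt.sub (by fun_prop) (continuousWithinAt_const.mul ?_)
      refine (continuousOn_dilog (-1) (by simp)).comp (t := Set.Icc (-1) 1) (by fun_prop) ?_
      intro x hx
      exact ⟨by linarith [hx.2], by linarith [hx.1]⟩
    refine h1.tendsto.mono_left ?_
    rw [nhdsWithin_le_iff]
    filter_upwards [Ioo_mem_nhdsLT (zero_lt_one (α := ℝ))] with x hx
    exact ⟨hx.1.le, hx.2.le⟩
  have hm1 : m 1 = Real.pi ^ 2 / 6 - 1 := by simp only [hm, dilog_neg_one]; ring
  obtain ⟨r, hr, hr0, hr1⟩ := ((hlim.eventually (lt_mem_nhds (hm1 ▸ hw))).and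
    (Ioo_mem_nhdsLT (zero_lt_one (α := ℝ)))).exists
  set f : ℂ → ℂ := fun z => powSer a z + conj (powSer b z) with hf
  have hsubc : Metric.closedBall (0 : ℂ) r ⊆ unitDisk := Metric.closedBall_subset_ball hr1
  have hcl : IsClosed (f '' Metric.closedBall 0 r) :=
    ((isCompact_closedBall _ _).image_of_continuousOn (hab.continuousOn.mono hsubc)).isClosed
  have hmpos : 0 < m r := (norm_nonneg w).trans_lt hr
  -- By the growth bound the disk of radius m(r) misses the image of the circle |z| = r. It is thus
  -- covered by the image of the open disk and the complement of the image of the closed one, two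
  -- disjoint open sets, and being connected it lies in the first.
  have hsub := IsPreconnected.subset_left_of_subset_union (hab.isOpen_image hr1.le) hcl.isOpen_compl
    (Set.disjoint_compl_right_iff_subset.2 (Set.image_mono Metric.ball_subset_closedBall))
    (s := Metric.ball 0 (m r)) (fun x hx => by
      by_cases hx' : x ∈ f '' Metric.closedBall 0 r
      · left
        obtain ⟨z, hz, rfl⟩ := hx'
        rcases (mem_closedBall_zero_iff.1 hz).lt_or_eq with h | h
        · exact ⟨z, mem_ball_zero_iff.2 h, rfl⟩
        · have := hab.lower_growth (z := z) (h ▸ hr1)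
          rw [h] at this
          exact absurd (mem_ball_zero_iff.1 hx) (not_lt.2 this)
      · exact Or.inr hx')
    ⟨0, by simpa using hmpos, 0, by simpa using hr0, by simp [powSer_zero, hab.a_zero, hab.b_zero]⟩
    (convex_ball _ _).isPreconnected
  exact Set.image_mono (Metric.ball_subset_ball hr1.le) (hsub (mem_ball_zero_iff.2 hr))

end CoeffWH

/-! ### Starlike domains are close-to-convex -/

/-- A domain that is starlike with respect to the origin is close-to-convex. -/
theorem isCloseToConvexDomain_of_starConvex {Ω : Set ℂ} (ho : IsOpen Ω) (hc : IsConnected Ω)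
    (h0 : (0 : ℂ) ∈ Ω) (hst : StarConvex ℝ 0 Ω) : IsCloseToConvexDomain Ω := by
  have hsm : ∀ w ∈ Ω, ∀ t : ℝ, 0 ≤ t → t ≤ 1 → (t : ℂ) * w ∈ Ω := fun w hw t h0 h1 => by
    simpa using hst.smul_mem hw h0 h1
  -- The half-lines are radial: each starts at the first exit point p from the domain and has
  -- direction p itself, so that its points are (1 + t)p.
  refine ⟨ho, hc, {l | l.2 = l.1 ∧ l.1 ∉ Ω ∧ ∀ t : ℝ, 0 ≤ t → t < 1 → (t : ℂ) * l.1 ∈ Ω}, ?_, ?_, ?_⟩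
  · rintro ⟨p, u⟩ ⟨hu, hp, -⟩ h
    simp only at hu hp h
    exact hp (by rw [← hu, h]; exact h0)
  · rintro ⟨p, u⟩ ⟨hu, hp, hpt⟩ ⟨p', u'⟩ ⟨hu', hp', hpt'⟩ hne
    simp only at hu hu' hp hp' hpt hpt'
    subst hu hu'
    rw [Set.disjoint_left]
    rintro w ⟨t, ht, hw⟩ ⟨t', ht', hw'⟩
    have key : (1 + t : ℂ) * u = (1 + t') * u' := by
      simp only at hw hw'
      linear_combination hw' - hw
    have ht1 : (1 + t : ℂ) ≠ 0 := by exact_mod_cast (by linarith : (1 + t : ℝ) ≠ 0)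
    have ht1' : (1 + t' : ℂ) ≠ 0 := by exact_mod_cast (by linarith : (1 + t' : ℝ) ≠ 0)
    rcases lt_trichotomy t t' with h | h | h
    · refine hp' ?_
      have := hpt ((1 + t) / (1 + t')) (by positivity) ((div_lt_one (by linarith)).2 (by linarith))
      convert! this using 1
      push_cast
      field_simp
      linear_combination -key
    · subst h
      have := mul_left_cancel₀ ht1 key
      exact hne (by rw [this])
    · refine hp ?_
      have := hpt' ((1 + t') / (1 + t)) (by positivity) ((div_lt_one (by linarith)).2 (by linarith))
      convert! this using 1
      push_cast
      field_simp
      linear_combination key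
  · ext w
    simp only [Set.mem_compl_iff, Set.mem_iUnion]
    constructor
    · intro hw
      have hcomp : IsCompact (Set.Icc (0 : ℝ) 1 ∩ (fun t : ℝ => (t : ℂ) * w) ⁻¹' Ωᶜ) :=
        isCompact_Icc.inter_right (ho.isClosed_compl.preimage (by fun_prop))
      obtain ⟨t, ⟨ht, htw⟩, hmin⟩ := hcomp.exists_isMinOn ⟨1, by simp, by simpa using hw⟩
        continuous_id.continuousOn
      have ht0 : 0 < t := by
        refine lt_of_le_of_ne ht.1 ?_
        rintro rfl
        exact htw (by simpa using h0)
      have htC : (t : ℂ) ≠ 0 := by exact_mod_cast ht0.ne'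
      refine ⟨((t : ℂ) * w, (t : ℂ) * w), ⟨rfl, htw, fun s hs hs1 => ?_⟩, 1 / t - 1, ?_, ?_⟩
      · by_contra hcon
        have hst1 : s * t < t := mul_lt_of_lt_one_left ht0 hs1
        have h2 := hmin (a := s * t) ⟨⟨mul_nonneg hs ht.1, hst1.le.trans ht.2⟩, by
          simpa [mul_assoc] using hcon⟩
        exact absurd hst1 (not_lt.2 h2)
      · rw [sub_nonneg]
        exact (one_le_div ht0).2 ht.2
      · push_cast
        field_simp
        ring
    · rintro ⟨⟨p, u⟩, ⟨hu, hp, -⟩, t, ht, hw⟩ hwΩ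
      simp only at hu hp hw
      subst hu
      refine hp ?_
      have := hsm w hwΩ (1 / (1 + t)) (by positivity) ((div_le_one (by linarith)).2 (by linarith))
      convert! this using 1
      have ht1 : (1 + t : ℂ) ≠ 0 := by exact_mod_cast (by linarith : (1 + t : ℝ) ≠ 0)
      rw [hw]
      push_cast
      field_simp
      try ring

/-! ### Convex analytic functions and the Marx–Strohhäcker theorem -/

/-- An injective analytic function has no critical points. -/
theorem deriv_ne_zero_of_injOn {F : ℂ → ℂ} (hF : DifferentiableOn ℂ F unitDisk)
    (hinj : Set.InjOn F unitDisk) {z₀ : ℂ} (hz₀ : ‖z₀‖ < 1) : deriv F z₀ ≠ 0 := by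
  intro hd
  have hD : unitDisk ∈ 𝓝 z₀ := Metric.isOpen_ball.mem_nhds (mem_disk.2 hz₀)
  set f : ℂ → ℂ := fun z => F z - F z₀ with hf
  have fan : AnalyticAt ℂ f z₀ := (hF.analyticAt hD).sub analyticAt_const
  have hfd : HasDerivAt f 0 z₀ := by
    have := (hasDerivAt_of_mem_disk hF hz₀).sub_const (F z₀)
    rwa [hd] at this
  have htop : analyticOrderAt f z₀ ≠ ⊤ := by
    intro htop
    have h1 : ∀ᶠ z in 𝓝[≠] z₀, f z = 0 := (analyticOrderAt_eq_top.1 htop).filter_mono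
      nhdsWithin_le_nhds
    obtain ⟨z, ⟨h2, h3⟩, h4⟩ := ((h1.and (nhdsWithin_le_nhds hD)).and
      (self_mem_nhdsWithin (s := {z₀}ᶜ))).exists
    exact h4 (hinj h3 (mem_disk.2 hz₀) (sub_eq_zero.1 h2))
  obtain ⟨g, gan, hg0, hfg⟩ := fan.analyticOrderAt_ne_top.1 htop
  set n := analyticOrderNatAt f z₀ with hn
  have hn0 : n ≠ 0 := by
    intro h
    have := hfg.self_of_nhds
    rw [h] at this
    simp [hf] at this
    exact hg0 this.symm
  have hn1 : n ≠ 1 := by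
    intro h
    rw [h] at hfg
    have h1 : HasDerivAt (fun z => (z - z₀) ^ 1 • g z) (g z₀) z₀ := by
      convert! ((((hasDerivAt_id z₀).sub_const z₀).pow 1).mul gan.differentiableAt.hasDerivAt) using 1
      simp
    exact hg0 ((h1.congr_of_eventuallyEq hfg).unique hfd)
  have hnC : (n : ℂ) ≠ 0 := by exact_mod_cast hn0
  -- An analytic n-th root of g/g(z₀). It puts F - F(z₀) in the form ψⁿ · const with ψ a local
  -- coordinate; as n ≥ 2, two points whose ψ-values differ by a primitive root of unity contradict
  -- injectivity.
  set v : ℂ → ℂ := fun z => cexp (Complex.log (g z / g z₀) / n) with hv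
  have van : AnalyticAt ℂ v z₀ := by
    refine AnalyticAt.cexp (AnalyticAt.div (AnalyticAt.clog (gan.div analyticAt_const hg0) ?_)
      analyticAt_const hnC)
    rw [div_self hg0]
    exact one_mem_slitPlane
  have hv0 : v z₀ = 1 := by simp [hv, div_self hg0]
  set ψ : ℂ → ℂ := fun z => (z - z₀) * v z with hψ
  have ψan : AnalyticAt ℂ ψ z₀ := (analyticAt_id.sub analyticAt_const).mul van
  have hψ' : HasDerivAt ψ 1 z₀ := by
    convert! (((hasDerivAt_id z₀).sub_const z₀).mul van.differentiableAt.hasDerivAt) using 1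
    simp [hv0]
  have hψs : HasStrictDerivAt ψ 1 z₀ := by
    have := ψan.hasStrictDerivAt
    rwa [hψ'.deriv] at this
  have hmap := hψs.map_nhds_eq one_ne_zero
  have hpow : ∀ᶠ z in 𝓝 z₀, z ∈ unitDisk ∧ f z = ψ z ^ n * g z₀ := by
    filter_upwards [hfg, gan.continuousAt.eventually_ne hg0, hD] with z h1 h2 h3
    refine ⟨h3, ?_⟩
    rw [h1, hψ, mul_pow, smul_eq_mul, hv]
    simp only
    rw [← Complex.exp_nat_mul, mul_div_cancel₀ _ hnC, Complex.exp_log (div_ne_zero h2 hg0)]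
    field_simp
  have himg : ψ '' {z | z ∈ unitDisk ∧ f z = ψ z ^ n * g z₀} ∈ 𝓝 (0 : ℂ) := by
    have h0 : ψ z₀ = 0 := by simp [hψ]
    rw [← h0, ← hmap]
    exact image_mem_map hpow
  obtain ⟨ε, hε, hball⟩ := Metric.mem_nhds_iff.1 himg
  set ω : ℂ := cexp (2 * Real.pi * I / n) with hω
  have hprim : IsPrimitiveRoot ω n := Complex.isPrimitiveRoot_exp n hn0
  have hωn : ‖ω‖ = 1 := hprim.norm'_eq_one hn0
  have hω1 : ω ≠ 1 := fun h => hn1 (hprim.eq_orderOf.trans (by rw [h, orderOf_one]))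
  have hx : ((ε / 2 : ℝ) : ℂ) ∈ Metric.ball (0 : ℂ) ε := by
    rw [mem_ball_zero_iff, Complex.norm_real, Real.norm_of_nonneg (by positivity)]
    linarith
  have hy : ((ε / 2 : ℝ) : ℂ) * ω ∈ Metric.ball (0 : ℂ) ε := by
    rw [mem_ball_zero_iff, norm_mul, hωn, Complex.norm_real, Real.norm_of_nonneg (by positivity)]
    linarith
  obtain ⟨z₁, ⟨h1, h2⟩, h3⟩ := hball hx
  obtain ⟨z₂, ⟨h4, h5⟩, h6⟩ := hball hy
  have h7 : f z₁ = f z₂ := by rw [h2, h5, h3, h6, mul_pow, hprim.pow_eq_one, mul_one]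
  have h8 : z₁ = z₂ := hinj h1 h4 (sub_left_injective h7)
  rw [h8, h6] at h3
  have hε0 : ((ε / 2 : ℝ) : ℂ) ≠ 0 := by exact_mod_cast (by positivity : ε / 2 ≠ 0)
  exact hω1 (mul_left_cancel₀ hε0 (by rw [h3, mul_one]))

/-- Subordination: images of concentric circles under a convex function are convex curves. -/
theorem re_div_nonneg_of_convex {F : ℂ → ℂ} (hF : DifferentiableOn ℂ F unitDisk)
    (hinj : Set.InjOn F unitDisk) (hconv : Convex ℝ (F '' unitDisk)) {z ζ : ℂ}
    (hz : ‖z‖ < 1) (hz0 : z ≠ 0) (hζz : ‖ζ‖ = ‖z‖) :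
    0 ≤ ((F z - F ζ) / (z * deriv F z)).re := by
  obtain ⟨G, hG⟩ := exists_inverse hF hinj fun _ hz => deriv_ne_zero_of_injOn hF hinj hz
  set x := ζ / z with hx
  have hx1 : ‖x‖ = 1 := by rw [hx, norm_div, hζz, div_self (norm_ne_zero_iff.2 hz0)]
  have hxz : x * z = ζ := div_mul_cancel₀ _ hz0
  have hxD : ∀ w ∈ unitDisk, x * w ∈ unitDisk := fun w hw => by
    rw [mem_disk, norm_mul, hx1, one_mul]; exact mem_disk.1 hw
  have hle : ∀ t ∈ Set.Icc (0 : ℝ) 1, ‖G (F z + t * (F ζ - F z))‖ ≤ ‖z‖ := by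
    intro t ht
    have hmem : ∀ w ∈ unitDisk, ∃ ξ ∈ unitDisk, F ξ = F w + t * (F (x * w) - F w) := by
      intro w hw
      have := hconv.add_smul_sub_mem (Set.mem_image_of_mem F hw)
        (Set.mem_image_of_mem F (hxD w hw)) ht
      simpa using this
    -- Schwarz's lemma for w ↦ F⁻¹((1 - t)F(w) + tF(xw)), defined on the disk by convexity and
    -- fixing 0. The preimage of the chord therefore never exceeds |z|, and the derivative of its
    -- squared modulus at t = 0 is not positive.
    have := norm_le_norm_of_mapsTo_ball (f := fun w => G (F w + t * (F (x * w) - F w))) (R := 1)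
      (fun w hw => ?_) (fun w hw => ?_) ?_ hz
    · simpa only [hxz] using this
    · obtain ⟨ξ, hξ, hξw⟩ := hmem w hw
      have h1 := (hG ξ (mem_disk.1 hξ)).2.1
      rw [hξw] at h1
      have d1 := (hasDerivAt_of_mem_disk hF (mem_disk.1 hw)).differentiableAt
      have d2 : DifferentiableAt ℂ (fun w => F (x * w)) w :=
        DifferentiableAt.comp (g := F) w
          (hasDerivAt_of_mem_disk hF (mem_disk.1 (hxD w hw))).differentiableAt (by fun_prop)
      exact (DifferentiableAt.comp (g := G) w h1.differentiableAt
        (d1.add ((d2.sub d1).const_mul (t : ℂ)))).differentiableWithinAt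
    · obtain ⟨ξ, hξ, hξw⟩ := hmem w hw
      simp only
      rw [← hξw, (hG ξ (mem_disk.1 hξ)).1]
      exact Metric.ball_subset_closedBall hξ
    · have := (hG 0 (by simp)).1
      simpa using this
  obtain ⟨h1, h2, -⟩ := hG z hz
  have hl : HasDerivAt (fun t : ℝ => F z + (t : ℂ) * (F ζ - F z)) (F ζ - F z) (0 : ℝ) := by
    simpa using ((hasDerivAt_id (0 : ℝ)).ofReal_comp.mul_const (F ζ - F z)).const_add (F z)
  have hc : HasDerivAt (fun t : ℝ => G (F z + (t : ℂ) * (F ζ - F z)))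
      ((deriv F z)⁻¹ * (F ζ - F z)) (0 : ℝ) := by
    refine HasDerivAt.comp (h₂ := G) (h := fun t : ℝ => F z + (t : ℂ) * (F ζ - F z)) (0 : ℝ) ?_ hl
    simpa using h2
  have hm := hasDerivAt_normSq_comp hc
  by_contra! hcon
  have hns : 0 < normSq z := normSq_pos.2 hz0
  have hF0 := deriv_ne_zero_of_injOn hF hinj hz
  have hpos : 0 < (conj z * ((deriv F z)⁻¹ * (F ζ - F z))).re := by
    have e : conj z * ((deriv F z)⁻¹ * (F ζ - F z)) =
        ((normSq z : ℝ) : ℂ) * -((F z - F ζ) / (z * deriv F z)) := by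
      rw [normSq_eq_conj_mul_self]
      field_simp
      ring
    rw [e, re_ofReal_mul, neg_re]
    exact mul_pos hns (neg_pos.2 hcon)
  have hev := eventually_lt_right_of_hasDerivAt_pos hm (by
    simp only [ofReal_zero, zero_mul, add_zero, h1]; linarith)
  obtain ⟨t, ht1, ht2⟩ := (hev.and (Ioo_mem_nhdsGT (zero_lt_one (α := ℝ)))).exists
  simp only [ofReal_zero, zero_mul, add_zero, h1] at ht1
  rw [normSq_eq_norm_sq, normSq_eq_norm_sq, sq_lt_sq₀ (norm_nonneg _) (norm_nonneg _)] at ht1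
  exact absurd ht1 (not_lt.2 (hle t ⟨ht2.1.le, ht2.2.le⟩))

/-- The theorem of Marx and Strohhäcker for convex functions. -/
theorem half_le_re_div_of_classK {F : ℂ → ℂ} (hK : F ∈ classK) {ζ : ℂ} (hζ : ‖ζ‖ < 1)
    (hζ0 : ζ ≠ 0) : 1 / 2 ≤ (F ζ / ζ).re := by
  obtain ⟨⟨hF, hF0, hF1⟩, hinj, hconv⟩ := hK
  have hζD : unitDisk ∈ 𝓝 ζ := Metric.isOpen_ball.mem_nhds (mem_disk.2 hζ)
  set r := ‖ζ‖ with hr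
  have hr0 : 0 < r := norm_pos_iff.2 hζ0
  have hF' := fun z (hz : ‖z‖ < 1) => deriv_ne_zero_of_injOn hF hinj hz
  have hne : ∀ z, ‖z‖ < 1 → z ≠ ζ → F z - F ζ ≠ 0 := fun z hz hzζ h =>
    hzζ (hinj (mem_disk.2 hz) (mem_disk.2 hζ) (sub_eq_zero.1 h))
  set S := dslope F ζ with hS
  have dS : DifferentiableOn ℂ S unitDisk := (differentiableOn_dslope hζD).2 hF
  have hS1 : S ζ = deriv F ζ := dslope_same F ζ
  have hS2 : ∀ z, z ≠ ζ → S z = (F z - F ζ) / (z - ζ) := fun z hz => by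
    rw [hS, dslope_of_ne F hz, slope_def_field]
  have hS0 : ∀ z ∈ unitDisk, S z ≠ 0 := fun z hz => by
    rcases eq_or_ne z ζ with rfl | h
    · rw [hS1]; exact hF' _ hζ
    · rw [hS2 z h]; exact div_ne_zero (hne z (mem_disk.1 hz) h) (sub_ne_zero.2 h)
  -- The divided differences `S` and `H` remove the singularity at ζ of 2zF'/(F - F(ζ)) - (z + ζ)/(z
  -- - ζ). On |z| = |ζ| the second fraction is imaginary and the first has nonnegative real part by
  -- convexity.
  set N : ℂ → ℂ := fun z => 2 * z * deriv F z / S z - (z + ζ) with hN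
  have dF' : DifferentiableOn ℂ (deriv F) unitDisk := hF.deriv Metric.isOpen_ball
  have dN : DifferentiableOn ℂ N unitDisk :=
    (DifferentiableOn.div (DifferentiableOn.mul (by fun_prop) dF') dS hS0).sub (by fun_prop)
  have hNζ : N ζ = 0 := by
    have := hF' ζ hζ
    simp only [hN, hS1]
    field_simp
    ring
  set H := dslope N ζ with hH
  have dH : DifferentiableOn ℂ H unitDisk := (differentiableOn_dslope hζD).2 dN
  have hH2 : ∀ z, ‖z‖ < 1 → z ≠ ζ →
      H z = 2 * z * deriv F z / (F z - F ζ) - (z + ζ) / (z - ζ) := fun z hz hzζ => by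
    rw [hH, dslope_of_ne N hzζ, slope_def_field, hNζ, sub_zero, hN]
    simp only
    rw [hS2 z hzζ]
    have h1 := hne z hz hzζ
    have h2 := sub_ne_zero.2 hzζ
    field_simp
  have hcirc : ∀ z, ‖z‖ = r → z ≠ ζ → 0 ≤ (H z).re := by
    intro z hz hzζ
    have hz1 : ‖z‖ < 1 := hz ▸ hζ
    have hz0 : z ≠ 0 := norm_pos_iff.1 (hz ▸ hr0)
    have h1 := re_div_nonneg_of_convex hF hinj hconv hz1 hz0 (ζ := ζ) (hz ▸ rfl)
    have h2 : 0 ≤ (2 * z * deriv F z / (F z - F ζ)).re := by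
      have e : 2 * z * deriv F z / (F z - F ζ) =
          ((2 : ℝ) : ℂ) * ((F z - F ζ) / (z * deriv F z))⁻¹ := by
        rw [inv_div]; push_cast; ring
      rw [e, re_ofReal_mul, inv_re]
      exact mul_nonneg two_pos.le (div_nonneg h1 (normSq_nonneg _))
    have h3 : ((z + ζ) / (z - ζ)).re = 0 := by
      rw [div_re, ← add_div]
      refine div_eq_zero_iff.2 (Or.inl ?_)
      have e1 : normSq z = normSq ζ := by rw [normSq_eq_norm_sq, normSq_eq_norm_sq, hz]
      rw [normSq_apply, normSq_apply] at e1
      simp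
      linarith
    rw [hH2 z hz1 hzζ, sub_re, h3, sub_zero]
    exact h2
  have hcirc' : ∀ z, ‖z‖ = r → 0 ≤ (H z).re := by
    intro z hz
    rcases eq_or_ne z ζ with rfl | h
    · have hcont : ContinuousAt (fun θ : ℝ => (H (z * cexp (θ * I))).re) 0 := by
        refine continuous_re.continuousAt.comp (ContinuousAt.comp (g := H)
          (f := fun θ : ℝ => z * cexp (θ * I)) ?_ (by fun_prop))
        simpa using (hasDerivAt_of_mem_disk dH hζ).continuousAt
      have hlim : Tendsto (fun θ : ℝ => (H (z * cexp (θ * I))).re) (𝓝[>] 0) (𝓝 (H z).re) := by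
        simpa using tendsto_nhdsWithin_of_tendsto_nhds hcont.tendsto
      refine ge_of_tendsto hlim ?_
      filter_upwards [Ioo_mem_nhdsGT Real.pi_pos] with θ hθ
      refine hcirc _ (by rw [norm_mul, norm_exp_ofReal_mul_I, mul_one]) fun h => ?_
      have h1 : cexp (θ * I) = 1 := mul_left_cancel₀ hζ0 (by rw [h, mul_one])
      have h2 := congrArg im h1
      rw [exp_ofReal_mul_I_im, one_im] at h2
      exact (Real.sin_pos_of_pos_of_lt_pi hθ.1 hθ.2).ne' h2
    · exact hcirc z hz h
  have hball : ∀ z, ‖z‖ < r → 0 ≤ (H z).re := by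
    intro z hz
    have hsub : closure (Metric.ball (0 : ℂ) r) ⊆ unitDisk := by
      rw [closure_ball _ hr0.ne']
      exact Metric.closedBall_subset_ball hζ
    -- The maximum principle for exp(-H) carries Re H ≥ 0 from the circle to the disk.
    have := norm_le_of_forall_mem_frontier_norm_le (U := Metric.ball (0 : ℂ) r) (C := 1)
      (f := fun z => cexp (-H z)) Metric.isBounded_ball
      ((DifferentiableOn.mono (dH.neg.cexp) hsub).diffContOnCl) (fun w hw => ?_)
      (subset_closure (mem_ball_zero_iff.2 hz))
    · rw [Complex.norm_exp, Real.exp_le_one_iff, neg_re] at this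
      linarith
    · rw [frontier_ball _ hr0.ne', mem_sphere_zero_iff_norm] at hw
      rw [Complex.norm_exp, Real.exp_le_one_iff, neg_re]
      linarith [hcirc' w hw]
  set u : ℂ → ℂ := fun w => H (r * w) with hu
  have hrw : ∀ w : ℂ, ‖w‖ < 1 → ‖(r : ℂ) * w‖ < r := fun w hw => by
    rw [norm_mul, Complex.norm_real, Real.norm_of_nonneg hr0.le]
    exact mul_lt_of_lt_one_right hr0 hw
  have du : DifferentiableOn ℂ u unitDisk := dH.comp (by fun_prop) fun w hw =>
    mem_disk.2 ((hrw w (mem_disk.1 hw)).trans hζ)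
  have hu0 : u 0 = 1 := by
    simp only [hu, mul_zero]
    rw [hH2 0 (by simp) hζ0.symm]
    simp
    field_simp
  have hcara := norm_coeff_le_two (radOne_taylorCoeff du) (by rw [taylorCoeff_zero, hu0])
    (fun w hw => by rw [← eqOn_powSer du hw]; exact hball _ (hrw w hw)) one_ne_zero
  rw [taylorCoeff_one] at hcara
  have hFζ : F ζ ≠ 0 := fun h => hζ0 (hinj (mem_disk.2 hζ) (mem_disk.2 (by simp)) (h.trans hF0.symm))
  have hH' : HasDerivAt H (2 / ζ - 2 / F ζ) 0 := by
    have h1 : HasDerivAt (fun z : ℂ => 2 * z * deriv F z / (F z - F ζ) - (z + ζ) / (z - ζ))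
        (2 / ζ - 2 / F ζ) 0 := by
      have a1 := (((hasDerivAt_id (0 : ℂ)).const_mul 2).mul
        (hasDerivAt_of_mem_disk dF' (z := 0) (by simp))).div
        ((hasDerivAt_of_mem_disk hF (z := 0) (by simp)).sub_const (F ζ)) (by simpa [hF0] using hFζ)
      have a2 := ((hasDerivAt_id (0 : ℂ)).add_const ζ).div ((hasDerivAt_id (0 : ℂ)).sub_const ζ)
        (by simpa using hζ0)
      convert! a1.sub a2 using 1
      simp [hF0, hF1]
      field_simp
      ring
    refine h1.congr_of_eventuallyEq ?_
    filter_upwards [Metric.isOpen_ball.mem_nhds (mem_disk.2 (by simp : ‖(0 : ℂ)‖ < 1)),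
      isOpen_ne.mem_nhds hζ0.symm] with z h2 h3
    exact hH2 z (mem_disk.1 h2) h3
  have hu' : HasDerivAt u ((2 / ζ - 2 / F ζ) * r) 0 := by
    refine HasDerivAt.comp (h₂ := H) (0 : ℂ) (by simpa using hH') ?_
    simpa using (hasDerivAt_id (0 : ℂ)).const_mul (r : ℂ)
  rw [hu'.deriv] at hcara
  set y := F ζ / ζ with hy
  have hy0 : y ≠ 0 := div_ne_zero hFζ hζ0
  -- Since H(0) = 1 and H'(0) = 2/ζ - 2/F(ζ), Carathéodory's bound reads |1 - 1/y| ≤ 1, that is, Re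
  -- y ≥ 1/2.
  have h1 : ‖y - 1‖ ≤ ‖y‖ := by
    have e : (2 / ζ - 2 / F ζ) * r = 2 * (y - 1) / y * (r / ζ) := by
      rw [hy]; field_simp
    have er : ‖(r : ℂ) / ζ‖ = 1 := by
      rw [norm_div, Complex.norm_real, Real.norm_of_nonneg hr0.le, ← hr, div_self hr0.ne']
    clear_value y
    rw [e, norm_mul, er, mul_one, norm_div, norm_mul, div_le_iff₀ (norm_pos_iff.2 hy0)] at hcara
    simp at hcara
    linarith
  rw [← sq_le_sq₀ (norm_nonneg _) (norm_nonneg _), ← normSq_eq_norm_sq, ← normSq_eq_norm_sq,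
    normSq_apply, normSq_apply] at h1
  simp at h1
  linarith

/-! ### Passage between the function classes and their coefficients -/

theorem IsCanonical.dz_dzbar {f h g : ℂ → ℂ} (hc : IsCanonical f h g) {z : ℂ} (hz : ‖z‖ < 1) :
    dz f z = deriv h z ∧ dzbar f z = conj (deriv g z) := by
  have h1 := (hasDerivAt_of_mem_disk hc.analytic_h hz).hasFDerivAt.restrictScalars ℝ
  have h2 := (hasDerivAt_of_mem_disk hc.analytic_g hz).hasFDerivAt.restrictScalars ℝ
  have h3 : HasFDerivAt (fun z => h z + conj (g z)) _ z :=
    h1.add (conjCLE.toContinuousLinearMap.hasFDerivAt.comp z h2)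
  have h4 := h3.congr_of_eventuallyEq (Filter.eventuallyEq_of_mem
    (Metric.isOpen_ball.mem_nhds (mem_disk.2 hz)) hc.eq_on)
  constructor
  · rw [dz, h4.fderiv]
    simp
    ring_nf
    simp
    ring
  · rw [dzbar, h4.fderiv]
    simp
    ring_nf
    simp
    ring

theorem IsCanonical.harmonicOnNhd {f h g : ℂ → ℂ} (hc : IsCanonical f h g) :
    InnerProductSpace.HarmonicOnNhd f unitDisk := by
  intro z hz
  have hD := Metric.isOpen_ball.mem_nhds hz
  have h1 := (hc.analytic_h.analyticAt hD).harmonicAt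
  have h2 := (hc.analytic_g.analyticAt hD).harmonicAt_conj
  exact (InnerProductSpace.harmonicAt_congr_nhds (Filter.eventuallyEq_of_mem hD hc.eq_on)).2
    (h1.add h2)

/-- Membership supplies some decomposition, not necessarily the given one; the Wirtinger derivatives
of f identify h' and g' in both. -/
theorem coeffWH_of_mem {f h g : ℂ → ℂ} (hf : f ∈ classWH0) (hc : IsCanonical f h g) :
    CoeffWH (taylorCoeff h) (taylorCoeff g) := by
  obtain ⟨⟨-, hf0, hf1, hf2⟩, h', g', hc', hlt⟩ := hf
  have z0 : ‖(0 : ℂ)‖ < 1 := by simp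
  have e1 : Set.EqOn (deriv h) (deriv h') unitDisk := fun z hz => by
    rw [← (hc.dz_dzbar (mem_disk.1 hz)).1, (hc'.dz_dzbar (mem_disk.1 hz)).1]
  have e2 : Set.EqOn (deriv g) (deriv g') unitDisk := fun z hz => by
    apply star_injective
    exact (hc.dz_dzbar (mem_disk.1 hz)).2.symm.trans (hc'.dz_dzbar (mem_disk.1 hz)).2
  refine ⟨radOne_taylorCoeff hc.analytic_h, radOne_taylorCoeff hc.analytic_g, ?_, ?_, ?_, ?_, ?_⟩
  · have := hc.eq_on 0 (mem_disk.2 z0)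
    rw [hf0, hc.g_zero, map_zero, add_zero] at this
    rw [taylorCoeff_zero, ← this]
  · rw [taylorCoeff_one, ← (hc.dz_dzbar z0).1, hf1]
  · rw [taylorCoeff_zero, hc.g_zero]
  · have := (hc.dz_dzbar z0).2
    rw [hf2] at this
    rw [taylorCoeff_one]
    exact (map_eq_zero _).1 this.symm
  · intro z hz
    rw [← deriv_add_mul_deriv_deriv hc.analytic_h hz, ← deriv_add_mul_deriv_deriv hc.analytic_g hz,
      eventuallyEq_deriv e1 (mem_disk.2 hz), eventuallyEq_deriv e2 (mem_disk.2 hz),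
      e1 (mem_disk.2 hz), e2 (mem_disk.2 hz)]
    exact hlt z (mem_disk.2 hz)

theorem CoeffWH.isCanonical {a b : ℕ → ℂ} (hab : CoeffWH a b) {f : ℂ → ℂ}
    (hf : ∀ z, ‖z‖ < 1 → f z = powSer a z + conj (powSer b z)) :
    IsCanonical f (powSer a) (powSer b) :=
  ⟨differentiableOn_powSer hab.rad_a, differentiableOn_powSer hab.rad_b,
    by rw [powSer_zero, hab.b_zero], fun z hz => hf z (mem_disk.1 hz)⟩

theorem CoeffWH.mem_classWH0 {a b : ℕ → ℂ} (hab : CoeffWH a b) {f : ℂ → ℂ}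
    (hf : ∀ z, ‖z‖ < 1 → f z = powSer a z + conj (powSer b z)) : f ∈ classWH0 := by
  have hc := hab.isCanonical hf
  have z0 : ‖(0 : ℂ)‖ < 1 := by simp
  refine ⟨⟨hc.harmonicOnNhd, ?_, ?_, ?_⟩, _, _, hc, fun z hz => ?_⟩
  · rw [hf 0 z0, powSer_zero, powSer_zero, hab.a_zero, hab.b_zero]; simp
  · rw [(hc.dz_dzbar z0).1, ← taylorCoeff_one, taylorCoeff_powSer hab.rad_a, hab.a_one]
  · rw [(hc.dz_dzbar z0).2, ← taylorCoeff_one, taylorCoeff_powSer hab.rad_b, hab.b_one, map_zero]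
  · have hz := mem_disk.1 hz
    rw [deriv_add_mul_deriv_deriv hc.analytic_h hz, deriv_add_mul_deriv_deriv hc.analytic_g hz,
      funext (taylorCoeff_powSer hab.rad_a), funext (taylorCoeff_powSer hab.rad_b)]
    exact hab.lt_re z hz

theorem IsCanonical.eq_powSer {f h g : ℂ → ℂ} (hc : IsCanonical f h g) {z : ℂ} (hz : ‖z‖ < 1) :
    f z = powSer (taylorCoeff h) z + conj (powSer (taylorCoeff g) z) := by
  rw [hc.eq_on z (mem_disk.2 hz), eqOn_powSer hc.analytic_h hz, eqOn_powSer hc.analytic_g hz]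

theorem exists_coeffWH_of_mem {f : ℂ → ℂ} (hf : f ∈ classWH0) : ∃ a b, CoeffWH a b ∧
    ∀ z, ‖z‖ < 1 → f z = powSer a z + conj (powSer b z) := by
  obtain ⟨h, g, hc, -⟩ := hf.2
  exact ⟨_, _, coeffWH_of_mem hf hc, fun z hz => hc.eq_powSer hz⟩

namespace CoeffWH

variable {a b : ℕ → ℂ} (hab : CoeffWH a b) {f : ℂ → ℂ}
  (hf : ∀ z, ‖z‖ < 1 → f z = powSer a z + conj (powSer b z))
include hab hf

theorem sensePreservingOn : SensePreservingOn f unitDisk := by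
  intro z hz
  have hz := mem_disk.1 hz
  obtain ⟨e1, e2⟩ := (hab.isCanonical hf).dz_dzbar hz
  rw [e1, e2, norm_conj, sub_pos, sq_lt_sq₀ (norm_nonneg _) (norm_nonneg _)]
  exact (hab.norm_deriv_lt hz).trans_le (Complex.re_le_norm _)

omit hab in
theorem eqOn_unitDisk : Set.EqOn (fun z => powSer a z + conj (powSer b z)) f unitDisk :=
  fun z hz => (hf z (mem_disk.1 hz)).symm

theorem mem_classSH0 : f ∈ classSH0 :=
  ⟨(hab.mem_classWH0 hf).1, hab.injOn.congr (eqOn_unitDisk hf), hab.sensePreservingOn hf⟩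

omit hab in
theorem image_eq {ρ : ℝ} (hρ : ρ ≤ 1) : f '' Metric.ball 0 ρ =
    (fun z => powSer a z + conj (powSer b z)) '' Metric.ball 0 ρ :=
  Set.image_congr fun z hz => hf z ((mem_ball_zero_iff.1 hz).trans_le hρ)

theorem starlikeIn {ρ : ℝ} (hρ0 : 0 < ρ) (hρ : ρ ≤ 1) : StarlikeIn f ρ := by
  have hsub : Metric.ball (0 : ℂ) ρ ⊆ unitDisk := Metric.ball_subset_ball hρ
  refine ⟨(hab.mem_classSH0 hf).2.1.mono hsub, fun z hz => hab.sensePreservingOn hf z (hsub hz), ?_⟩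
  rw [image_eq hf hρ]
  exact hab.starConvex hρ0 hρ

theorem closeToConvexIn {ρ : ℝ} (hρ0 : 0 < ρ) (hρ : ρ ≤ 1) : CloseToConvexIn f ρ := by
  obtain ⟨h1, h2, h3⟩ := hab.starlikeIn hf hρ0 hρ
  refine ⟨h1, h2, ?_⟩
  have hsub : Metric.ball (0 : ℂ) ρ ⊆ unitDisk := Metric.ball_subset_ball hρ
  rw [image_eq hf hρ] at h3 ⊢
  refine isCloseToConvexDomain_of_starConvex (hab.isOpen_image hρ)
    (((convex_ball _ _).isConnected ⟨0, by simpa using hρ0⟩).image _ (hab.continuousOn.mono hsub))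
    ⟨0, by simpa using hρ0, ?_⟩ h3
  simp [powSer_zero, hab.a_zero, hab.b_zero]

end CoeffWH

/-! ### Closure under convolutions -/

theorem CoeffW.half_add {c d : ℕ → ℂ} (hc : CoeffW c) (hd : CoeffW d) :
    CoeffW (fun n => (1 / 2 : ℂ) * (c n + d n)) where
  rad := (hc.rad.add hd.rad).const_mul _
  zero := by simp [hc.zero, hd.zero]
  one := by simp [hc.one, hd.one]; norm_num
  re_pos z hz := by
    have e : chichra (fun n => (1 / 2 : ℂ) * (c n + d n)) =
        fun n => ((1 / 2 : ℝ) : ℂ) * (chichra c n + chichra d n) := by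
      ext n; simp only [chichra]; push_cast; ring
    rw [e, powSer_const_mul, powSer_add hc.rad.chichra hd.rad.chichra hz, re_ofReal_mul, add_re]
    linarith [hc.re_pos z hz, hd.re_pos z hz]

theorem CoeffWH.mul {a b a' b' : ℕ → ℂ} (h : CoeffWH a b) (h' : CoeffWH a' b') :
    CoeffWH (fun n => a n * a' n) (fun n => b n * b' n) := by
  refine coeffWH_of_coeffW (h.rad_a.mul h'.rad_a) (h.rad_b.mul h'.rad_b) fun k hk => ?_
  have h1 := h.coeffW (k := 1) (by simp)
  have h2 := h.coeffW (k := -1) (by simp)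
  have h3 := h'.coeffW (k := k) hk.le
  have h4 := h'.coeffW (k := -k) (by simp [hk])
  -- Polarization: aa' + k bb' is the mean of (a + b)(a' + k b') and (a - b)(a' - k b'), two
  -- products inside Chichra's class.
  have h5 := (h1.mul_of_half_le h3.rad h3.one fun z hz => h3.half_le_re_shift hz).half_add
    (h2.mul_of_half_le h4.rad h4.one fun z hz => h4.half_le_re_shift hz)
  convert! h5 using 1
  ext n; ring

theorem CoeffWH.mul_of_half_le {a b d : ℕ → ℂ} (h : CoeffWH a b) (hd : RadOne d) (hd1 : d 1 = 1)
    (hre : ∀ z, ‖z‖ < 1 → 1 / 2 ≤ (powSer (fun n => d (n + 1)) z).re) :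
    CoeffWH (fun n => a n * d n) (fun n => b n * d n) := by
  refine coeffWH_of_coeffW (h.rad_a.mul hd) (h.rad_b.mul hd) fun k hk => ?_
  convert! (h.coeffW hk.le).mul_of_half_le hd hd1 hre using 1
  ext n; ring

/-- Needed for stable convexity: h + c conj g is the harmonic function whose co-analytic part is
built from conj(c) g. -/
theorem CoeffWH.const_mul_right {a b : ℕ → ℂ} (h : CoeffWH a b) {k : ℂ} (hk : ‖k‖ = 1) :
    CoeffWH a (fun n => k * b n) := by
  refine coeffWH_of_coeffW h.rad_a (h.rad_b.const_mul k) fun l hl => ?_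
  convert! h.coeffW (k := l * k) (by rw [norm_mul, hk, hl, one_mul]) using 1
  ext n; ring

theorem CoeffWH.mem_classKH0_of_mul {a b d : ℕ → ℂ} (h : CoeffWH a b) (hd : CoeffW d) {f : ℂ → ℂ}
    (hf : ∀ z, ‖z‖ < 1 →
      f z = powSer (fun n => a n * d n) z + conj (powSer (fun n => b n * d n) z)) :
    f ∈ classKH0 := by
  have h1 := h.mul_of_half_le hd.rad hd.one fun z hz => hd.half_le_re_shift hz
  refine ⟨h1.mem_classSH0 hf, ?_⟩
  rw [CoeffWH.image_eq hf le_rfl]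
  refine h1.convex_image fun k hk z hz => ?_
  have e : (fun n => a n * d n + k * (b n * d n)) = fun n => (a n + k * b n) * d n := by
    ext n; ring
  rw [e]
  exact (h.coeffW hk.le).re_convex_pos_of_mul hd hz

theorem CoeffWH.mem_classSKH0_of_mul {a b d : ℕ → ℂ} (h : CoeffWH a b) (hd : CoeffW d)
    {f : ℂ → ℂ} (hf : ∀ z, ‖z‖ < 1 →
      f z = powSer (fun n => a n * d n) z + conj (powSer (fun n => b n * d n) z)) :
    f ∈ classSKH0 := by
  have h1 := h.mul_of_half_le hd.rad hd.one fun z hz => hd.half_le_re_shift hz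
  refine ⟨h1.mem_classSH0 hf, _, _, h1.isCanonical hf, fun c hc => ?_⟩
  refine (h.const_mul_right (k := conj c) (by rwa [norm_conj])).mem_classKH0_of_mul hd fun z _ => ?_
  simp only [mul_assoc]
  rw [powSer_const_mul, map_mul, conj_conj]

/-- The growth of a power series divided by `z`, in terms of the function. -/
theorem half_le_re_shift_of_half_le {φ : ℂ → ℂ} (hφ : φ ∈ classA)
    (h : ∀ z, ‖z‖ < 1 → z ≠ 0 → 1 / 2 ≤ (φ z / z).re) {z : ℂ} (hz : ‖z‖ < 1) :
    1 / 2 ≤ (powSer (fun n => taylorCoeff φ (n + 1)) z).re := by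
  obtain ⟨hd, h0, h1⟩ := hφ
  rcases eq_or_ne z 0 with rfl | hz0
  · rw [powSer_zero, zero_add, taylorCoeff_one, h1]
    norm_num
  · have e := mul_powSer_shift (radOne_taylorCoeff hd) hz
    rw [taylorCoeff_zero, h0, sub_zero, ← eqOn_powSer hd hz] at e
    have := h z hz hz0
    rwa [← e, mul_div_cancel_left₀ _ hz0] at this

/-! ### The extremal function and sharpness -/

/-- The coefficients of `extremal`. -/
def extremalCoeff (n : ℕ) : ℂ := if n = 0 then 0 else if n = 1 then 1 else 2 / (n : ℂ) ^ 2

theorem extremalCoeff_add_two (n : ℕ) : extremalCoeff (n + 2) = 2 / ((n : ℂ) + 2) ^ 2 := by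
  simp [extremalCoeff]

theorem radOne_extremalCoeff : RadOne extremalCoeff := by
  refine radOne_of_bound (B := 2) fun n => ?_
  rcases n with _ | _ | n
  · simp [extremalCoeff]
  · simp [extremalCoeff]
  · rw [extremalCoeff_add_two, norm_div, norm_pow,
      show ((n : ℂ) + 2) = ((n + 2 : ℕ) : ℂ) by push_cast; rfl, Complex.norm_natCast]
    push_cast
    have : (0 : ℝ) ≤ n := n.cast_nonneg
    simp only [Complex.norm_ofNat]
    exact div_le_self two_pos.le (one_le_pow₀ (by linarith))

theorem extremal_eq_powSer {z : ℂ} (hz : ‖z‖ < 1) : extremal z = powSer extremalCoeff z := by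
  have h := (hasSum_nat_add_iff' 2).2 (radOne_extremalCoeff.hasSum hz)
  simp only [extremalCoeff_add_two] at h
  rw [extremal, h.tsum_eq]
  simp [Finset.sum_range_succ, extremalCoeff]

/-- All coefficients after the constant 1 equal 2, which gives the half-plane map, extremal for both
Harnack's and Carathéodory's inequalities. -/
theorem powSer_chichra_extremalCoeff {z : ℂ} (hz : ‖z‖ < 1) :
    powSer (chichra extremalCoeff) z = (1 + z) / (1 - z) := by
  have h1 : (1 : ℂ) - z ≠ 0 := fun h => by
    rw [← sub_eq_zero.1 h] at hz
    simp at hz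
  have h2 : ∀ n, chichra extremalCoeff (n + 1) = 2 := fun n => by
    have : ((n : ℂ) + 2) ≠ 0 := by exact_mod_cast (by omega : n + 2 ≠ 0)
    rw [chichra, extremalCoeff_add_two]
    push_cast
    rw [show (n : ℂ) + 1 + 1 = n + 2 by ring]
    field_simp
  have h3 := mul_powSer_shift radOne_extremalCoeff.chichra hz
  simp only [h2] at h3
  have h4 : powSer (fun _ => 2) z = 2 * (1 - z)⁻¹ := by
    rw [powSer, tsum_mul_left, tsum_geometric_of_norm_lt_one hz]
  have h5 : chichra extremalCoeff 0 = 1 := by simp [chichra, extremalCoeff]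
  rw [h4, h5] at h3
  rw [eq_div_iff h1]
  field_simp at h3
  linear_combination -h3

theorem coeffWH_extremalCoeff : CoeffWH extremalCoeff 0 := by
  refine ⟨radOne_extremalCoeff, radOne_of_bound (B := 0) (by simp), by simp [extremalCoeff],
    by simp [extremalCoeff], rfl, rfl, fun z hz => ?_⟩
  have h0 : powSer (chichra 0) z = 0 := by simp [powSer, chichra]
  rw [h0, norm_zero, powSer_chichra_extremalCoeff hz, div_re, ← add_div]
  have h1 : (1 : ℂ) - z ≠ 0 := fun h => by
    rw [← sub_eq_zero.1 h] at hz
    simp at hz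
  refine div_pos ?_ (normSq_pos.2 h1)
  have h2 : normSq z < 1 := by
    rw [normSq_eq_norm_sq]
    exact pow_lt_one₀ (norm_nonneg z) hz two_ne_zero
  rw [normSq_apply] at h2
  simp
  nlinarith

theorem powSer_zero_coeff (z : ℂ) : powSer 0 z = 0 := by simp [powSer]

theorem extremal_eq {z : ℂ} (hz : ‖z‖ < 1) :
    extremal z = powSer extremalCoeff z + conj (powSer 0 z) := by
  rw [extremal_eq_powSer hz, powSer_zero_coeff, map_zero, add_zero]

theorem coeffW_extremalCoeff : CoeffW extremalCoeff := by
  simpa using coeffWH_extremalCoeff.coeffW (k := 0) (by simp)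

theorem extremal_ofReal {x : ℝ} (hx : |x| < 1) :
    extremal (x : ℂ) = ((-x + 2 * dilog x : ℝ) : ℂ) := by
  have h := (hasSum_nat_add_iff' 1).2 (hasSum_dilog hx.le)
  simp at h
  have h2 := Complex.hasSum_ofReal.2 (h.mul_left 2)
  rw [extremal]
  have e : (fun n : ℕ => 2 / ((n : ℂ) + 2) ^ 2 * (x : ℂ) ^ (n + 2)) =
      fun n : ℕ => ((2 * (x ^ (n + 1 + 1) / ((n : ℝ) + 1 + 1) ^ 2) : ℝ) : ℂ) := by
    ext n
    push_cast
    ring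
  rw [e, h2.tsum_eq]
  push_cast
  ring

/-- Real values of `extremal` have the sign of the argument. -/
theorem half_le_extremal_div {x : ℝ} (hx : |x| < 1) (hx0 : x ≠ 0) :
    1 / 2 ≤ (-x + 2 * dilog x) / x := by
  have hz : ‖(x : ℂ)‖ < 1 := by simpa using hx
  have hxC : (x : ℂ) ≠ 0 := by exact_mod_cast hx0
  have h := coeffW_extremalCoeff.half_le_re_shift hz
  have h1 := coeffW_extremalCoeff.powSer_eq_mul hz
  rw [← extremal_eq_powSer hz, extremal_ofReal hx] at h1
  have h2 : powSer (fun n => extremalCoeff (n + 1)) x = (((-x + 2 * dilog x) / x : ℝ) : ℂ) := by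
    rw [ofReal_div, h1]
    field_simp
  rwa [h2, ofReal_re] at h

theorem norm_extremal {r : ℝ} (h0 : 0 ≤ r) (h1 : r < 1) :
    ‖extremal (-(r : ℂ))‖ = -r - 2 * dilog (-r) ∧ ‖extremal (r : ℂ)‖ = -r + 2 * dilog r := by
  rcases h0.eq_or_lt with rfl | h0
  · have := extremal_ofReal (x := 0) (by simp)
    simp [dilog_zero] at this ⊢
    exact this
  have hr : |r| < 1 := by rwa [abs_of_pos h0]
  have hr' : |-r| < 1 := by rwa [abs_neg]
  constructor
  · rw [← ofReal_neg, extremal_ofReal hr', Complex.norm_real, Real.norm_eq_abs, abs_of_nonpos]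
    · ring
    · have := half_le_extremal_div hr' (neg_ne_zero.2 h0.ne')
      by_contra! hcon
      have h2 := div_neg_of_pos_of_neg hcon (neg_neg_of_pos h0)
      linarith
  · rw [extremal_ofReal hr, Complex.norm_real, Real.norm_of_nonneg]
    have := half_le_extremal_div hr h0.ne'
    by_contra! hcon
    have h2 := div_neg_of_neg_of_pos hcon h0
    linarith

/-- The lower growth function increases: its derivative 2 log(1 + s)/s - 1 is at least 2 log 2 - 1 >
0, by concavity of the logarithm. -/
theorem lower_growth_le_limit {r : ℝ} (h0 : 0 ≤ r) (h1 : r ≤ 1) :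
    -r - 2 * dilog (-r) ≤ Real.pi ^ 2 / 6 - 1 := by
  have hmono : MonotoneOn (fun r => -r - 2 * dilog (-r)) (Set.Icc 0 1) := by
    have hd : ∀ s ∈ Set.Ioo (0 : ℝ) 1, HasDerivAt (fun r => -r - 2 * dilog (-r))
        (-1 + 2 * (Real.log (1 + s) / s)) s := by
      intro s hs
      have := hasDerivAt_dilog (x := -s) (by rw [abs_neg, abs_of_pos hs.1]; exact hs.2)
        (neg_ne_zero.2 hs.1.ne')
      convert! (hasDerivAt_id s).neg.sub ((this.comp s (hasDerivAt_neg s)).const_mul 2) using 1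
      rw [sub_neg_eq_add]
      have := hs.1.ne'
      field_simp
      ring
    refine monotoneOn_of_deriv_nonneg (convex_Icc 0 1) ?_ ?_ ?_
    · refine ContinuousOn.sub (by fun_prop) (continuousOn_const.mul
        (continuousOn_dilog.comp continuousOn_neg fun s hs => ?_))
      exact ⟨by linarith [hs.2], by linarith [hs.1]⟩
    · rw [interior_Icc]
      exact fun s hs => (hd s hs).differentiableAt.differentiableWithinAt
    · rw [interior_Icc]
      intro s hs
      rw [(hd s hs).deriv]
      have h3 := strictConcaveOn_log_Ioi.concaveOn.2 (show (1 : ℝ) ∈ Set.Ioi 0 by simp)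
        (show (2 : ℝ) ∈ Set.Ioi 0 by simp) (show 0 ≤ 1 - s by linarith [hs.2]) hs.1.le (by ring)
      simp only [smul_eq_mul, Real.log_one, mul_zero, mul_one, zero_add] at h3
      rw [show 1 - s + s * 2 = 1 + s by ring] at h3
      have h4 : Real.log 2 ≤ Real.log (1 + s) / s := by
        rw [le_div_iff₀ hs.1, mul_comm]
        exact h3
      linarith [Real.log_two_gt_d9]
  have := hmono ⟨h0, h1⟩ (Set.right_mem_Icc.2 zero_le_one) h1
  simp only [dilog_neg_one] at this
  linarith

theorem extremal_conj {z : ℂ} (hz : ‖z‖ < 1) : extremal (conj z) = conj (extremal z) := by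
  rw [extremal_eq_powSer hz, extremal_eq_powSer (by rwa [norm_conj]), powSer, powSer, conj_tsum]
  refine tsum_congr fun n => ?_
  rw [map_mul, map_pow]
  congr 1
  rcases n with _ | _ | n
  · simp [extremalCoeff]
  · simp [extremalCoeff]
  · rw [extremalCoeff_add_two, show (2 : ℂ) / ((n : ℂ) + 2) ^ 2 =
      ((2 / ((n : ℝ) + 2) ^ 2 : ℝ) : ℂ) by push_cast; rfl, conj_ofReal]

theorem extremal_covering_sharp {R : ℝ} (hR : Metric.ball (0 : ℂ) R ⊆ extremal '' unitDisk) :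
    R ≤ Real.pi ^ 2 / 6 - 1 := by
  by_contra! hcon
  set κ := Real.pi ^ 2 / 6 - 1 with hκ
  have hκ0 : 0 < κ := by
    have := Real.pi_gt_three
    rw [hκ]; nlinarith
  obtain ⟨s, hs1, hs2⟩ := exists_between hcon
  obtain ⟨z, hz, hzs⟩ := hR (show ((-s : ℝ) : ℂ) ∈ Metric.ball 0 R by
    rw [mem_ball_zero_iff, Complex.norm_real, norm_neg, Real.norm_of_nonneg (by linarith)]
    exact hs2)
  have hz1 := mem_disk.1 hz
  -- Real coefficients and injectivity force a preimage of the real number -s to be real; on the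
  -- real diameter the values stay above -κ.
  have hconj : conj z = z := (coeffWH_extremalCoeff.mem_classSH0 fun z hz => extremal_eq hz).2.1
    (mem_disk.2 (by rwa [norm_conj])) hz (show extremal (conj z) = extremal z by rw [extremal_conj hz1, hzs, conj_ofReal])
  obtain ⟨x, rfl⟩ := conj_eq_iff_real.1 hconj
  have hx : |x| < 1 := by simpa using hz1
  rw [extremal_ofReal hx] at hzs
  have hxs : -x + 2 * dilog x = -s := by exact_mod_cast hzs
  rcases lt_trichotomy x 0 with h | rfl | h
  · have := lower_growth_le_limit (r := -x) (by linarith) (by linarith [(abs_lt.1 hx).1])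
    rw [neg_neg] at this
    linarith
  · rw [dilog_zero] at hxs
    linarith
  · have h1 := half_le_extremal_div hx h.ne'
    have h2 := div_neg_of_neg_of_pos (by linarith : -x + 2 * dilog x < 0) h
    linarith

/-! ### Compactness and convex combinations -/

/-- It suffices to have the weak inequality in the definition of `CoeffWH`. -/
theorem coeffWH_of_le {a b : ℕ → ℂ} (ha : RadOne a) (hb : RadOne b) (ha0 : a 0 = 0) (ha1 : a 1 = 1)
    (hb0 : b 0 = 0) (hb1 : b 1 = 0)
    (hle : ∀ z, ‖z‖ < 1 → ‖powSer (chichra b) z‖ ≤ (powSer (chichra a) z).re) : CoeffWH a b := by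
  refine coeffWH_of_coeffW ha hb fun k hk => ?_
  have hr : RadOne fun n => a n + k * b n := ha.add (hb.const_mul k)
  refine ⟨hr, by simp [ha0, hb0], by simp [ha1, hb1], fun z hz => re_pos_of_nonneg
    (differentiableOn_powSer hr.chichra) (by simp [powSer_zero, chichra, ha1, hb1])
    (fun w hw => ?_) hz⟩
  rw [powSer_chichra_add ha hb k hw, add_re]
  have h1 := hle w hw
  have h2 := neg_le_of_abs_le (Complex.abs_re_le_norm (k * powSer (chichra b) w))
  rw [norm_mul, hk, one_mul] at h2
  linarith

theorem CoeffWH.norm_le {a b : ℕ → ℂ} (h : CoeffWH a b) (n : ℕ) :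
    ‖a n‖ ≤ 2 / (n : ℝ) ^ 2 ∧ ‖b n‖ ≤ 2 / (n : ℝ) ^ 2 := by
  rcases n with _ | _ | n
  · simp [h.a_zero, h.b_zero]
  · simp [h.a_one, h.b_one]
  · have := h.norm_coeff_add_le n
    push_cast
    rw [show (n : ℝ) + 1 + 1 = n + 2 by ring]
    exact ⟨by linarith [norm_nonneg (b (n + 2))], by linarith [norm_nonneg (a (n + 2))]⟩

theorem norm_chichra_le {a : ℕ → ℂ} (h : ∀ n, ‖a n‖ ≤ 2 / (n : ℝ) ^ 2) (n : ℕ) :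
    ‖chichra a n‖ ≤ 2 := by
  have h1 := h (n + 1)
  rw [le_div_iff₀ (by positivity)] at h1
  rw [chichra, norm_mul, norm_mul, show ((n : ℂ) + 1) = ((n + 1 : ℕ) : ℂ) by push_cast; rfl,
    Complex.norm_natCast]
  linarith

theorem norm_le_two {a : ℕ → ℂ} (h : ∀ n, ‖a n‖ ≤ 2 / (n : ℝ) ^ 2) (n : ℕ) : ‖a n‖ ≤ 2 := by
  refine (h n).trans ?_
  rcases n with _ | n
  · simp
  · exact div_le_self two_pos.le (one_le_pow₀ (by push_cast; linarith [(n.cast_nonneg : (0 : ℝ) ≤ n)]))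

/-- The pairs of coefficient sequences of `classWH0`, as a subset of a product space. -/
def coeffSet : Set (ℕ → ℂ × ℂ) := {p | CoeffWH (fun n => (p n).1) (fun n => (p n).2)}

theorem isCompact_coeffSet : IsCompact coeffSet := by
  set K : Set (ℕ → ℂ × ℂ) := Set.univ.pi fun n =>
    Metric.closedBall 0 (2 / (n : ℝ) ^ 2) ×ˢ Metric.closedBall 0 (2 / (n : ℝ) ^ 2) with hK
  have hKc : IsCompact K := isCompact_univ_pi fun n =>
    (isCompact_closedBall _ _).prod (isCompact_closedBall _ _)
  have hK1 : ∀ p ∈ K, ∀ n, ‖(p n).1‖ ≤ 2 / (n : ℝ) ^ 2 := fun p hp n =>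
    mem_closedBall_zero_iff.1 (hp n trivial).1
  have hK2 : ∀ p ∈ K, ∀ n, ‖(p n).2‖ ≤ 2 / (n : ℝ) ^ 2 := fun p hp n =>
    mem_closedBall_zero_iff.1 (hp n trivial).2
  have hsum : ∀ z : ℂ, ‖z‖ < 1 → Summable fun n : ℕ => 2 * ‖z‖ ^ n := fun z hz =>
    (summable_geometric_of_lt_one (norm_nonneg z) hz).mul_left 2
  have hbd : ∀ (a : ℕ → ℂ) (z : ℂ), (∀ n, ‖a n‖ ≤ 2 / (n : ℝ) ^ 2) → ∀ n,
      ‖chichra a n * z ^ n‖ ≤ 2 * ‖z‖ ^ n := fun a z ha n => by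
    rw [norm_mul, norm_pow]
    exact mul_le_mul_of_nonneg_right (norm_chichra_le ha n) (by positivity)
  have hc1 : ∀ z : ℂ, ‖z‖ < 1 → ContinuousOn
      (fun p : ℕ → ℂ × ℂ => powSer (chichra fun n => (p n).1) z) K := fun z hz =>
    continuousOn_tsum (fun n => by unfold chichra; fun_prop) (hsum z hz)
      fun n p hp => hbd _ z (hK1 p hp) n
  have hc2 : ∀ z : ℂ, ‖z‖ < 1 → ContinuousOn
      (fun p : ℕ → ℂ × ℂ => powSer (chichra fun n => (p n).2) z) K := fun z hz =>
    continuousOn_tsum (fun n => by unfold chichra; fun_prop) (hsum z hz)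
      fun n p hp => hbd _ z (hK2 p hp) n
  -- Inside the compact product of disks, the class is cut out by closed conditions, one weak
  -- inequality for each point of the disk. The uniform bound 2 on the coefficients of F' + zF''
  -- makes each of them continuous in the coefficients.
  have heq : coeffSet = (K ∩ {p | p 0 = 0 ∧ p 1 = (1, 0)}) ∩ ⋂ z ∈ unitDisk,
      (K ∩ (fun p : ℕ → ℂ × ℂ => (powSer (chichra fun n => (p n).1) z).re -
        ‖powSer (chichra fun n => (p n).2) z‖) ⁻¹' Set.Ici 0) := by
    ext p
    simp only [Set.mem_inter_iff, Set.mem_iInter, Set.mem_preimage, Set.mem_Ici, sub_nonneg]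
    constructor
    · intro (h : CoeffWH _ _)
      have hpK : p ∈ K := fun n _ =>
        ⟨mem_closedBall_zero_iff.2 (h.norm_le n).1, mem_closedBall_zero_iff.2 (h.norm_le n).2⟩
      exact ⟨⟨hpK, Prod.ext h.a_zero h.b_zero, Prod.ext h.a_one h.b_one⟩,
        fun z hz => ⟨hpK, (h.lt_re z (mem_disk.1 hz)).le⟩⟩
    · rintro ⟨⟨hpK, h0, h1⟩, h2⟩
      refine coeffWH_of_le (radOne_of_bound (norm_le_two (hK1 p hpK)))
        (radOne_of_bound (norm_le_two (hK2 p hpK))) ?_ ?_ ?_ ?_ fun z hz =>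
          (h2 z (mem_disk.2 hz)).2
      · rw [h0]; rfl
      · rw [h1]
      · rw [h0]; rfl
      · rw [h1]
  rw [heq]
  refine (hKc.inter_right ?_).inter_right (isClosed_biInter fun z hz => ?_)
  · exact (isClosed_eq (continuous_apply 0) continuous_const).inter
      (isClosed_eq (continuous_apply 1) continuous_const)
  · have hz := mem_disk.1 hz
    exact ((continuous_re.comp_continuousOn (hc1 z hz)).sub (hc2 z hz).norm).preimage_isClosed_of_isClosed
      hKc.isClosed isClosed_Ici

/-- The summable bound 2/n² makes evaluation jointly continuous in coefficients and point, so
currying exhibits the class as a continuous image of the compact coefficient set. -/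
theorem isCompact_classWH0 :
    IsCompact {F : C(unitDisk, ℂ) | ∃ f ∈ classWH0, ∀ z : unitDisk, F z = f z} := by
  have : CompactSpace coeffSet := isCompact_iff_compactSpace.1 isCompact_coeffSet
  have hs : Summable fun n : ℕ => 2 / (n : ℝ) ^ 2 := by
    simpa [div_eq_mul_inv] using (Real.summable_one_div_nat_pow.2 one_lt_two).mul_left 2
  have hbd : ∀ (a : ℕ → ℂ) (z : ℂ), ‖z‖ < 1 → (∀ n, ‖a n‖ ≤ 2 / (n : ℝ) ^ 2) → ∀ n,
      ‖a n * z ^ n‖ ≤ 2 / (n : ℝ) ^ 2 := fun a z hz ha n => by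
    rw [norm_mul, norm_pow]
    exact (mul_le_of_le_one_right (norm_nonneg _) (pow_le_one₀ (norm_nonneg z) hz.le)).trans (ha n)
  have c1 : Continuous fun q : coeffSet × unitDisk =>
      powSer (fun n => (q.1.1 n).1) (q.2 : ℂ) :=
    continuous_tsum (fun n => (((continuous_apply n).comp
      (continuous_subtype_val.comp continuous_fst)).fst).mul
      ((continuous_subtype_val.comp continuous_snd).pow n)) hs
      fun n q => hbd _ _ (mem_disk.1 q.2.2) (fun n => (CoeffWH.norm_le q.1.2 n).1) n
  have c2 : Continuous fun q : coeffSet × unitDisk =>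
      powSer (fun n => (q.1.1 n).2) (q.2 : ℂ) :=
    continuous_tsum (fun n => (((continuous_apply n).comp
      (continuous_subtype_val.comp continuous_fst)).snd).mul
      ((continuous_subtype_val.comp continuous_snd).pow n)) hs
      fun n q => hbd _ _ (mem_disk.1 q.2.2) (fun n => (CoeffWH.norm_le q.1.2 n).2) n
  let Φ : C(coeffSet × unitDisk, ℂ) := ⟨fun q => powSer (fun n => (q.1.1 n).1) (q.2 : ℂ) +
    conj (powSer (fun n => (q.1.1 n).2) (q.2 : ℂ)), c1.add (continuous_conj.comp c2)⟩
  convert! isCompact_range Φ.curry.continuous using 1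
  ext F
  constructor
  · rintro ⟨f, hf, hF⟩
    obtain ⟨a, b, hab, hfab⟩ := exists_coeffWH_of_mem hf
    refine ⟨⟨fun n => (a n, b n), hab⟩, ?_⟩
    ext z
    rw [hF z, hfab z (mem_disk.1 z.2)]
    rfl
  · rintro ⟨⟨p, hp⟩, rfl⟩
    exact ⟨fun z => powSer (fun n => (p n).1) z + conj (powSer (fun n => (p n).2) z),
      CoeffWH.mem_classWH0 hp fun _ _ => rfl, fun z => rfl⟩

/-- Interchange of summations, justified by domination of the double series by 2 t_n |z|^m. -/
theorem hasSum_mul_powSer {t : ℕ → ℝ} (ht : ∀ n, 0 ≤ t n) (hs : Summable t) {c : ℕ → ℕ → ℂ}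
    (hc : ∀ n m, ‖c n m‖ ≤ 2) {z : ℂ} (hz : ‖z‖ < 1) :
    HasSum (fun n => (t n : ℂ) * powSer (c n) z) (powSer (fun m => ∑' n, (t n : ℂ) * c n m) z) := by
  have hu : Summable fun q : ℕ × ℕ => (t q.1 : ℂ) * (c q.1 q.2 * z ^ q.2) := by
    refine Summable.of_norm_bounded ((hs.mul_left 2).mul_of_nonneg
      (summable_geometric_of_lt_one (norm_nonneg z) hz) (fun n => by have := ht n; positivity)
      (fun n => by positivity)) fun q => ?_
    rw [norm_mul, norm_mul, norm_pow, Complex.norm_real, Real.norm_of_nonneg (ht _)]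
    calc t q.1 * (‖c q.1 q.2‖ * ‖z‖ ^ q.2) ≤ t q.1 * (2 * ‖z‖ ^ q.2) :=
          mul_le_mul_of_nonneg_left (mul_le_mul_of_nonneg_right (hc _ _) (by positivity)) (ht _)
      _ = _ := by ring
  have h1 : HasSum (fun n => (t n : ℂ) * powSer (c n) z)
      (∑' q : ℕ × ℕ, (t q.1 : ℂ) * (c q.1 q.2 * z ^ q.2)) :=
    HasSum.prod_fiberwise hu.hasSum fun n =>
      ((radOne_of_bound (hc n)).hasSum hz).mul_left (t n : ℂ)
  have h2 : ∑' q : ℕ × ℕ, (t q.1 : ℂ) * (c q.1 q.2 * z ^ q.2) =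
      ∑' (m : ℕ) (n : ℕ), (t n : ℂ) * (c n m * z ^ m) := by
    rw [hu.tsum_prod]
    exact (Summable.tsum_comm (f := fun n m => (t n : ℂ) * (c n m * z ^ m)) hu).symm
  rw [h2] at h1
  convert! h1 using 1
  rw [powSer]
  refine tsum_congr fun m => ?_
  rw [← tsum_mul_right]
  exact tsum_congr fun n => by ring

theorem coeffWH_tsum {t : ℕ → ℝ} (ht : ∀ n, 0 ≤ t n) (hs : HasSum t 1) {a b : ℕ → ℕ → ℂ}
    (hab : ∀ n, CoeffWH (a n) (b n)) :
    CoeffWH (fun m => ∑' n, (t n : ℂ) * a n m) (fun m => ∑' n, (t n : ℂ) * b n m) := by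
  have ha2 := fun n => norm_le_two fun m => ((hab n).norm_le m).1
  have hb2 := fun n => norm_le_two fun m => ((hab n).norm_le m).2
  have hrad : ∀ c : ℕ → ℕ → ℂ, (∀ n m, ‖c n m‖ ≤ 2) → RadOne fun m => ∑' n, (t n : ℂ) * c n m := by
    intro c hc
    refine radOne_of_bound (B := 2) fun m => ?_
    refine tsum_of_norm_bounded (by simpa using hs.mul_left 2) fun n => ?_
    rw [norm_mul, Complex.norm_real, Real.norm_of_nonneg (ht n), mul_comm]
    exact mul_le_mul_of_nonneg_right (hc n m) (ht n)
  have hch : ∀ c : ℕ → ℕ → ℂ, chichra (fun m => ∑' n, (t n : ℂ) * c n m) =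
      fun m => ∑' n, (t n : ℂ) * chichra (c n) m := by
    intro c
    ext m
    rw [chichra, ← tsum_mul_left, ← tsum_mul_left]
    exact tsum_congr fun n => by rw [chichra]; ring
  refine coeffWH_of_le (hrad a ha2) (hrad b hb2) ?_ ?_ ?_ ?_ fun z hz => ?_
  · simp [(hab _).a_zero]
  · simp only [(hab _).a_one, mul_one]
    rw [← ofReal_tsum, hs.tsum_eq, ofReal_one]
  · simp [(hab _).b_zero]
  · simp [(hab _).b_one]
  · rw [hch, hch]
    have h1 := hasSum_mul_powSer ht hs.summable
      (fun n => norm_chichra_le fun m => ((hab n).norm_le m).1) hz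
    have h2 := hasSum_mul_powSer ht hs.summable
      (fun n => norm_chichra_le fun m => ((hab n).norm_le m).2) hz
    -- Summing the termwise inequalities with weights t_n gives the weak inequality, which is
    -- enough.
    refine h2.norm_le_of_bounded (Complex.hasSum_re h1) fun n => ?_
    rw [norm_mul, Complex.norm_real, Real.norm_of_nonneg (ht n), re_ofReal_mul]
    exact mul_le_mul_of_nonneg_left ((hab n).lt_re z hz).le (ht n)

theorem IsCanonical.taylorCoeff_succ_eq {f h g h' g' : ℂ → ℂ} (hc : IsCanonical f h g)
    (hc' : IsCanonical f h' g') (n : ℕ) :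
    taylorCoeff h (n + 1) = taylorCoeff h' (n + 1) ∧
      taylorCoeff g (n + 1) = taylorCoeff g' (n + 1) := by
  have e1 : Set.EqOn (deriv h) (deriv h') unitDisk := fun z hz => by
    rw [← (hc.dz_dzbar (mem_disk.1 hz)).1, (hc'.dz_dzbar (mem_disk.1 hz)).1]
  have e2 : Set.EqOn (deriv g) (deriv g') unitDisk := fun z hz => by
    apply star_injective
    exact (hc.dz_dzbar (mem_disk.1 hz)).2.symm.trans (hc'.dz_dzbar (mem_disk.1 hz)).2
  simp only [taylorCoeff_succ, taylorCoeff_congr e1, taylorCoeff_congr e2, and_self]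

end HarmonicAnalogue
end

open HarmonicAnalogue

/-! ### Assembly of the theorem -/

theorem theorem3p5 :
    -- coefficient bound, growth bounds and covering disk
    (∀ f ∈ classWH0, ∀ h g : ℂ → ℂ, IsCanonical f h g →
      (∀ n : ℕ, 2 ≤ n → |‖taylorCoeff h n‖ - ‖taylorCoeff g n‖| ≤ 2 / (n : ℝ) ^ 2) ∧
      (∀ z ∈ unitDisk,
        -‖z‖ + 2 * (∫ t in (0 : ℝ)..‖z‖, 1 / t * Real.log (1 + t)) ≤ ‖f z‖ ∧
        ‖f z‖ ≤ -‖z‖ - 2 * (∫ t in (0 : ℝ)..‖z‖, 1 / t * Real.log (1 - t))) ∧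
      Metric.ball (0 : ℂ) (Real.pi ^ 2 / 6 - 1) ⊆ f '' unitDisk) ∧
    -- sharpness
    (extremal ∈ classWH0 ∧
      (∀ h g : ℂ → ℂ, IsCanonical extremal h g → ∀ n : ℕ, 2 ≤ n →
        |‖taylorCoeff h n‖ - ‖taylorCoeff g n‖| = 2 / (n : ℝ) ^ 2) ∧
      (∀ r : ℝ, 0 ≤ r → r < 1 →
        ‖extremal (-(r : ℂ))‖ = -r + 2 * (∫ t in (0 : ℝ)..r, 1 / t * Real.log (1 + t)) ∧
        ‖extremal (r : ℂ)‖ = -r - 2 * (∫ t in (0 : ℝ)..r, 1 / t * Real.log (1 - t))) ∧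
      (∀ R : ℝ, Metric.ball (0 : ℂ) R ⊆ extremal '' unitDisk → R ≤ Real.pi ^ 2 / 6 - 1)) ∧
    -- (i) compactness for locally uniform convergence (the compact-open topology)
    IsCompact {F : C(unitDisk, ℂ) | ∃ f ∈ classWH0, ∀ z : unitDisk, F z = f z} ∧
    -- (ii) radii of starlikeness and close-to-convexity
    (IsRadius StarlikeIn classWH0 1 ∧ IsRadius CloseToConvexIn classWH0 1) ∧
    -- (iii) closure under convolutions
    (∀ f₁ ∈ classWH0, ∀ f₂ ∈ classWH0, ∀ h₁ g₁ h₂ g₂ : ℂ → ℂ,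
      IsCanonical f₁ h₁ g₁ → IsCanonical f₂ h₂ g₂ → harmonicConv h₁ g₁ h₂ g₂ ∈ classWH0) ∧
    -- (iv) convolutions with analytic functions
    (∀ f ∈ classWH0, ∀ h g : ℂ → ℂ, IsCanonical f h g →
      (∀ φ ∈ classK, mixedConv φ h g ∈ classWH0) ∧
      (∀ φ ∈ classA, (∀ z ∈ unitDisk, z ≠ 0 → 1 / 2 < (φ z / z).re) →
        mixedConv φ h g ∈ classWH0) ∧
      (∀ φ ∈ classW, mixedConv φ h g ∈ classWH0 ∩ classSKH0)) ∧
    -- (v) closure under (finite or countable) convex combinations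
    (∀ (f : ℕ → ℂ → ℂ) (t : ℕ → ℝ), (∀ n, f n ∈ classWH0) → (∀ n, 0 ≤ t n) → HasSum t 1 →
      (∀ z ∈ unitDisk, Summable (fun n => (t n : ℂ) * f n z)) ∧
      (fun z => ∑' n, (t n : ℂ) * f n z) ∈ classWH0) := by
  refine ⟨fun f hf h g hc => ?_, ⟨?_, ?_, ?_, fun R hR => extremal_covering_sharp hR⟩,
    isCompact_classWH0, ⟨?_, ?_⟩, ?_, fun f hf h g hc => ⟨fun φ hφ => ?_, fun φ hφ hre => ?_,
    fun φ hφ => ?_⟩, fun f t hf ht hs => ?_⟩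
  · have hab := coeffWH_of_mem hf hc
    refine ⟨fun n hn => ?_, fun z hz => ?_, fun w hw => ?_⟩
    · obtain ⟨m, rfl⟩ := Nat.exists_eq_add_of_le' hn
      have h1 := hab.norm_coeff_add_le m
      have h2 := norm_nonneg (taylorCoeff h (m + 2))
      have h3 := norm_nonneg (taylorCoeff g (m + 2))
      push_cast
      rw [abs_le]
      constructor <;> linarith
    · have hz := mem_disk.1 hz
      rw [integral_log_one_add (norm_nonneg z) hz, integral_log_one_sub (norm_nonneg z) hz,
        hc.eq_powSer hz]
      have h1 := hab.lower_growth hz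
      have h2 := hab.upper_growth hz
      constructor <;> linarith
    · obtain ⟨z, hz, rfl⟩ := hab.ball_subset_image hw
      exact ⟨z, hz, hc.eq_powSer (mem_disk.1 hz)⟩
  · exact coeffWH_extremalCoeff.mem_classWH0 fun z hz => extremal_eq hz
  · intro h g hc n hn
    obtain ⟨m, rfl⟩ := Nat.exists_eq_add_of_le' hn
    obtain ⟨e1, e2⟩ := hc.taylorCoeff_succ_eq
      (coeffWH_extremalCoeff.isCanonical fun z hz => extremal_eq hz) (m + 1)
    rw [e1, e2, taylorCoeff_powSer coeffWH_extremalCoeff.rad_a,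
      taylorCoeff_powSer coeffWH_extremalCoeff.rad_b, extremalCoeff_add_two, Pi.zero_apply,
      norm_zero, sub_zero, abs_norm, norm_div, norm_pow]
    norm_cast
  · intro r h0 h1
    obtain ⟨e1, e2⟩ := norm_extremal h0 h1
    rw [e1, e2, integral_log_one_add h0 h1, integral_log_one_sub h0 h1]
    constructor <;> ring
  · refine ⟨⟨one_pos, le_rfl, fun f hf ρ h0 h1 => ?_⟩, fun r hr => hr.2.1⟩
    obtain ⟨a, b, hab, e⟩ := exists_coeffWH_of_mem hf
    exact hab.starlikeIn e h0 h1
  · refine ⟨⟨one_pos, le_rfl, fun f hf ρ h0 h1 => ?_⟩, fun r hr => hr.2.1⟩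
    obtain ⟨a, b, hab, e⟩ := exists_coeffWH_of_mem hf
    exact hab.closeToConvexIn e h0 h1
  · intro f₁ hf₁ f₂ hf₂ h₁ g₁ h₂ g₂ hc₁ hc₂
    exact ((coeffWH_of_mem hf₁ hc₁).mul (coeffWH_of_mem hf₂ hc₂)).mem_classWH0 fun z _ => rfl
  · have hre : ∀ z : ℂ, ‖z‖ < 1 → z ≠ 0 → 1 / 2 ≤ (φ z / z).re :=
      fun z hz hz0 => half_le_re_div_of_classK hφ hz hz0
    exact ((coeffWH_of_mem hf hc).mul_of_half_le (radOne_taylorCoeff hφ.1.1)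
      ((taylorCoeff_one φ).trans hφ.1.2.2)
      fun z hz => half_le_re_shift_of_half_le hφ.1 hre hz).mem_classWH0 fun z _ => rfl
  · have hre' : ∀ z : ℂ, ‖z‖ < 1 → z ≠ 0 → 1 / 2 ≤ (φ z / z).re :=
      fun z hz hz0 => (hre z (mem_disk.2 hz) hz0).le
    exact ((coeffWH_of_mem hf hc).mul_of_half_le (radOne_taylorCoeff hφ.1)
      ((taylorCoeff_one φ).trans hφ.2.2)
      fun z hz => half_le_re_shift_of_half_le hφ hre' hz).mem_classWH0 fun z _ => rfl
  · have hd := coeffW_of_mem hφ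
    have hab := coeffWH_of_mem hf hc
    refine ⟨(hab.mul_of_half_le hd.rad hd.one fun z hz => hd.half_le_re_shift hz).mem_classWH0
      fun z _ => rfl, hab.mem_classSKH0_of_mul hd fun z _ => rfl⟩
  · choose a b hab e using fun n => exists_coeffWH_of_mem (hf n)
    have key : ∀ z : ℂ, ‖z‖ < 1 → HasSum (fun n => (t n : ℂ) * f n z)
        (powSer (fun m => ∑' n, (t n : ℂ) * a n m) z +
          conj (powSer (fun m => ∑' n, (t n : ℂ) * b n m) z)) := fun z hz => by
      have h1 := hasSum_mul_powSer ht hs.summable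
        (fun n => norm_le_two fun m => ((hab n).norm_le m).1) hz
      have h2 := hasSum_mul_powSer ht hs.summable
        (fun n => norm_le_two fun m => ((hab n).norm_le m).2) hz
      refine (h1.add (Complex.hasSum_conj'.2 h2)).congr_fun fun n => ?_
      rw [e n z hz, map_mul, conj_ofReal, mul_add]
    exact ⟨fun z hz => (key z (mem_disk.1 hz)).summable,
      (coeffWH_tsum ht hs hab).mem_classWH0 fun z hz => (key z hz).tsum_eq⟩
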